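/- Let $k$ be a commutative ring. A graph consists of finite sets of vertices and flags, an incidence map from flags to vertices and an involution $j$ of the flags; the fixed points of $j$ are the tails, the two-element orbits are the edges. A tree is painted if its tails are divided into white and black ones; all halves of edges are declared white. A painted tree is *stable* if every vertex carries at least three flags and every vertex incident to at most one edge carries a white tail. A contraction $f:\tau'\to\tau$ is a composition of contractions of single edges and of isomorphisms (preserving colours); it is given by a map of vertices $\tau'\to\tau$ and a map of flags in the opposite direction. An $S$-tree, for a finite painted set $S$, is a painted stable tree with a colour-preserving bijection of $S$ onto its tails. *Cohomology and homology of painted sets.* A 2-partition of $S$ is stable if each part has at least two elements and contains a white one. Distinct $i,j,p,q\in S$ are allowed if each of the sets $\{i,j\},\{p,q\},\{p,j\},\{i,q\}$ contains a white element; $ij\sigma pq$ means that $i,j$ lie in one part of $\sigma$ and $p,q$ in the other one. Let $H^*_S=k[l_\sigma]/I_S$, with one variable for each unordered stable 2-partition $\sigma$, and $I_S$ generated by $\sum_{ij\sigma pq}l_\sigma-\sum_{pj\sigma iq}l_\sigma$ and by $l_\sigma l_{\sigma'}$ with $ij\sigma pq$, $pj\sigma' iq$, for all allowed $i,j,p,q$.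 For an $S$-tree $T$ and an edge $e$ let $\sigma_e$ be the 2-partition of $S$ defined by deleting $e$, and $m(T)=\prod_e l_{\sigma_e}$. For a stable 2-partition $\alpha$ of the painted set $F_T(v)$ of flags at a vertex $v$ let $T(\alpha)$ be the tree obtained by replacing $v$ by an edge that distributes the flags according to $\alpha$. Let $H_{*S}$ be the free $k$-module on the isomorphism classes $\mu(T)$ of $S$-trees modulo all $\sum_{IJ\alpha KL}\mu(T(\alpha))-\sum_{KJ\alpha IL}\mu(T(\alpha))$ for trees $T$, vertices $v$ and allowed $I,J,K,L\in F_T(v)$. The ring $H^*_S$ acts on $H_{*S}$ by: $l_\sigma\mu(T)=\mu(T(\alpha))$ if $\sigma=\sigma_e$ for the new edge $e$ of $T(\alpha)$; if $\sigma=\sigma_e$ for an edge $e$ of $T$ with halves $e_1,e_2$ at $v_1,v_2$, then $$l_\sigma\mu(T)=-\sum_{\alpha:\,IJ\alpha e_1}\mu(T(\alpha))-\sum_{\beta:\,KL\beta e_2}\mu(T(\beta))$$ for any allowed flags $I,J\ne e_1$ at $v_1$ and $K,L\neq e_2$ at $v_2$, where $\alpha$ and $\beta$ run over the stable 2-partitions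 of $F_T(v_1)$ and $F_T(v_2)$; and $l_\sigma\mu(T)=0$ for all other $\sigma$. (That this action exists is part of the claim.) For a stable tree put $H^*(\tau)=\bigotimes_{v}H^*_{F_\tau(v)}$ and $H_*(\tau)=\bigotimes_vH_{*F_\tau(v)}$ (tensor products over $k$, $v$ running over the vertices), with the componentwise ring structure and action. **Theorem.** (a) *One-edge case.* Let $\sigma=(A_1,A_2)$ be a stable 2-partition of $S$, regarded as a one-edge $S$-tree with the sets of flags $S_1=A_1\cup\{e_1\}$, $S_2=A_2\cup\{e_2\}$ at its vertices, $e_1,e_2$ white. There is a homomorphism of $k$-algebras $f_e^*:H^*_S\to H^*_{S_1}\otimes_k H^*_{S_2}$ with the following values. If a part $B$ of $\rho$ is a proper subset of $A_1$, then $f_e^*(l_\rho)=l_{\rho_1}\otimes1$ with $\rho_1=(B,S_1\setminus B)$; if a part $B$ of $\rho$ is a proper subset of $A_2$, then $f_e^*(l_\rho)=1\otimes l_{\rho_2}$ with $\rho_2=(B,S_2\setminus B)$; if both parts of $\rho$ meet both parts of $\sigma$, then $f_e^*(l_\rho)=0$; and $$f_e^*(l_\sigma)=-\sum_{\alpha:\,ij\alpha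 e_1}l_\alpha\otimes1-\sum_{\beta:\,pq\beta e_2}1\otimes l_\beta$$ for all allowed $i,j,p,q\in S$ with $i,j\in A_1$, $p,q\in A_2$, where $\alpha$ and $\beta$ run over the stable 2-partitions of $S_1$ and $S_2$. The map $f_e^*$ is surjective. For every $S_1$-tree $\tau_1$ and $S_2$-tree $\tau_2$, let $\tau_1\bullet\tau_2$ be the $S$-tree obtained by gluing the tails $e_1$ and $e_2$ to an edge $e$. Then $$f_e^*\Big(\Big[\prod_{e'\ne e}l_{\sigma_{e'}}\Big]\Big)=[m(\tau_1)]\otimes[m(\tau_2)],$$ the product being taken over all edges $e'\neq e$ of $\tau_1\bullet\tau_2$; hence $f_e^*([m(\tau_1\bullet\tau_2)])=f_e^*([l_\sigma])\cdot([m(\tau_1)]\otimes[m(\tau_2)])$. Moreover, there is a $k$-linear map $f_{e*}:H_{*S_1}\otimes_k H_{*S_2}\to H_{*S}$ with $[\mu(\tau_1)]\otimes[\mu(\tau_2)]\mapsto[\mu(\tau_1\bullet\tau_2)]$, and $f_{e*}(f_e^*(a)x)=a f_{e*}(x)$ for all $a$, $x$. (b) *General case.* For every contraction $f:\tau'\to\tau$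 of painted stable trees there are a homomorphism of $k$-algebras $f^*:H^*(\tau)\to H^*(\tau')$ and a $k$-linear map $f_*:H_*(\tau')\to H_*(\tau)$ such that $f_*(f^*(a)x)=a f_*(x)$ for all $a\in H^*(\tau)$, $x\in H_*(\tau')$; $\mathrm{id}^*=\mathrm{id}$, $(f\circ g)^*=g^*\circ f^*$, $\mathrm{id}_*=\mathrm{id}$, $(f\circ g)_*=f_*\circ g_*$; for isomorphisms, $f^*$ and $f_*$ are the obvious relabelings of flags; and, if $f$ contracts one edge $e$ of $\tau'$ to a vertex $v$ of $\tau$, then $f^*$ and $f_*$ are given by the maps $f_e^*$, $f_{e*}$ of (a) between the tensor factor at $v$ and the two factors at the ends of $e$, and by the relabelings of flags at the other vertices. The families $f^*$ and $f_*$ are uniquely determined by functoriality and these values. -/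

import Mathlib

universe u w

open scoped TensorProduct

noncomputable section

namespace PaintedTrees

/-! ### Painted sets and the combinatorial cohomology rings -/

/-- A painted finite set: `white` is the set of white elements, all other elements are black. -/
structure PaintedSet : Type (u + 1) where
  carrier : Type u
  [finite : Finite carrier]
  white : Set carrier

instance : CoeSort PaintedSet.{u} (Type u) := ⟨PaintedSet.carrier⟩

attribute [instance] PaintedSet.finite

/-- Bijections of painted sets that preserve colours. -/
structure PaintedSet.Iso (S T : PaintedSet.{u}) where
  toEquiv : S ≃ T
  white_iff : ∀ s, toEquiv s ∈ T.white ↔ s ∈ S.white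

/-- The 2-partition `(A, Aᶜ)` of the painted set `S` is painted stable: each of the two parts has at
least two elements, at least one of which is white. -/
structure IsStablePart {S : PaintedSet.{u}} (A : Set S) : Prop where
  two_le : 2 ≤ A.ncard
  two_le_compl : 2 ≤ (Aᶜ).ncard
  white : (A ∩ S.white).Nonempty
  white_compl : (Aᶜ ∩ S.white).Nonempty

theorem IsStablePart.compl {S : PaintedSet.{u}} {A : Set S} (h : IsStablePart A) :
    IsStablePart Aᶜ :=
  ⟨h.two_le_compl, by rw [compl_compl]; exact h.two_le, h.white_compl,
    by rw [compl_compl]; exact h.white⟩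

/-- Painted stable 2-partitions of `S` with ordered parts `(A, Aᶜ)`, given by the first part `A`. -/
def OrdPart (S : PaintedSet.{u}) : Type u := {A : Set S // IsStablePart A}

instance (S : PaintedSet.{u}) : Finite (OrdPart S) :=
  inferInstanceAs (Finite {A : Set S // IsStablePart A})

instance (S : PaintedSet.{u}) : Fintype (OrdPart S) := Fintype.ofFinite _

/-- The same partition with its two parts exchanged. -/
def OrdPart.compl {S : PaintedSet.{u}} (A : OrdPart S) : OrdPart S := ⟨A.1ᶜ, A.2.compl⟩

/-- Two ordered 2-partitions are the same unordered 2-partition. -/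
instance OrdPart.setoid (S : PaintedSet.{u}) : Setoid (OrdPart S) where
  r A B := A = B ∨ A = B.compl
  iseqv :=
    { refl := fun _ => Or.inl rfl
      symm := by
        rintro A B (h | h)
        · exact Or.inl h.symm
        · right; subst h; exact Subtype.ext (compl_compl _).symm
      trans := by
        rintro A B C (rfl | rfl) (rfl | rfl)
        · exact Or.inl rfl
        · exact Or.inr rfl
        · exact Or.inr rfl
        · exact Or.inl (Subtype.ext (compl_compl _)) }

/-- Painted stable unordered 2-partitions of `S`. -/
def Part (S : PaintedSet.{u}) : Type u := Quotient (OrdPart.setoid S)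

/-- Transport of a painted stable 2-partition along a bijection of painted sets. -/
def OrdPart.map {S T : PaintedSet.{u}} (φ : S.Iso T) (A : OrdPart S) : OrdPart T :=
  ⟨φ.toEquiv '' A.1, by
    have hc : (φ.toEquiv '' A.1)ᶜ = φ.toEquiv '' (A.1)ᶜ :=
      (Set.image_compl_eq φ.toEquiv.bijective).symm
    obtain ⟨a, ha, haw⟩ := A.2.white
    obtain ⟨b, hb, hbw⟩ := A.2.white_compl
    refine ⟨?_, ?_, ⟨φ.toEquiv a, ⟨a, ha, rfl⟩, (φ.white_iff a).2 haw⟩, ?_⟩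
    · rw [Set.ncard_image_of_injective _ φ.toEquiv.injective]; exact A.2.two_le
    · rw [hc, Set.ncard_image_of_injective _ φ.toEquiv.injective]; exact A.2.two_le_compl
    · rw [hc]; exact ⟨φ.toEquiv b, ⟨b, hb, rfl⟩, (φ.white_iff b).2 hbw⟩⟩

open Classical in
/-- The painted stable 2-partitions `σ` with `i j σ p q`: the elements `i, j` lie in one part of `σ`
(taken as the first one) and the elements `p, q` in the other one. Each unordered partition with
this property is listed exactly once. -/
def sep {S : PaintedSet.{u}} (i j p q : S) : Finset (OrdPart S) :=
  Finset.univ.filter fun A => i ∈ A.1 ∧ j ∈ A.1 ∧ p ∉ A.1 ∧ q ∉ A.1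

/-- The quadruple `i, j, p, q` of pairwise distinct elements is allowed: both partitions
`ij|pq` and `pj|iq` are painted stable (`W` is the set of white elements). -/
def Allowed {X : Type u} (W : Set X) (i j p q : X) : Prop :=
  (i ≠ j ∧ i ≠ p ∧ i ≠ q ∧ j ≠ p ∧ j ≠ q ∧ p ≠ q) ∧
    ((i ∈ W ∨ j ∈ W) ∧ (p ∈ W ∨ q ∈ W)) ∧ ((p ∈ W ∨ j ∈ W) ∧ (i ∈ W ∨ q ∈ W))

section Cohomology

variable (k : Type w) [CommRing k]

/-- The polynomial ring on independent variables indexed by painted stable unordered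
2-partitions. -/
abbrev PolyRing (S : PaintedSet.{u}) : Type (max u w) := MvPolynomial (Part S) k

/-- The variable indexed by the unordered partition `{A, Aᶜ}`. -/
def gen {S : PaintedSet.{u}} (A : OrdPart S) : PolyRing k S :=
  MvPolynomial.X (Quotient.mk (OrdPart.setoid S) A)

/-- The linear relation attached to a quadruple. -/
def linRel {S : PaintedSet.{u}} (i j p q : S) : PolyRing k S :=
  ∑ A ∈ sep i j p q, gen k A - ∑ A ∈ sep p j i q, gen k A

/-- The ideal generated by the linear relations of allowed quadruples, and by the products of two
variables whose partitions separate some allowed quadruple in the two different ways. -/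
def relIdeal (S : PaintedSet.{u}) : Ideal (PolyRing k S) :=
  Ideal.span
    ({x | ∃ i j p q : S, Allowed S.white i j p q ∧ x = linRel k i j p q} ∪
      {x | ∃ i j p q : S, Allowed S.white i j p q ∧
        ∃ A ∈ sep i j p q, ∃ B ∈ sep p j i q, x = gen k A * gen k B})

/-- The combinatorial cohomology ring of the painted set `S`. -/
abbrev Coh (S : PaintedSet.{u}) : Type (max u w) := PolyRing k S ⧸ relIdeal k S

/-- The class in cohomology of the generator indexed by the partition `{A, Aᶜ}`. -/
def cls {S : PaintedSet.{u}} (A : OrdPart S) : Coh k S :=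
  Ideal.Quotient.mk (relIdeal k S) (gen k A)

theorem cls_compl {S : PaintedSet.{u}} (A : OrdPart S) : cls k A.compl = cls k A := by
  unfold cls gen
  rw [Quotient.sound (show A.compl ≈ A from Or.inr rfl)]

end Cohomology

/-! ### Graphs, trees, stability -/

/-- A finite graph given by vertices, flags, the incidence map and an involution on flags. Flags
fixed by the involution are the tails, the other orbits are the edges. The graph is painted:
`white` is the set of white flags, where all halves of edges are declared to be white, so that
`white` amounts to a painting of the tails. -/
structure Graph : Type (u + 1) where
  V : Type u
  F : Type u
  [finV : Finite V]
  [finF : Finite F]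
  bd : F → V
  inv : F → F
  inv_inv : ∀ f, inv (inv f) = f
  white : Set F
  edge_white : ∀ f, inv f ≠ f → f ∈ white

attribute [instance] Graph.finV Graph.finF

namespace Graph

/-- The painted set of flags at a vertex. -/
def flagsAt (G : Graph.{u}) (v : G.V) : PaintedSet.{u} where
  carrier := {f : G.F // G.bd f = v}
  white := {f | f.1 ∈ G.white}

/-- One can pass from `v` to `w` along an edge none of whose halves is in `X`. -/
def Step (G : Graph.{u}) (X : Set G.F) (v w : G.V) : Prop :=
  ∃ f, f ∉ X ∧ G.inv f ∉ X ∧ G.bd f = v ∧ G.bd (G.inv f) = w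

/-- `v` and `w` are joined by a path that does not use the edges with a half in `X`. -/
def Reach (G : Graph.{u}) (X : Set G.F) : G.V → G.V → Prop :=
  Relation.ReflTransGen (G.Step X)

/-- A tree: a non-empty connected graph without cycles (of any length, in particular without
edges from a vertex to itself and without multiple edges), that is, the deletion of any
edge separates its two ends. -/
structure IsTree (G : Graph.{u}) : Prop where
  nonempty : Nonempty G.V
  connected : ∀ v w, G.Reach ∅ v w
  bridge : ∀ f, G.inv f ≠ f → ¬ G.Reach {f} (G.bd f) (G.bd (G.inv f))

/-- Painted stable trees: every vertex carries at least three flags, and every end vertex (a vertex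
incident to at most one edge) carries at least one white tail. -/
structure IsStable (G : Graph.{u}) : Prop extends G.IsTree where
  three_le : ∀ v, 3 ≤ {f | G.bd f = v}.ncard
  end_white : ∀ v, {f | G.bd f = v ∧ G.inv f ≠ f}.Subsingleton →
    ∃ f ∈ G.white, G.bd f = v ∧ G.inv f = f

variable {G : Graph.{u}}

theorem Step.symm {X : Set G.F} {v w : G.V} (h : G.Step X v w) : G.Step X w v := by
  obtain ⟨f, h1, h2, h3, h4⟩ := h
  exact ⟨G.inv f, h2, by rwa [G.inv_inv], h4, by rwa [G.inv_inv]⟩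

theorem Reach.symm {X : Set G.F} {v w : G.V} (h : G.Reach X v w) : G.Reach X w v := by
  induction h with
  | refl => exact .refl
  | tail _ h ih => exact .head h.symm ih

theorem Reach.inv_off {f : G.F} {v w : G.V} (h : G.Reach {f} v w) : G.Reach {G.inv f} v w := by
  refine Relation.ReflTransGen.mono (r := G.Step {f}) (fun a b hab => ?_) _ _ h
  obtain ⟨g, h1, h2, h3, h4⟩ := hab
  refine ⟨g, ?_, ?_, h3, h4⟩
  · rintro rfl
    exact h2 (by simp [G.inv_inv])
  · intro h
    apply h1
    have : G.inv (G.inv g) = G.inv (G.inv f) := congrArg G.inv h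
    simpa [G.inv_inv] using this

theorem reach_inv_iff (f : G.F) (v w : G.V) : G.Reach {G.inv f} v w ↔ G.Reach {f} v w :=
  ⟨fun h => by simpa [G.inv_inv] using h.inv_off, Reach.inv_off⟩

theorem reach_or (hG : G.IsTree) (f : G.F) (w : G.V) :
    G.Reach {f} (G.bd f) w ∨ G.Reach {f} (G.bd (G.inv f)) w := by
  induction hG.connected (G.bd f) w with
  | refl => exact Or.inl .refl
  | @tail x y _ hs ih =>
    obtain ⟨g, -, -, rfl, rfl⟩ := hs
    by_cases h1 : g = f
    · subst h1; exact Or.inr .refl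
    by_cases h2 : G.inv g = f
    · left; rw [h2]; exact .refl
    have hst : G.Step {f} (G.bd g) (G.bd (G.inv g)) := ⟨g, h1, h2, rfl, rfl⟩
    exact ih.imp (fun h => h.tail hst) (fun h => h.tail hst)

theorem bd_ne (hG : G.IsTree) {f : G.F} (hf : G.inv f ≠ f) : G.bd f ≠ G.bd (G.inv f) :=
  fun h => hG.bridge f hf (h ▸ .refl)

theorem inv_ne {f : G.F} (hf : G.inv f ≠ f) : G.inv (G.inv f) ≠ G.inv f := by
  rw [G.inv_inv]; exact hf.symm

/-- In a tree, the part of the tree behind a further edge is smaller. -/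
theorem reach_mono (hG : G.IsTree) {f g : G.F} (hf : G.inv f ≠ f) (hg : G.inv g ≠ g)
    (hgf : g ≠ f) (hbd : G.bd g = G.bd f) {w : G.V}
    (h : G.Reach {g} (G.bd (G.inv g)) w) : G.Reach {f} (G.bd f) w := by
  have hne : G.inv g ≠ f := by
    rintro rfl
    exact bd_ne hG hg hbd
  induction h with
  | refl => exact .single ⟨g, hgf, hne, hbd, rfl⟩
  | @tail x y hx hs ih =>
    have hy := hx.tail hs
    obtain ⟨q, hq1, hq2, rfl, rfl⟩ := hs
    refine ih.tail ⟨q, ?_, ?_, rfl, rfl⟩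
    · rintro rfl
      exact hG.bridge g hg (hbd ▸ Reach.symm hx)
    · intro hq
      rw [Set.mem_singleton_iff.1 hq, ← hbd] at hy
      exact hG.bridge g hg (Reach.symm hy)

theorem branch_aux (hG : G.IsStable) (n : ℕ) : ∀ f : G.F, G.inv f ≠ f →
    {w | G.Reach {f} (G.bd f) w}.ncard ≤ n →
    2 ≤ {t | G.inv t = t ∧ G.Reach {f} (G.bd f) (G.bd t)}.ncard ∧
      ∃ t ∈ G.white, G.inv t = t ∧ G.Reach {f} (G.bd f) (G.bd t) := by
  induction n with
  | zero =>
    intro f _ h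
    have : {w | G.Reach {f} (G.bd f) w} = ∅ := (Set.ncard_eq_zero (Set.toFinite _)).1 (by omega)
    exact absurd (show G.bd f ∈ {w | G.Reach {f} (G.bd f) w} from .refl) (by simp [this])
  | succ n ih =>
    intro f hf hn
    by_cases hs : {g | G.bd g = G.bd f ∧ G.inv g ≠ g}.Subsingleton
    · constructor
      · have h3 := hG.three_le (G.bd f)
        have hsub : {g | G.bd g = G.bd f} \ {f} ⊆
            {t | G.inv t = t ∧ G.Reach {f} (G.bd f) (G.bd t)} := by
          rintro g ⟨hg1, hg2⟩
          refine ⟨?_, ?_⟩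
          · by_contra hc
            exact hg2 (hs ⟨hg1, hc⟩ ⟨rfl, hf⟩)
          · rw [show G.bd g = G.bd f from hg1]; exact .refl
        have h1 := Set.ncard_le_ncard hsub (Set.toFinite _)
        have h2 := Set.ncard_sdiff_singleton_of_mem (a := f) (s := {g | G.bd g = G.bd f}) rfl
        omega
      · obtain ⟨t, ht, h1, h2⟩ := hG.end_white _ hs
        exact ⟨t, ht, h2, by rw [h1]; exact .refl⟩
    · obtain ⟨g, hg, hgf⟩ : ∃ g, (G.bd g = G.bd f ∧ G.inv g ≠ g) ∧ g ≠ f := by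
        by_contra hc
        push Not at hc
        exact hs fun a ha b hb => (hc a ha).trans (hc b hb).symm
      have hsub : ∀ w, G.Reach {G.inv g} (G.bd (G.inv g)) w → G.Reach {f} (G.bd f) w :=
        fun w hw => reach_mono hG.toIsTree hf hg.2 hgf hg.1 ((reach_inv_iff _ _ _).1 hw)
      have hlt : {w | G.Reach {G.inv g} (G.bd (G.inv g)) w}.ncard <
          {w | G.Reach {f} (G.bd f) w}.ncard := by
        refine Set.ncard_lt_ncard ⟨hsub, fun h => ?_⟩ (Set.toFinite _)
        have : G.Reach {G.inv g} (G.bd (G.inv g)) (G.bd f) := h .refl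
        rw [← hg.1, reach_inv_iff] at this
        exact hG.bridge g hg.2 this.symm
      obtain ⟨h1, t, ht, h2, h3⟩ := ih (G.inv g) (inv_ne hg.2) (by omega)
      refine ⟨h1.trans (Set.ncard_le_ncard ?_ (Set.toFinite _)), t, ht, h2, hsub _ h3⟩
      rintro s ⟨hs1, hs2⟩
      exact ⟨hs1, hsub _ hs2⟩

end Graph

/-- A painted stable `S`-tree: a painted stable tree with a bijection `mark` of `S` onto the set of
its tails that preserves colours. -/
structure STree (S : PaintedSet.{u}) : Type (u + 1) where
  graph : Graph.{u}
  stable : graph.IsStable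
  mark : S → graph.F
  mark_inj : Function.Injective mark
  mark_tail : ∀ f, graph.inv f = f ↔ ∃ s, mark s = f
  mark_white : ∀ s, mark s ∈ graph.white ↔ s ∈ S.white

/-- The data of a morphism of graphs `G → H`: a map of flags in the reverse direction and a map of
vertices. -/
@[ext]
structure GMap (G H : Graph.{u}) where
  flag : H.F → G.F
  vert : G.V → H.V

/-- The identity morphism. -/
def GMap.id (G : Graph.{u}) : GMap G G := ⟨fun f => f, fun v => v⟩

/-- The composition of morphisms: first `c`, then `d`. -/
def GMap.comp {G H K : Graph.{u}} (c : GMap G H) (d : GMap H K) : GMap G K :=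
  ⟨c.flag ∘ d.flag, d.vert ∘ c.vert⟩

/-- The conditions common to isomorphisms and contractions: flags of the target are identified with
some flags of the source, compatibly with involutions, incidence and colours. -/
structure GMap.IsCompat {G H : Graph.{u}} (c : GMap G H) : Prop where
  flag_inj : Function.Injective c.flag
  flag_inv : ∀ f, c.flag (H.inv f) = G.inv (c.flag f)
  vert_bd : ∀ f, c.vert (G.bd (c.flag f)) = H.bd f
  white_iff : ∀ f, c.flag f ∈ G.white ↔ f ∈ H.white

/-- Isomorphisms of painted graphs. -/
structure GMap.IsIso {G H : Graph.{u}} (c : GMap G H) : Prop extends c.IsCompat where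
  flag_surj : Function.Surjective c.flag
  vert_bij : Function.Bijective c.vert

/-- `c` contracts the edge `{e, inv e}`: the flags of the target are the flags of the source
other than `e` and `inv e`, the two ends of the edge are glued together, and the map of
vertices is a bijection elsewhere. -/
structure GMap.IsEdgeContraction {G H : Graph.{u}} (c : GMap G H) (e : G.F) : Prop
    extends c.IsCompat where
  edge : G.inv e ≠ e
  flag_range : ∀ f, (∃ f', c.flag f' = f) ↔ f ≠ e ∧ f ≠ G.inv e
  vert_surj : Function.Surjective c.vert
  vert_eq : ∀ v w, c.vert v = c.vert w ↔
    v = w ∨ (v = G.bd e ∧ w = G.bd (G.inv e)) ∨ (v = G.bd (G.inv e) ∧ w = G.bd e)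

theorem GMap.isIso_id (G : Graph.{u}) : (GMap.id G).IsIso where
  flag_inj := fun _ _ h => h
  flag_inv := fun _ => rfl
  vert_bd := fun _ => rfl
  white_iff := fun _ => Iff.rfl
  flag_surj := fun f => ⟨f, rfl⟩
  vert_bij := Function.bijective_id

theorem GMap.IsIso.comp {G H K : Graph.{u}} {c : GMap G H} {d : GMap H K} (hc : c.IsIso)
    (hd : d.IsIso) : (c.comp d).IsIso where
  flag_inj := hc.flag_inj.comp hd.flag_inj
  flag_inv := fun f => by simp [GMap.comp, hc.flag_inv, hd.flag_inv]
  vert_bd := fun f => by simp [GMap.comp, hc.vert_bd, hd.vert_bd]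
  white_iff := fun f => by simp [GMap.comp, hc.white_iff, hd.white_iff]
  flag_surj := hc.flag_surj.comp hd.flag_surj
  vert_bij := hd.vert_bij.comp hc.vert_bij

theorem GMap.IsIso.exists_inv {G H : Graph.{u}} {c : GMap G H} (hc : c.IsIso) :
    ∃ d : GMap H G, d.IsIso ∧ ∀ f, d.flag (c.flag f) = f := by
  obtain ⟨a, ha1, ha2⟩ := Function.bijective_iff_has_inverse.1 ⟨hc.flag_inj, hc.flag_surj⟩
  obtain ⟨b, hb1, hb2⟩ := Function.bijective_iff_has_inverse.1 hc.vert_bij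
  refine ⟨⟨a, b⟩, ?_, ha1⟩
  refine
    { flag_inj := ha2.injective
      flag_inv := fun f => ?_
      vert_bd := fun f => ?_
      white_iff := fun f => ?_
      flag_surj := ha1.surjective
      vert_bij := ⟨hb2.injective, hb1.surjective⟩ }
  · apply hc.flag_inj
    change c.flag (a (G.inv f)) = c.flag (H.inv (a f))
    rw [ha2, hc.flag_inv, ha2]
  · change b (H.bd (a f)) = G.bd f
    rw [← hc.vert_bd, ha2, hb1]
  · change a f ∈ H.white ↔ _
    rw [← hc.white_iff, ha2]

/-- `S`-isomorphism of painted stable `S`-trees. -/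
instance STree.setoid (S : PaintedSet.{u}) : Setoid (STree S) where
  r T T' := ∃ c : GMap T.graph T'.graph, c.IsIso ∧ ∀ s, c.flag (T'.mark s) = T.mark s
  iseqv :=
    { refl := fun T => ⟨GMap.id _, GMap.isIso_id _, fun _ => rfl⟩
      symm := by
        rintro T T' ⟨c, hc, h⟩
        obtain ⟨d, hd, h'⟩ := hc.exists_inv
        exact ⟨d, hd, fun s => by rw [← h, h']⟩
      trans := by
        rintro T T' T'' ⟨c, hc, h⟩ ⟨d, hd, h'⟩
        exact ⟨c.comp d, hc.comp hd, fun s => by simp [GMap.comp, h, h']⟩ }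

namespace STree

variable {S : PaintedSet.{u}}

/-- Change of the labels of the tails along a bijection of painted sets. -/
def relabel {S' : PaintedSet.{u}} (φ : S'.Iso S) (T : STree S) : STree S' where
  graph := T.graph
  stable := T.stable
  mark := fun s => T.mark (φ.toEquiv s)
  mark_inj := T.mark_inj.comp φ.toEquiv.injective
  mark_tail := fun f => by rw [T.mark_tail, φ.toEquiv.surjective.exists]
  mark_white := fun s => (T.mark_white _).trans (φ.white_iff s)

/-- The flags of the tree that are halves of edges. -/
def EdgeFlag (T : STree S) : Type u := {f : T.graph.F // T.graph.inv f ≠ f}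

/-- The other half of the same edge. -/
def EdgeFlag.flip {T : STree S} (f : T.EdgeFlag) : T.EdgeFlag :=
  ⟨T.graph.inv f.1, Graph.inv_ne f.2⟩

/-- The 2-partition `σ_e` of the set of labels defined by an edge `e` of the tree. As an ordered
partition it depends on the choice of a half `f` of the edge: the first part consists of the
labels of the tails that stay connected to the vertex of `f` after the deletion of the edge. -/
def part (T : STree S) (f : T.EdgeFlag) : OrdPart S :=
  ⟨{s | T.graph.Reach {f.1} (T.graph.bd f.1) (T.graph.bd (T.mark s))}, by
    have key : ∀ g : T.EdgeFlag,
        2 ≤ {s | T.graph.Reach {g.1} (T.graph.bd g.1) (T.graph.bd (T.mark s))}.ncard ∧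
          ({s | T.graph.Reach {g.1} (T.graph.bd g.1) (T.graph.bd (T.mark s))} ∩
            S.white).Nonempty := by
      intro g
      obtain ⟨h1, t, ht, h2, h3⟩ := Graph.branch_aux T.stable _ g.1 g.2 le_rfl
      constructor
      · rw [← Set.ncard_image_of_injective _ T.mark_inj]
        refine h1.trans (Set.ncard_le_ncard ?_ (Set.toFinite _))
        rintro x ⟨hx1, hx2⟩
        obtain ⟨s, rfl⟩ := (T.mark_tail x).1 hx1
        exact ⟨s, hx2, rfl⟩
      · obtain ⟨s, rfl⟩ := (T.mark_tail t).1 h2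
        exact ⟨s, h3, (T.mark_white s).1 ht⟩
    have hc : {s | T.graph.Reach {f.1} (T.graph.bd f.1) (T.graph.bd (T.mark s))}ᶜ =
        {s | T.graph.Reach {f.flip.1} (T.graph.bd f.flip.1) (T.graph.bd (T.mark s))} := by
      ext s
      simp only [Set.mem_compl_iff, Set.mem_ofPred_eq, EdgeFlag.flip, Graph.reach_inv_iff]
      constructor
      · exact (Graph.reach_or T.stable.toIsTree f.1 _).resolve_left
      · exact fun h h' => T.stable.bridge f.1 f.2 (h'.trans h.symm)
    refine ⟨(key f).1, ?_, (key f).2, ?_⟩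
    · rw [hc]; exact (key f.flip).1
    · rw [hc]; exact (key f.flip).2⟩

theorem part_flip (T : STree S) (f : T.EdgeFlag) : T.part f.flip = (T.part f).compl := by
  apply Subtype.ext
  ext s
  simp only [part, OrdPart.compl, Set.mem_compl_iff, Set.mem_ofPred_eq, EdgeFlag.flip,
    Graph.reach_inv_iff]
  constructor
  · exact fun h h' => T.stable.bridge f.1 f.2 (h'.trans h.symm)
  · exact (Graph.reach_or T.stable.toIsTree f.1 _).resolve_left

/-- Two halves belong to the same edge. -/
instance edgeSetoid (T : STree S) : Setoid T.EdgeFlag where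
  r f g := f = g ∨ f = g.flip
  iseqv :=
    { refl := fun _ => Or.inl rfl
      symm := by
        rintro f g (h | h)
        · exact Or.inl h.symm
        · right; subst h; exact Subtype.ext (T.graph.inv_inv _).symm
      trans := by
        rintro f g h (rfl | rfl) (rfl | rfl)
        · exact Or.inl rfl
        · exact Or.inr rfl
        · exact Or.inr rfl
        · exact Or.inl (Subtype.ext (T.graph.inv_inv _)) }

/-- The edges of the tree. -/
def Edge (T : STree S) : Type u := Quotient T.edgeSetoid

instance (T : STree S) : Finite T.EdgeFlag :=
  inferInstanceAs (Finite {f : T.graph.F // T.graph.inv f ≠ f})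

instance (T : STree S) : Finite T.Edge := inferInstanceAs (Finite (Quotient T.edgeSetoid))

instance (T : STree S) : Fintype T.Edge := Fintype.ofFinite _

/-- The edge with a given half. -/
def EdgeFlag.edge {T : STree S} (f : T.EdgeFlag) : T.Edge := Quotient.mk T.edgeSetoid f

/-- The class in cohomology of the generator indexed by the partition `σ_e`. -/
def edgeCls (k : Type w) [CommRing k] (T : STree S) (e : T.Edge) : Coh k S :=
  Quotient.lift (fun f : T.EdgeFlag => cls k (T.part f)) (by
    rintro f g (rfl | rfl)
    · rfl
    · exact (congrArg (cls k) (T.part_flip g)).trans (cls_compl k _)) e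

/-- The class `[m(T)]` of the good monomial of a tree: the product of the generators indexed by the
partitions `σ_e` over all edges `e`. -/
def monomialCls (k : Type w) [CommRing k] (T : STree S) : Coh k S :=
  ∏ e : T.Edge, T.edgeCls k e

open Classical in
/-- The same product over all edges different from the edge `e₀`. -/
def monomialClsErase (k : Type w) [CommRing k] (T : STree S) (e₀ : T.Edge) : Coh k S :=
  ∏ e ∈ Finset.univ.erase e₀, T.edgeCls k e

end STree

/-! ### Insertion of an edge at a vertex -/

namespace Graph

open Classical in
/-- The graph obtained from `G` by replacing the vertex `v` by an edge. The new vertex `none` carries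
the flags of `v` that belong to `A` and the half `Sum.inr true` of the new edge; the vertex
`some v` keeps the other flags of `v` and carries the half `Sum.inr false` of the new edge. -/
def insert (G : Graph.{u}) (v : G.V) (A : Set (G.flagsAt v)) : Graph.{u} where
  V := Option G.V
  F := G.F ⊕ Bool
  bd := Sum.elim (fun f => if f ∈ Subtype.val '' A then none else some (G.bd f))
    (fun b => if b = true then none else some v)
  inv := Sum.map G.inv not
  inv_inv := by rintro (f | b) <;> simp [G.inv_inv]
  white := {x | Sum.elim (fun f => f ∈ G.white) (fun _ => True) x}
  edge_white := by
    rintro (f | b) h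
    · exact G.edge_white f fun h' => h (by simp [h'])
    · trivial

variable {G : Graph.{u}} {v : G.V} {A : Set (G.flagsAt v)}

theorem insert_bd_pos {f : G.F} (h : f ∈ Subtype.val '' A) :
    (G.insert v A).bd (Sum.inl f) = none := if_pos h

theorem insert_bd_neg {f : G.F} (h : f ∉ Subtype.val '' A) :
    (G.insert v A).bd (Sum.inl f) = some (G.bd f) := if_neg h

theorem bd_of_mem {f : G.F} (h : f ∈ Subtype.val '' A) : G.bd f = v := by
  obtain ⟨x, _, rfl⟩ := h
  exact x.2

theorem insert_proj (f : G.F) :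
    ((G.insert v A).bd (Sum.inl f)).getD v = G.bd f := by
  by_cases h : f ∈ Subtype.val '' A
  · rw [insert_bd_pos h, Option.getD_none, bd_of_mem h]
  · rw [insert_bd_neg h, Option.getD_some]

theorem insert_new : (G.insert v A).Step ∅ none (some v) :=
  ⟨Sum.inr true, id, id, rfl, rfl⟩

theorem insert_some (f : G.F) :
    (G.insert v A).Reach ∅ (some (G.bd f)) ((G.insert v A).bd (Sum.inl f)) := by
  by_cases h : f ∈ Subtype.val '' A
  · rw [insert_bd_pos h, bd_of_mem h]
    exact .single insert_new.symm
  · rw [insert_bd_neg h]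
    exact .refl

theorem insert_reach {w w' : G.V} (h : G.Reach ∅ w w') :
    (G.insert v A).Reach ∅ (some w) (some w') := by
  induction h with
  | refl => exact .refl
  | tail _ hs ih =>
    obtain ⟨f, -, -, rfl, rfl⟩ := hs
    exact ((ih.trans (insert_some f)).tail ⟨Sum.inl f, id, id, rfl, rfl⟩).trans
      (insert_some (G.inv f)).symm

theorem insert_proj_reach {f : G.F} {w w' : Option G.V}
    (h : (G.insert v A).Reach {Sum.inl f} w w') : G.Reach {f} (w.getD v) (w'.getD v) := by
  induction h with
  | refl => exact .refl
  | tail _ hs ih =>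
    obtain ⟨g | b, h1, h2, rfl, rfl⟩ := hs
    · refine ih.tail ⟨g, ?_, ?_, (insert_proj g).symm, (insert_proj (G.inv g)).symm⟩
      · rintro rfl; exact h1 rfl
      · intro h; exact h2 (congrArg Sum.inl h)
    · have : ∀ b, Option.getD ((G.insert v A).bd (Sum.inr b)) v = v := by
        rintro (_ | _) <;> rfl
      rw [this] at ih
      change G.Reach _ _ (Option.getD ((G.insert v A).bd (Sum.inr (!b))) v)
      rwa [this]

theorem insert_isTree (hG : G.IsTree) (v : G.V) (A : Set (G.flagsAt v)) :
    (G.insert v A).IsTree where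
  nonempty := ⟨none⟩
  connected := by
    have key : ∀ w, (G.insert v A).Reach ∅ (some v) w := by
      rintro (_ | w)
      · exact .single insert_new.symm
      · exact insert_reach (hG.connected v w)
    exact fun w w' => (key w).symm.trans (key w')
  bridge := by
    have new : ¬ (G.insert v A).Reach {Sum.inr true} none (some v) := by
      intro h
      have inv : ∀ w, (G.insert v A).Reach {Sum.inr true} none w →
          w = none ∨ ∃ f ∈ Subtype.val '' A, ∃ x, w = some x ∧ G.inv f ≠ f ∧
            G.Reach {f} (G.bd (G.inv f)) x := by
        intro w hw
        induction hw with
        | refl => exact Or.inl rfl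
        | @tail x y _ hs ih =>
          obtain ⟨g | b, h1, h2, h3, h4⟩ := hs
          · change (G.insert v A).bd (Sum.inl (G.inv g)) = y at h4
            by_cases hy : G.inv g ∈ Subtype.val '' A
            · left; rw [← h4, insert_bd_pos hy]
            rw [insert_bd_neg hy] at h4
            right
            by_cases hx : g ∈ Subtype.val '' A
            · refine ⟨g, hx, _, h4.symm, ?_, .refl⟩
              intro h; rw [h] at hy; exact hy hx
            · rw [insert_bd_neg hx] at h3
              rcases ih with ih | ⟨f, hf, z, hz, hne, hr⟩
              · rw [← h3] at ih; simp at ih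
              · rw [← h3] at hz
                obtain rfl := Option.some.inj hz
                refine ⟨f, hf, _, h4.symm, hne, hr.tail ⟨g, ?_, ?_, rfl, rfl⟩⟩
                · rintro rfl; exact hx hf
                · intro h
                  rw [Set.mem_singleton_iff.1 h] at hy; exact hy hf
          · exfalso
            cases b
            · exact h2 rfl
            · exact h1 rfl
      rcases inv _ h with h | ⟨f, hf, x, hx, hne, hr⟩
      · simp at h
      · obtain rfl := Option.some.inj hx
        have hb := bd_of_mem hf
        exact hG.bridge f hne (by rw [hb]; exact hr.symm)
    rintro (f | b) hf h
    · have hf' : G.inv f ≠ f := fun h' => hf (congrArg Sum.inl h')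
      have := insert_proj_reach h
      rw [insert_proj] at this
      change G.Reach {f} (G.bd f) (Option.getD ((G.insert v A).bd (Sum.inl (G.inv f))) v) at this
      rw [insert_proj] at this
      exact hG.bridge f hf' this
    · cases b
      · exact new ((reach_inv_iff (G := G.insert v A) (Sum.inr true) _ _).1 h).symm
      · exact new h

theorem insert_isStable (hG : G.IsStable) (v : G.V) (A : Set (G.flagsAt v))
    (hA : IsStablePart A) : (G.insert v A).IsStable where
  toIsTree := insert_isTree hG.toIsTree v A
  three_le := by
    have aux : ∀ (B : Set (G.flagsAt v)) (b : Bool) (w : Option G.V), 2 ≤ B.ncard →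
        (∀ x ∈ B, (G.insert v A).bd (Sum.inl x.1) = w) → (G.insert v A).bd (Sum.inr b) = w →
        3 ≤ {f | (G.insert v A).bd f = w}.ncard := by
      intro B b w hB h1 h2
      have hi : Function.Injective (fun x : G.flagsAt v => (Sum.inl x.1 : G.F ⊕ Bool)) :=
        fun x y h => Subtype.ext (Sum.inl.inj h)
      have h3 : ((fun x : G.flagsAt v => (Sum.inl x.1 : G.F ⊕ Bool)) '' B).ncard = B.ncard :=
        Set.ncard_image_of_injective _ hi
      have h4 : (Sum.inr b : G.F ⊕ Bool) ∉
          (fun x : G.flagsAt v => (Sum.inl x.1 : G.F ⊕ Bool)) '' B := by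
        rintro ⟨x, _, hx⟩; simp at hx
      have h5 := Set.ncard_insert_of_notMem h4 (Set.toFinite _)
      have h6 : Insert.insert (Sum.inr b : G.F ⊕ Bool)
          ((fun x : G.flagsAt v => (Sum.inl x.1 : G.F ⊕ Bool)) '' B) ⊆
          {f | (G.insert v A).bd f = w} := by
        rintro _ (rfl | ⟨x, hx, rfl⟩)
        · exact h2
        · exact h1 x hx
      have h7 := Set.ncard_le_ncard (t := {f : G.F ⊕ Bool | (G.insert v A).bd f = w}) h6
        (Set.toFinite _)
      change 3 ≤ ({f : G.F ⊕ Bool | (G.insert v A).bd f = w}).ncard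
      omega
    rintro (_ | w)
    · exact aux A true _ hA.two_le (fun x hx => insert_bd_pos ⟨x, hx, rfl⟩) rfl
    · by_cases hw : w = v
      · subst hw
        refine aux Aᶜ false _ hA.two_le_compl (fun x hx => ?_) rfl
        rw [insert_bd_neg, x.2]
        rintro ⟨y, hy, hyx⟩
        exact hx (Subtype.ext hyx ▸ hy)
      · have h3 := hG.three_le w
        rw [← Set.ncard_image_of_injective _ (Sum.inl_injective (β := Bool))] at h3
        refine h3.trans (Set.ncard_le_ncard ?_ (Set.toFinite _))
        rintro _ ⟨f, hf, rfl⟩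
        change (G.insert v A).bd (Sum.inl f) = some w
        rw [insert_bd_neg, show G.bd f = w from hf]
        intro h
        exact hw ((show G.bd f = w from hf).symm.trans (bd_of_mem h))
  end_white := by
    have aux : ∀ (x : G.flagsAt v) (b : Bool) (w : Option G.V), x ∈ (G.flagsAt v).white →
        (G.insert v A).bd (Sum.inl x.1) = w → (G.insert v A).bd (Sum.inr b) = w →
        {f | (G.insert v A).bd f = w ∧ (G.insert v A).inv f ≠ f}.Subsingleton →
        ∃ f ∈ (G.insert v A).white, (G.insert v A).bd f = w ∧ (G.insert v A).inv f = f := by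
      intro x b w hx h1 h2 hs
      refine ⟨Sum.inl x.1, hx, h1, ?_⟩
      by_contra hc
      have : (Sum.inr b : G.F ⊕ Bool) = Sum.inl x.1 := hs
        ⟨h2, fun h => by
          have h' : (!b) = b := Sum.inr.inj h
          cases b <;> simp at h'⟩ ⟨h1, hc⟩
      simp at this
    rintro (_ | w) hs
    · obtain ⟨x, hx, hxw⟩ := hA.white
      exact aux x true _ hxw (insert_bd_pos ⟨x, hx, rfl⟩) rfl hs
    · by_cases hw : w = v
      · subst hw
        obtain ⟨x, hx, hxw⟩ := hA.white_compl
        refine aux x false _ hxw ?_ rfl hs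
        rw [insert_bd_neg, x.2]
        rintro ⟨y, hy, hyx⟩
        exact hx (Subtype.ext hyx ▸ hy)
      · have hbd : ∀ f, G.bd f = w → (G.insert v A).bd (Sum.inl f) = some w := by
          intro f hf
          rw [insert_bd_neg, hf]
          intro h
          exact hw (hf.symm.trans (bd_of_mem h))
        obtain ⟨f, hf, h1, h2⟩ := hG.end_white w (fun a ha b hb => Sum.inl.inj
          (hs ⟨hbd a ha.1, fun h => ha.2 (Sum.inl.inj h)⟩
            ⟨hbd b hb.1, fun h => hb.2 (Sum.inl.inj h)⟩))
        exact ⟨Sum.inl f, hf, hbd f h1, congrArg Sum.inl h2⟩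

end Graph

namespace STree

variable {S : PaintedSet.{u}}

/-- The `S`-tree `T(A)` obtained from `T` by inserting an edge at the vertex `v` that breaks the set
of flags at `v` according to the painted stable 2-partition `(A, Aᶜ)`. -/
def insert (T : STree S) (v : T.graph.V) (A : OrdPart (T.graph.flagsAt v)) : STree S where
  graph := T.graph.insert v A.1
  stable := Graph.insert_isStable T.stable v A.1 A.2
  mark := fun s => Sum.inl (T.mark s)
  mark_inj := Sum.inl_injective.comp T.mark_inj
  mark_tail := by
    rintro (f | b)
    · constructor
      · intro h
        obtain ⟨s, hs⟩ := (T.mark_tail f).1 (Sum.inl.inj h)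
        exact ⟨s, congrArg Sum.inl hs⟩
      · rintro ⟨s, hs⟩
        exact congrArg Sum.inl ((T.mark_tail f).2 ⟨s, Sum.inl.inj hs⟩)
    · constructor
      · intro h
        have h' : (!b) = b := Sum.inr.inj h
        cases b <;> simp at h'
      · rintro ⟨s, hs⟩
        cases hs
  mark_white := fun s => T.mark_white s

/-- The new edge of `T(A)` (its half at the vertex that carries the flags in `A`). -/
def newEdge (T : STree S) (v : T.graph.V) (A : OrdPart (T.graph.flagsAt v)) :
    (T.insert v A).EdgeFlag :=
  ⟨Sum.inr true, fun h => by
    have h' : (!true) = true := Sum.inr.inj h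
    simp at h'⟩

end STree

/-! ### Homology modules and the action of cohomology -/

section Homology

variable (k : Type w) [CommRing k]

/-- The free module on the `S`-isomorphism classes of painted stable `S`-trees. -/
abbrev TreeModule (S : PaintedSet.{u}) : Type (max (u + 1) w) :=
  Quotient (STree.setoid S) →₀ k

/-- The generator given by the isomorphism class of a tree. -/
def muFree {S : PaintedSet.{u}} (T : STree S) : TreeModule k S :=
  Finsupp.single (Quotient.mk (STree.setoid S) T) 1

/-- The standard relation attached to a tree, a vertex and a quadruple of flags at this vertex. -/
def stdRel {S : PaintedSet.{u}} (T : STree S) (v : T.graph.V) (I J K L : T.graph.flagsAt v) :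
    TreeModule k S :=
  ∑ A ∈ sep I J K L, muFree k (T.insert v A) - ∑ A ∈ sep K J I L, muFree k (T.insert v A)

/-- The submodule spanned by the standard relations of allowed quadruples of flags. -/
def relSubmodule (S : PaintedSet.{u}) : Submodule k (TreeModule k S) :=
  Submodule.span k {x | ∃ (T : STree S) (v : T.graph.V) (I J K L : T.graph.flagsAt v),
    Allowed (T.graph.flagsAt v).white I J K L ∧ x = stdRel k T v I J K L}

/-- The combinatorial homology module of the painted set `S`. -/
abbrev Hlg (S : PaintedSet.{u}) : Type (max (u + 1) w) := TreeModule k S ⧸ relSubmodule k S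

/-- The class `[μ(T)]` of a tree in homology. -/
def mu {S : PaintedSet.{u}} (T : STree S) : Hlg k S :=
  (relSubmodule k S).mkQ (muFree k T)

/-- The partition `σ` breaks the tree at an edge: `σ = σ_e` for an edge `e`. -/
def STree.BreaksAtEdge {S : PaintedSet.{u}} (T : STree S) (σ : OrdPart S) : Prop :=
  ∃ f : T.EdgeFlag, T.part f = σ

/-- The partition `σ` breaks the tree at a vertex: `σ = σ_e` for the new edge `e` of a tree that is
obtained by the insertion of an edge at a vertex. -/
def STree.BreaksAtVertex {S : PaintedSet.{u}} (T : STree S) (σ : OrdPart S) : Prop :=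
  ∃ (v : T.graph.V) (A : OrdPart (T.graph.flagsAt v)), (T.insert v A).part (T.newEdge v A) = σ

/-- A homomorphism from the cohomology ring to the endomorphisms of the homology module is the
action given by the multiplication table of partitions and trees. -/
structure IsAction {S : PaintedSet.{u}} (act : Coh k S →ₐ[k] Module.End k (Hlg k S)) : Prop where
  not_break : ∀ (T : STree S) (σ : OrdPart S), ¬ T.BreaksAtEdge σ → ¬ T.BreaksAtVertex σ →
    act (cls k σ) (mu k T) = 0
  break_vertex : ∀ (T : STree S) (v : T.graph.V) (A : OrdPart (T.graph.flagsAt v)),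
    act (cls k ((T.insert v A).part (T.newEdge v A))) (mu k T) = mu k (T.insert v A)
  break_edge : ∀ (T : STree S) (e : T.EdgeFlag)
    (I J : T.graph.flagsAt (T.graph.bd e.1)) (K L : T.graph.flagsAt (T.graph.bd e.flip.1)),
    I.1 ≠ e.1 → J.1 ≠ e.1 → K.1 ≠ e.flip.1 → L.1 ≠ e.flip.1 →
    Allowed T.graph.white I.1 J.1 K.1 L.1 →
    act (cls k (T.part e)) (mu k T) =
      - ∑ A ∈ sep I J ⟨e.1, rfl⟩ ⟨e.1, rfl⟩, mu k (T.insert (T.graph.bd e.1) A)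
      - ∑ B ∈ sep K L ⟨e.flip.1, rfl⟩ ⟨e.flip.1, rfl⟩, mu k (T.insert (T.graph.bd e.flip.1) B)

end Homology

/-! ### One-edge trees and gluing -/

/-- A painted stable one-edge `S`-tree. The sets of flags at its two vertices are `S₁` and `S₂`, the
halves of the edge are `e₁` and `e₂`, and the set `S` of tails is identified by `toSum` with
the set of the remaining flags. -/
structure OneEdge (S S₁ S₂ : PaintedSet.{u}) where
  e₁ : S₁
  e₂ : S₂
  e₁_white : e₁ ∈ S₁.white
  e₂_white : e₂ ∈ S₂.white
  toSum : S → S₁ ⊕ S₂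
  toSum_inj : Function.Injective toSum
  toSum_range : ∀ x, (∃ s, toSum s = x) ↔ x ≠ Sum.inl e₁ ∧ x ≠ Sum.inr e₂
  white_iff : ∀ s, Sum.elim (· ∈ S₁.white) (· ∈ S₂.white) (toSum s) ↔ s ∈ S.white
  stable : IsStablePart {s | ∃ x, toSum s = Sum.inl x}

namespace OneEdge

variable {S S₁ S₂ : PaintedSet.{u}}

/-- The 2-partition `σ` of `S` given by the one-edge tree. -/
def part (D : OneEdge S S₁ S₂) : OrdPart S := ⟨{s | ∃ x, D.toSum s = Sum.inl x}, D.stable⟩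

theorem not_left_iff (D : OneEdge S S₁ S₂) (s : S) :
    (¬ ∃ x, D.toSum s = Sum.inl x) ↔ ∃ x, D.toSum s = Sum.inr x := by
  rcases h : D.toSum s with x | x <;> simp

/-- The same tree with its two vertices exchanged. -/
def swap (D : OneEdge S S₁ S₂) : OneEdge S S₂ S₁ where
  e₁ := D.e₂
  e₂ := D.e₁
  e₁_white := D.e₂_white
  e₂_white := D.e₁_white
  toSum := fun s => (D.toSum s).swap
  toSum_inj := fun s t h => D.toSum_inj (Sum.swap_leftInverse.injective h)
  toSum_range := by
    intro x
    have h := D.toSum_range x.swap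
    constructor
    · rintro ⟨s, rfl⟩
      have := h.1 ⟨s, by simp⟩
      constructor
      · intro hx; apply this.2; rw [hx]; rfl
      · intro hx; apply this.1; rw [hx]; rfl
    · rintro ⟨h1, h2⟩
      obtain ⟨s, hs⟩ := h.2 ⟨fun hx => h2 (by rw [← Sum.swap_swap x, hx]; rfl),
        fun hx => h1 (by rw [← Sum.swap_swap x, hx]; rfl)⟩
      exact ⟨s, by rw [hs, Sum.swap_swap]⟩
  white_iff := by
    intro s
    rw [← D.white_iff]
    rcases D.toSum s with x | x <;> rfl
  stable := by
    have : {s | ∃ x, (D.toSum s).swap = Sum.inl x} = {s | ∃ x, D.toSum s = Sum.inl x}ᶜ := by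
      ext s
      rcases h : D.toSum s with x | x <;> simp [h]
    rw [this]
    exact D.stable.compl

theorem swap_part (D : OneEdge S S₁ S₂) : D.swap.part = D.part.compl := by
  apply Subtype.ext
  ext s
  rcases h : D.toSum s with x | x <;> simp [part, OrdPart.compl, swap, h]

/-- Let the partition `(B, Bᶜ)` of `S` break the one-edge tree at its first vertex, `B` being a
proper subset of the set of tails at this vertex. This is the induced partition of the set
`S₁` of flags of the first vertex: one part is `B`, the other one contains the half-edge. -/
def restrict (D : OneEdge S S₁ S₂) (B : OrdPart S) (h : B.1 ⊂ D.part.1) : OrdPart S₁ :=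
  ⟨{x | ∃ s ∈ B.1, D.toSum s = Sum.inl x}, by
    have hinl : (Sum.inl '' {x | ∃ s ∈ B.1, D.toSum s = Sum.inl x} : Set (S₁ ⊕ S₂)) =
        D.toSum '' B.1 := by
      ext y
      constructor
      · rintro ⟨x, ⟨s, hs, hx⟩, rfl⟩; exact ⟨s, hs, hx⟩
      · rintro ⟨s, hs, rfl⟩
        obtain ⟨x, hx⟩ := h.1 hs
        exact ⟨x, ⟨s, hs, hx⟩, hx.symm⟩
    have he : D.e₁ ∈ {x | ∃ s ∈ B.1, D.toSum s = Sum.inl x}ᶜ := by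
      rintro ⟨s, _, hs⟩
      exact ((D.toSum_range _).1 ⟨s, hs⟩).1 rfl
    refine ⟨?_, ?_, ?_, ⟨D.e₁, he, D.e₁_white⟩⟩
    · rw [← Set.ncard_image_of_injective _ (Sum.inl_injective (β := S₂)), hinl,
        Set.ncard_image_of_injective _ D.toSum_inj]
      exact B.2.two_le
    · obtain ⟨s, ⟨x, hx⟩, hsB⟩ := Set.exists_of_ssubset h
      have hxm : x ∈ {x | ∃ s ∈ B.1, D.toSum s = Sum.inl x}ᶜ := by
        rintro ⟨t, ht, htx⟩
        exact hsB (D.toSum_inj (hx.trans htx.symm) ▸ ht)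
      have hne : x ≠ D.e₁ := by
        rintro rfl
        exact ((D.toSum_range _).1 ⟨s, hx⟩).1 rfl
      exact (Set.one_lt_ncard (Set.toFinite _)).2 ⟨x, hxm, D.e₁, he, hne⟩
    · obtain ⟨s, hs, hw⟩ := B.2.white
      obtain ⟨x, hx⟩ := h.1 hs
      refine ⟨x, ⟨s, hs, hx⟩, ?_⟩
      have := (D.white_iff s).2 hw
      rwa [hx] at this⟩

end OneEdge

namespace Graph

open Classical in
/-- The graph obtained from two graphs by gluing the white tails `t₁` and `t₂` to one edge. -/
def glue (G₁ G₂ : Graph.{u}) (t₁ : G₁.F) (t₂ : G₂.F) (h₁ : G₁.inv t₁ = t₁) (h₂ : G₂.inv t₂ = t₂)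
    (w₁ : t₁ ∈ G₁.white) (w₂ : t₂ ∈ G₂.white) : Graph.{u} where
  V := G₁.V ⊕ G₂.V
  F := G₁.F ⊕ G₂.F
  bd := Sum.map G₁.bd G₂.bd
  inv := Sum.elim (fun f => if f = t₁ then Sum.inr t₂ else Sum.inl (G₁.inv f))
    (fun f => if f = t₂ then Sum.inl t₁ else Sum.inr (G₂.inv f))
  inv_inv := by
    have h1 : ∀ f, f ≠ t₁ → G₁.inv f ≠ t₁ := fun f hf h => hf (by
      rw [← G₁.inv_inv f, h, h₁])
    have h2 : ∀ f, f ≠ t₂ → G₂.inv f ≠ t₂ := fun f hf h => hf (by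
      rw [← G₂.inv_inv f, h, h₂])
    rintro (f | f)
    · by_cases hf : f = t₁
      · simp [hf]
      · simp [hf, h1 f hf, G₁.inv_inv]
    · by_cases hf : f = t₂
      · simp [hf]
      · simp [hf, h2 f hf, G₂.inv_inv]
  white := {x | Sum.elim (· ∈ G₁.white) (· ∈ G₂.white) x}
  edge_white := by
    rintro (f | f) h
    · by_cases hf : f = t₁
      · subst hf; exact w₁
      · refine G₁.edge_white f fun h' => h ?_
        simp [hf, h']
    · by_cases hf : f = t₂
      · subst hf; exact w₂
      · refine G₂.edge_white f fun h' => h ?_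
        simp [hf, h']

section

variable {G₁ G₂ : Graph.{u}} {t₁ : G₁.F} {t₂ : G₂.F} {h₁ : G₁.inv t₁ = t₁} {h₂ : G₂.inv t₂ = t₂}
  {w₁ : t₁ ∈ G₁.white} {w₂ : t₂ ∈ G₂.white}

theorem glue_inv_left : (G₁.glue G₂ t₁ t₂ h₁ h₂ w₁ w₂).inv (Sum.inl t₁) = Sum.inr t₂ := if_pos rfl

theorem glue_inv_right : (G₁.glue G₂ t₁ t₂ h₁ h₂ w₁ w₂).inv (Sum.inr t₂) = Sum.inl t₁ := if_pos rfl

theorem glue_new : (G₁.glue G₂ t₁ t₂ h₁ h₂ w₁ w₂).inv (Sum.inl t₁) ≠ Sum.inl t₁ := by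
  rw [glue_inv_left]; exact Sum.inr_ne_inl

theorem glue_inv_inl {f : G₁.F} (hf : f ≠ t₁) :
    (G₁.glue G₂ t₁ t₂ h₁ h₂ w₁ w₂).inv (Sum.inl f) = Sum.inl (G₁.inv f) := if_neg hf

theorem glue_inv_inr {f : G₂.F} (hf : f ≠ t₂) :
    (G₁.glue G₂ t₁ t₂ h₁ h₂ w₁ w₂).inv (Sum.inr f) = Sum.inr (G₂.inv f) := if_neg hf

theorem glue_reach_inl {v w : G₁.V} (h : G₁.Reach ∅ v w) :
    (G₁.glue G₂ t₁ t₂ h₁ h₂ w₁ w₂).Reach ∅ (Sum.inl v) (Sum.inl w) := by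
  induction h with
  | refl => exact .refl
  | tail _ hs ih =>
    obtain ⟨f, -, -, rfl, rfl⟩ := hs
    by_cases hf : f = t₁
    · subst hf; rwa [h₁]
    · exact ih.tail ⟨Sum.inl f, id, id, rfl, by rw [glue_inv_inl hf]; rfl⟩

theorem glue_reach_inr {v w : G₂.V} (h : G₂.Reach ∅ v w) :
    (G₁.glue G₂ t₁ t₂ h₁ h₂ w₁ w₂).Reach ∅ (Sum.inr v) (Sum.inr w) := by
  induction h with
  | refl => exact .refl
  | tail _ hs ih =>
    obtain ⟨f, -, -, rfl, rfl⟩ := hs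
    by_cases hf : f = t₂
    · subst hf; rwa [h₂]
    · exact ih.tail ⟨Sum.inr f, id, id, rfl, by rw [glue_inv_inr hf]; rfl⟩

theorem glue_proj_inl {f : G₁.F} {v w : G₁.V ⊕ G₂.V}
    (h : (G₁.glue G₂ t₁ t₂ h₁ h₂ w₁ w₂).Reach {Sum.inl f} v w) :
    G₁.Reach {f} (v.elim id fun _ => G₁.bd t₁) (w.elim id fun _ => G₁.bd t₁) := by
  induction h with
  | refl => exact .refl
  | tail _ hs ih =>
    obtain ⟨g | g, h1, h2, rfl, rfl⟩ := hs
    · by_cases hg : g = t₁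
      · subst hg; rw [glue_inv_left]; exact ih
      · rw [glue_inv_inl hg] at h2 ⊢
        exact ih.tail ⟨g, fun h => h1 (congrArg Sum.inl h), fun h => h2 (congrArg Sum.inl h),
          rfl, rfl⟩
    · by_cases hg : g = t₂
      · subst hg; rw [glue_inv_right]; exact ih
      · rw [glue_inv_inr hg]; exact ih

theorem glue_proj_inr {f : G₂.F} {v w : G₁.V ⊕ G₂.V}
    (h : (G₁.glue G₂ t₁ t₂ h₁ h₂ w₁ w₂).Reach {Sum.inr f} v w) :
    G₂.Reach {f} (v.elim (fun _ => G₂.bd t₂) id) (w.elim (fun _ => G₂.bd t₂) id) := by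
  induction h with
  | refl => exact .refl
  | tail _ hs ih =>
    obtain ⟨g | g, h1, h2, rfl, rfl⟩ := hs
    · by_cases hg : g = t₁
      · subst hg; rw [glue_inv_left]; exact ih
      · rw [glue_inv_inl hg]; exact ih
    · by_cases hg : g = t₂
      · subst hg; rw [glue_inv_right]; exact ih
      · rw [glue_inv_inr hg] at h2 ⊢
        exact ih.tail ⟨g, fun h => h1 (congrArg Sum.inr h), fun h => h2 (congrArg Sum.inr h),
          rfl, rfl⟩

theorem glue_sep {v w : G₁.V ⊕ G₂.V}
    (h : (G₁.glue G₂ t₁ t₂ h₁ h₂ w₁ w₂).Reach {Sum.inl t₁} v w) : v.isLeft = w.isLeft := by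
  induction h with
  | refl => rfl
  | tail _ hs ih =>
    obtain ⟨g | g, h1, h2, rfl, rfl⟩ := hs
    · by_cases hg : g = t₁
      · exact absurd (congrArg Sum.inl hg) h1
      · rw [glue_inv_inl hg]; exact ih
    · by_cases hg : g = t₂
      · subst hg; rw [glue_inv_right] at h2; exact absurd rfl h2
      · rw [glue_inv_inr hg]; exact ih

theorem glue_isTree (hG₁ : G₁.IsTree) (hG₂ : G₂.IsTree) :
    (G₁.glue G₂ t₁ t₂ h₁ h₂ w₁ w₂).IsTree where
  nonempty := ⟨Sum.inl (G₁.bd t₁)⟩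
  connected := by
    have hb : (G₁.glue G₂ t₁ t₂ h₁ h₂ w₁ w₂).Reach ∅ (Sum.inl (G₁.bd t₁))
        (Sum.inr (G₂.bd t₂)) :=
      .single ⟨Sum.inl t₁, id, id, rfl, by rw [glue_inv_left]; rfl⟩
    have key : ∀ w, (G₁.glue G₂ t₁ t₂ h₁ h₂ w₁ w₂).Reach ∅ (Sum.inl (G₁.bd t₁)) w := by
      rintro (w | w)
      · exact glue_reach_inl (hG₁.connected _ _)
      · exact hb.trans (glue_reach_inr (hG₂.connected _ _))
    exact fun v w => (key v).symm.trans (key w)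
  bridge := by
    rintro (f | f) hf h
    · by_cases hft : f = t₁
      · subst hft
        rw [glue_inv_left] at h
        exact Bool.noConfusion (show true = false from glue_sep h)
      · have h' := glue_proj_inl h
        rw [glue_inv_inl hft] at h' hf
        exact hG₁.bridge f (fun h => hf (congrArg Sum.inl h)) h'
    · by_cases hft : f = t₂
      · subst hft
        have h' := h.inv_off
        rw [glue_inv_right] at h'
        exact Bool.noConfusion (show false = true from glue_sep h')
      · have h' := glue_proj_inr h
        rw [glue_inv_inr hft] at h' hf
        exact hG₂.bridge f (fun h => hf (congrArg Sum.inr h)) h'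

/-- A vertex with no edges is the only vertex of a connected graph. -/
theorem eq_of_no_edge {G : Graph.{u}} (hG : G.IsTree) {v : G.V}
    (hv : ∀ f, G.bd f = v → G.inv f = f) (w : G.V) : w = v := by
  induction hG.connected v w with
  | refl => rfl
  | tail _ hs ih =>
    obtain ⟨f, -, -, h1, rfl⟩ := hs
    rw [hv f (h1.trans ih), h1, ih]

theorem glue_isStable (hG₁ : G₁.IsStable) (hG₂ : G₂.IsStable)
    (x₁ : ∃ f ∈ G₁.white, G₁.inv f = f ∧ f ≠ t₁) (x₂ : ∃ f ∈ G₂.white, G₂.inv f = f ∧ f ≠ t₂) :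
    (G₁.glue G₂ t₁ t₂ h₁ h₂ w₁ w₂).IsStable where
  toIsTree := glue_isTree hG₁.toIsTree hG₂.toIsTree
  three_le := by
    rintro (w | w)
    · have h3 := hG₁.three_le w
      rw [← Set.ncard_image_of_injective _ (Sum.inl_injective (β := G₂.F))] at h3
      refine h3.trans (Set.ncard_le_ncard ?_ (Set.toFinite _))
      rintro _ ⟨f, hf, rfl⟩
      exact congrArg Sum.inl hf
    · have h3 := hG₂.three_le w
      rw [← Set.ncard_image_of_injective _ (Sum.inr_injective (α := G₁.F))] at h3
      refine h3.trans (Set.ncard_le_ncard ?_ (Set.toFinite _))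
      rintro _ ⟨f, hf, rfl⟩
      exact congrArg Sum.inr hf
  end_white := by
    rintro (w | w) hs
    · have hinl : ∀ f, G₁.bd f = w → G₁.inv f ≠ f →
          (Sum.inl f : G₁.F ⊕ G₂.F) ∈ {f | (G₁.glue G₂ t₁ t₂ h₁ h₂ w₁ w₂).bd f = Sum.inl w ∧
            (G₁.glue G₂ t₁ t₂ h₁ h₂ w₁ w₂).inv f ≠ f} := by
        intro f hf hne
        refine ⟨congrArg Sum.inl hf, ?_⟩
        rw [glue_inv_inl (by rintro rfl; exact hne h₁)]
        exact fun h => hne (Sum.inl.inj h)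
      have fin : ∀ f ∈ G₁.white, G₁.inv f = f → f ≠ t₁ → G₁.bd f = w →
          ∃ f ∈ (G₁.glue G₂ t₁ t₂ h₁ h₂ w₁ w₂).white,
            (G₁.glue G₂ t₁ t₂ h₁ h₂ w₁ w₂).bd f = Sum.inl w ∧
            (G₁.glue G₂ t₁ t₂ h₁ h₂ w₁ w₂).inv f = f := fun f hf h1 h2 h3 =>
        ⟨Sum.inl f, hf, congrArg Sum.inl h3, by rw [glue_inv_inl h2, h1]⟩
      by_cases hw : G₁.bd t₁ = w
      · obtain ⟨f, hf, h1, h2⟩ := x₁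
        refine fin f hf h1 h2 (eq_of_no_edge hG₁.toIsTree (v := w) (fun g hg => ?_) _)
        by_contra hc
        have hm : (Sum.inl t₁ : G₁.F ⊕ G₂.F) ∈ {f | (G₁.glue G₂ t₁ t₂ h₁ h₂ w₁ w₂).bd f =
            Sum.inl w ∧ (G₁.glue G₂ t₁ t₂ h₁ h₂ w₁ w₂).inv f ≠ f} :=
          ⟨congrArg Sum.inl hw, by rw [glue_inv_left]; exact Sum.inr_ne_inl⟩
        have : (Sum.inl t₁ : G₁.F ⊕ G₂.F) = Sum.inl g := hs hm (hinl g hg hc)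
        obtain rfl := Sum.inl.inj this
        exact hc h₁
      · obtain ⟨f, hf, h1, h2⟩ := hG₁.end_white w fun a ha b hb =>
          Sum.inl.inj (hs (hinl a ha.1 ha.2) (hinl b hb.1 hb.2))
        exact fin f hf h2 (by rintro rfl; exact hw h1) h1
    · have hinr : ∀ f, G₂.bd f = w → G₂.inv f ≠ f →
          (Sum.inr f : G₁.F ⊕ G₂.F) ∈ {f | (G₁.glue G₂ t₁ t₂ h₁ h₂ w₁ w₂).bd f = Sum.inr w ∧
            (G₁.glue G₂ t₁ t₂ h₁ h₂ w₁ w₂).inv f ≠ f} := by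
        intro f hf hne
        refine ⟨congrArg Sum.inr hf, ?_⟩
        rw [glue_inv_inr (by rintro rfl; exact hne h₂)]
        exact fun h => hne (Sum.inr.inj h)
      have fin : ∀ f ∈ G₂.white, G₂.inv f = f → f ≠ t₂ → G₂.bd f = w →
          ∃ f ∈ (G₁.glue G₂ t₁ t₂ h₁ h₂ w₁ w₂).white,
            (G₁.glue G₂ t₁ t₂ h₁ h₂ w₁ w₂).bd f = Sum.inr w ∧
            (G₁.glue G₂ t₁ t₂ h₁ h₂ w₁ w₂).inv f = f := fun f hf h1 h2 h3 =>
        ⟨Sum.inr f, hf, congrArg Sum.inr h3, by rw [glue_inv_inr h2, h1]⟩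
      by_cases hw : G₂.bd t₂ = w
      · obtain ⟨f, hf, h1, h2⟩ := x₂
        refine fin f hf h1 h2 (eq_of_no_edge hG₂.toIsTree (v := w) (fun g hg => ?_) _)
        by_contra hc
        have hm : (Sum.inr t₂ : G₁.F ⊕ G₂.F) ∈ {f | (G₁.glue G₂ t₁ t₂ h₁ h₂ w₁ w₂).bd f =
            Sum.inr w ∧ (G₁.glue G₂ t₁ t₂ h₁ h₂ w₁ w₂).inv f ≠ f} :=
          ⟨congrArg Sum.inr hw, by rw [glue_inv_right]; exact Sum.inl_ne_inr⟩
        have : (Sum.inr t₂ : G₁.F ⊕ G₂.F) = Sum.inr g := hs hm (hinr g hg hc)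
        obtain rfl := Sum.inr.inj this
        exact hc h₂
      · obtain ⟨f, hf, h1, h2⟩ := hG₂.end_white w fun a ha b hb =>
          Sum.inr.inj (hs (hinr a ha.1 ha.2) (hinr b hb.1 hb.2))
        exact fin f hf h2 (by rintro rfl; exact hw h1) h1

end

end Graph

namespace OneEdge

variable {S S₁ S₂ : PaintedSet.{u}}

theorem exists_white (D : OneEdge S S₁ S₂) (T : STree S₁) :
    ∃ f ∈ T.graph.white, T.graph.inv f = f ∧ f ≠ T.mark D.e₁ := by
  obtain ⟨s, ⟨x, hx⟩, hw⟩ := D.stable.white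
  have h := (D.white_iff s).2 hw
  rw [hx] at h
  refine ⟨T.mark x, (T.mark_white x).2 h, (T.mark_tail _).2 ⟨x, rfl⟩, fun he => ?_⟩
  rw [T.mark_inj he] at hx
  exact ((D.toSum_range _).1 ⟨s, hx⟩).1 rfl

/-- The `S`-tree obtained from an `S₁`-tree and an `S₂`-tree by gluing the tails labelled by `e₁` and
`e₂` to one edge. -/
def glue (D : OneEdge S S₁ S₂) (T₁ : STree S₁) (T₂ : STree S₂) : STree S where
  graph := T₁.graph.glue T₂.graph (T₁.mark D.e₁) (T₂.mark D.e₂)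
    ((T₁.mark_tail _).2 ⟨_, rfl⟩) ((T₂.mark_tail _).2 ⟨_, rfl⟩)
    ((T₁.mark_white _).2 D.e₁_white) ((T₂.mark_white _).2 D.e₂_white)
  stable := Graph.glue_isStable T₁.stable T₂.stable (D.exists_white T₁) (D.swap.exists_white T₂)
  mark := fun s => Sum.map T₁.mark T₂.mark (D.toSum s)
  mark_inj := (T₁.mark_inj.sumMap T₂.mark_inj).comp D.toSum_inj
  mark_tail := by
    rintro (f | f)
    · by_cases hf : f = T₁.mark D.e₁
      · subst hf
        rw [Graph.glue_inv_left]
        constructor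
        · intro h; cases h
        · rintro ⟨s, hs⟩
          rcases hx : D.toSum s with x | x <;> rw [hx] at hs
          · rw [T₁.mark_inj (Sum.inl.inj hs)] at hx
            exact absurd rfl ((D.toSum_range _).1 ⟨s, hx⟩).1
          · cases hs
      · rw [Graph.glue_inv_inl hf]
        constructor
        · intro h
          obtain ⟨x, rfl⟩ := (T₁.mark_tail f).1 (Sum.inl.inj h)
          obtain ⟨s, hs⟩ := (D.toSum_range (Sum.inl x)).2
            ⟨fun h => hf (congrArg T₁.mark (Sum.inl.inj h)), by simp⟩
          exact ⟨s, by rw [hs]; rfl⟩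
        · rintro ⟨s, hs⟩
          rcases hx : D.toSum s with x | x <;> rw [hx] at hs
          · exact congrArg Sum.inl ((T₁.mark_tail f).2 ⟨x, Sum.inl.inj hs⟩)
          · cases hs
    · by_cases hf : f = T₂.mark D.e₂
      · subst hf
        rw [Graph.glue_inv_right]
        constructor
        · intro h; cases h
        · rintro ⟨s, hs⟩
          rcases hx : D.toSum s with x | x <;> rw [hx] at hs
          · cases hs
          · rw [T₂.mark_inj (Sum.inr.inj hs)] at hx
            exact absurd rfl ((D.toSum_range _).1 ⟨s, hx⟩).2
      · rw [Graph.glue_inv_inr hf]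
        constructor
        · intro h
          obtain ⟨x, rfl⟩ := (T₂.mark_tail f).1 (Sum.inr.inj h)
          obtain ⟨s, hs⟩ := (D.toSum_range (Sum.inr x)).2
            ⟨by simp, fun h => hf (congrArg T₂.mark (Sum.inr.inj h))⟩
          exact ⟨s, by rw [hs]; rfl⟩
        · rintro ⟨s, hs⟩
          rcases hx : D.toSum s with x | x <;> rw [hx] at hs
          · cases hs
          · exact congrArg Sum.inr ((T₂.mark_tail f).2 ⟨x, Sum.inr.inj hs⟩)
  mark_white := by
    intro s
    rw [← D.white_iff]
    rcases D.toSum s with x | x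
    · exact T₁.mark_white x
    · exact T₂.mark_white x

/-- The edge of the glued tree that arises from the two glued tails. -/
def glueEdge (D : OneEdge S S₁ S₂) (T₁ : STree S₁) (T₂ : STree S₂) : (D.glue T₁ T₂).EdgeFlag :=
  ⟨Sum.inl (T₁.mark D.e₁), Graph.glue_new (h₁ := (T₁.mark_tail _).2 ⟨_, rfl⟩)
    (h₂ := (T₂.mark_tail _).2 ⟨_, rfl⟩) (w₁ := (T₁.mark_white _).2 D.e₁_white)
    (w₂ := (T₂.mark_white _).2 D.e₂_white)⟩

variable (k : Type w) [CommRing k]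

/-- A homomorphism from the cohomology ring of `S` to the tensor product of those of `S₁` and `S₂`
is the restriction to the one-edge tree `D`: it sends the generator of a partition that breaks
the tree at its first (second) vertex to the generator of the induced partition, the generator
of a partition that does not break the tree to zero, and the generator of the partition
given by the tree itself to minus the sum of the partitions separating the half-edge at each
vertex from two of the flags of this vertex, for any allowed choice of these flags. -/
structure IsRestriction (D : OneEdge S S₁ S₂)
    (φ : Coh k S →ₐ[k] Coh k S₁ ⊗[k] Coh k S₂) : Prop where
  break_fst : ∀ (B : OrdPart S) (h : B.1 ⊂ D.part.1),
    φ (cls k B) = cls k (D.restrict B h) ⊗ₜ[k] 1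
  break_snd : ∀ (B : OrdPart S) (h : B.1 ⊂ D.swap.part.1),
    φ (cls k B) = 1 ⊗ₜ[k] cls k (D.swap.restrict B h)
  not_break : ∀ B : OrdPart S, (B.1 ∩ D.part.1).Nonempty → (B.1 ∩ D.part.1ᶜ).Nonempty →
    (B.1ᶜ ∩ D.part.1).Nonempty → (B.1ᶜ ∩ D.part.1ᶜ).Nonempty → φ (cls k B) = 0
  break_edge : ∀ (a b c d : S) (i j : S₁) (p q : S₂), D.toSum a = Sum.inl i →
    D.toSum b = Sum.inl j → D.toSum c = Sum.inr p → D.toSum d = Sum.inr q →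
    Allowed S.white a b c d →
    φ (cls k D.part) = - ∑ A ∈ sep i j D.e₁ D.e₁, cls k A ⊗ₜ[k] 1
      - ∑ B ∈ sep p q D.e₂ D.e₂, 1 ⊗ₜ[k] cls k B

end OneEdge

/-! ### The category of painted stable trees and contractions -/

/-- Painted stable trees. -/
structure StableTree : Type (u + 1) where
  graph : Graph.{u}
  stable : graph.IsStable

/-- Contractions: compositions of contractions of edges and isomorphisms. -/
inductive IsContraction : ∀ {σ τ : StableTree.{u}}, GMap σ.graph τ.graph → Prop
  | iso {σ τ : StableTree.{u}} (c : GMap σ.graph τ.graph) (h : c.IsIso) : IsContraction c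
  | edge {σ τ : StableTree.{u}} (c : GMap σ.graph τ.graph) (e : σ.graph.F)
      (h : c.IsEdgeContraction e) : IsContraction c
  | comp {σ τ ρ : StableTree.{u}} (c : GMap σ.graph τ.graph) (d : GMap τ.graph ρ.graph)
      (hc : IsContraction c) (hd : IsContraction d) : IsContraction (c.comp d)

/-- A contraction morphism of painted stable trees. -/
@[ext]
structure Contraction (σ τ : StableTree.{u}) where
  map : GMap σ.graph τ.graph
  isContraction : IsContraction map

instance : CategoryTheory.Category StableTree.{u} where
  Hom := Contraction
  id σ := ⟨GMap.id σ.graph, .iso _ (GMap.isIso_id _)⟩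
  comp c d := ⟨c.map.comp d.map, .comp _ _ c.isContraction d.isContraction⟩

/-- If no other vertex is glued to `w` and no flag at `w` is contracted, then `c` identifies the
flags at the image of `w` with the flags at `w`. -/
def GMap.IsCompat.flagIso {G H : Graph.{u}} {c : GMap G H} (hc : c.IsCompat) (w : G.V)
    (hr : ∀ f, G.bd f = w → ∃ f', c.flag f' = f) (hi : ∀ w', c.vert w' = c.vert w → w' = w) :
    (H.flagsAt (c.vert w)).Iso (G.flagsAt w) where
  toEquiv := Equiv.ofBijective
    (fun x : {f : H.F // H.bd f = c.vert w} =>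
      (⟨c.flag x.1, hi _ ((hc.vert_bd x.1).trans x.2)⟩ : {f : G.F // G.bd f = w}))
    ⟨fun x y h => Subtype.ext (hc.flag_inj (congrArg Subtype.val h)), fun y => by
      obtain ⟨f', hf'⟩ := hr y.1 y.2
      exact ⟨⟨f', by rw [← hc.vert_bd, hf', y.2]⟩, Subtype.ext hf'⟩⟩
  white_iff := fun x => hc.white_iff x.1

/-- An isomorphism identifies the flags at the image of a vertex with the flags at this vertex. -/
def GMap.IsIso.flagIso {G H : Graph.{u}} {c : GMap G H} (hc : c.IsIso) (w : G.V) :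
    (H.flagsAt (c.vert w)).Iso (G.flagsAt w) :=
  hc.toIsCompat.flagIso w (fun f _ => hc.flag_surj f) (fun _ h => hc.vert_bij.1 h)

/-- The contraction of an edge identifies the flags at the image of a vertex `w` with the flags at
`w`, if `w` is not an end of the edge. -/
def GMap.IsEdgeContraction.flagIso {G H : Graph.{u}} {c : GMap G H} {e : G.F}
    (hc : c.IsEdgeContraction e) (w : G.V) (h₁ : w ≠ G.bd e) (h₂ : w ≠ G.bd (G.inv e)) :
    (H.flagsAt (c.vert w)).Iso (G.flagsAt w) :=
  hc.toIsCompat.flagIso w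
    (fun f hf => (hc.flag_range f).2
      ⟨by rintro rfl; exact h₁ hf.symm, by rintro rfl; exact h₂ hf.symm⟩)
    (fun w' h => by
      rcases (hc.vert_eq w' w).1 h with h | h | h
      · exact h
      · exact absurd h.2 h₂
      · exact absurd h.2 h₁)

theorem Graph.IsStable.two_le {G : Graph.{u}} (hG : G.IsStable) (f : G.F) :
    2 ≤ {g | G.bd g = G.bd f ∧ g ≠ f}.ncard := by
  have h3 := hG.three_le (G.bd f)
  have h2 := Set.ncard_sdiff_singleton_of_mem (a := f) (s := {g | G.bd g = G.bd f}) rfl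
  have : {g | G.bd g = G.bd f} \ {f} = {g | G.bd g = G.bd f ∧ g ≠ f} := rfl
  rw [this] at h2
  omega

theorem Graph.IsStable.exists_white {G : Graph.{u}} (hG : G.IsStable) {f : G.F}
    (hf : G.inv f ≠ f) : ∃ g ∈ G.white, G.bd g = G.bd f ∧ g ≠ f := by
  by_cases hs : {g | G.bd g = G.bd f ∧ G.inv g ≠ g}.Subsingleton
  · obtain ⟨t, ht, h1, h2⟩ := hG.end_white _ hs
    exact ⟨t, ht, h1, by rintro rfl; exact hf h2⟩
  · by_contra hc
    push Not at hc
    exact hs fun a ha b hb =>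
      (hc a (G.edge_white a ha.2) ha.1).trans (hc b (G.edge_white b hb.2) hb.1).symm

open Classical in
/-- The local structure of the contraction of an edge `e`: the flags at the new vertex are the
tails of a one-edge tree, whose edge is `e` and whose vertices carry the flags at the ends of `e`. -/
def GMap.IsEdgeContraction.oneEdge {G H : Graph.{u}} {c : GMap G H} {e : G.F}
    (hc : c.IsEdgeContraction e) (hG : G.IsStable) :
    OneEdge (H.flagsAt (c.vert (G.bd e))) (G.flagsAt (G.bd e)) (G.flagsAt (G.bd (G.inv e))) :=
  have hor : ∀ x : {f : H.F // H.bd f = c.vert (G.bd e)}, ¬ G.bd (c.flag x.1) = G.bd e →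
      G.bd (c.flag x.1) = G.bd (G.inv e) := fun x hx => by
    rcases (hc.vert_eq _ _).1 ((hc.vert_bd x.1).trans x.2) with h | h | h
    · exact absurd h hx
    · exact absurd h.1 hx
    · exact h.1
  have hvv : c.vert (G.bd (G.inv e)) = c.vert (G.bd e) :=
    (hc.vert_eq _ _).2 (Or.inr (Or.inr ⟨rfl, rfl⟩))
  have hbd : G.bd e ≠ G.bd (G.inv e) := Graph.bd_ne hG.toIsTree hc.edge
  { e₁ := ⟨e, rfl⟩
    e₂ := ⟨G.inv e, rfl⟩
    e₁_white := G.edge_white e hc.edge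
    e₂_white := G.edge_white (G.inv e) (Graph.inv_ne hc.edge)
    toSum := fun x : {f : H.F // H.bd f = c.vert (G.bd e)} =>
      if h : G.bd (c.flag x.1) = G.bd e then Sum.inl ⟨c.flag x.1, h⟩
      else Sum.inr ⟨c.flag x.1, hor x h⟩
    toSum_inj := by
      intro x y h
      apply Subtype.ext
      apply hc.flag_inj
      dsimp only at h
      split_ifs at h
      · exact congrArg Subtype.val (Sum.inl.inj h)
      · exact congrArg Subtype.val (Sum.inr.inj h)
    toSum_range := by
      rintro (y | y)
      · constructor
        · rintro ⟨x, hx⟩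
          refine ⟨?_, by simp⟩
          rintro hy
          split_ifs at hx with h
          have h1 := congrArg Subtype.val (Sum.inl.inj (hx.trans hy))
          exact ((hc.flag_range e).1 ⟨_, h1⟩).1 rfl
        · rintro ⟨hy, -⟩
          obtain ⟨f', hf'⟩ := (hc.flag_range y.1).2 ⟨fun h => hy (congrArg Sum.inl
            (Subtype.ext h)), fun h => hbd (y.2.symm.trans (congrArg G.bd h))⟩
          refine ⟨⟨f', by rw [← hc.vert_bd, hf', y.2]⟩, ?_⟩
          rw [dif_pos (by rw [hf']; exact y.2)]
          exact congrArg Sum.inl (Subtype.ext hf')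
      · constructor
        · rintro ⟨x, hx⟩
          refine ⟨by simp, ?_⟩
          rintro hy
          split_ifs at hx with h
          have h1 := congrArg Subtype.val (Sum.inr.inj (hx.trans hy))
          exact ((hc.flag_range (G.inv e)).1 ⟨_, h1⟩).2 rfl
        · rintro ⟨-, hy⟩
          obtain ⟨f', hf'⟩ := (hc.flag_range y.1).2
            ⟨fun h => hbd ((congrArg G.bd h).symm.trans y.2), fun h => hy (congrArg Sum.inr
            (Subtype.ext h))⟩
          refine ⟨⟨f', by rw [← hc.vert_bd, hf', y.2, hvv]⟩, ?_⟩
          rw [dif_neg (by rw [hf', y.2]; exact hbd.symm)]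
          exact congrArg Sum.inr (Subtype.ext hf')
    white_iff := by
      intro x
      refine Iff.trans ?_ (hc.white_iff x.1)
      split_ifs
      · exact Iff.rfl
      · exact Iff.rfl
    stable := by
      have hcl : ∀ B : Set (H.flagsAt (c.vert (G.bd e))), ∀ e' : G.F, G.inv e' ≠ e' →
          (∀ g, G.bd g = G.bd e' → g ≠ e' → ∃ x ∈ B, c.flag x.1 = g) →
          2 ≤ B.ncard ∧ (B ∩ (H.flagsAt (c.vert (G.bd e))).white).Nonempty := by
        intro B e' he' hB
        constructor
        · have hi : Function.Injective
              (fun x : H.flagsAt (c.vert (G.bd e)) => c.flag x.1) :=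
            fun x y h => Subtype.ext (hc.flag_inj h)
          rw [← Set.ncard_image_of_injective _ hi]
          refine (hG.two_le e').trans (Set.ncard_le_ncard ?_ (Set.toFinite _))
          rintro g ⟨h1, h2⟩
          exact hB g h1 h2
        · obtain ⟨g, hg, h1, h2⟩ := hG.exists_white he'
          obtain ⟨x, hx, rfl⟩ := hB g h1 h2
          exact ⟨x, hx, (hc.white_iff x.1).1 hg⟩
      have hset : ∀ x : H.flagsAt (c.vert (G.bd e)),
          (∃ y, (if h : G.bd (c.flag x.1) = G.bd e then
            (Sum.inl ⟨c.flag x.1, h⟩ : G.flagsAt (G.bd e) ⊕ G.flagsAt (G.bd (G.inv e)))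
            else Sum.inr ⟨c.flag x.1, hor x h⟩) = Sum.inl y) ↔
            G.bd (c.flag x.1) = G.bd e := by
        intro x
        by_cases h : G.bd (c.flag x.1) = G.bd e
        · exact ⟨fun _ => h, fun _ => ⟨_, dif_pos h⟩⟩
        · refine ⟨fun h' => ?_, fun h' => absurd h' h⟩
          rw [dif_neg h] at h'
          obtain ⟨_, h'⟩ := h'
          cases h'
      have key1 := hcl {x | G.bd (c.flag x.1) = G.bd e} e hc.edge (by
        intro g hg hge
        obtain ⟨f', hf'⟩ := (hc.flag_range g).2 ⟨hge, fun h =>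
          hbd (hg.symm.trans (congrArg G.bd h))⟩
        exact ⟨⟨f', by rw [← hc.vert_bd, hf', hg]⟩, (congrArg G.bd hf').trans hg, hf'⟩)
      have key2 := hcl {x | G.bd (c.flag x.1) = G.bd e}ᶜ (G.inv e) (Graph.inv_ne hc.edge) (by
        intro g hg hge
        obtain ⟨f', hf'⟩ := (hc.flag_range g).2 ⟨fun h =>
          hbd ((congrArg G.bd h).symm.trans hg), hge⟩
        exact ⟨⟨f', by rw [← hc.vert_bd, hf', hg, hvv]⟩, fun h =>
          hbd (h.symm.trans ((congrArg G.bd hf').trans hg)), hf'⟩)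
      have heq : {x : H.flagsAt (c.vert (G.bd e)) |
          ∃ y, (if h : G.bd (c.flag x.1) = G.bd e then
            (Sum.inl ⟨c.flag x.1, h⟩ : G.flagsAt (G.bd e) ⊕ G.flagsAt (G.bd (G.inv e)))
            else Sum.inr ⟨c.flag x.1, hor x h⟩) = Sum.inl y} =
          {x | G.bd (c.flag x.1) = G.bd e} := Set.ext hset
      change IsStablePart {x : H.flagsAt (c.vert (G.bd e)) |
          ∃ y, (if h : G.bd (c.flag x.1) = G.bd e then
            (Sum.inl ⟨c.flag x.1, h⟩ : G.flagsAt (G.bd e) ⊕ G.flagsAt (G.bd (G.inv e)))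
            else Sum.inr ⟨c.flag x.1, hor x h⟩) = Sum.inl y}
      rw [heq]
      exact ⟨key1.1, key2.1, key1.2, key2.2⟩ }

/-! ### Cohomology and homology of trees -/

section TreeCohomology

variable (k : Type w) [CommRing k]

/-- The cohomology ring of a tree: the tensor product over its vertices of the cohomology rings of
the painted sets of flags at the vertices. -/
abbrev TreeCoh (τ : StableTree.{u}) : Type (max u w) :=
  PiTensorProduct k fun v : τ.graph.V => Coh k (τ.graph.flagsAt v)

/-- The homology module of a tree: the tensor product over its vertices of the homology modules of
the painted sets of flags at the vertices. -/
abbrev TreeHlg (τ : StableTree.{u}) : Type (max (u + 1) w) :=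
  PiTensorProduct k fun v : τ.graph.V => Hlg k (τ.graph.flagsAt v)

open Classical in
/-- The embedding of the tensor factor at the vertex `v`: `a` goes to the tensor product of `a` at
the vertex `v` and of `1` at all other vertices. -/
def factor (τ : StableTree.{u}) (v : τ.graph.V) :
    Coh k (τ.graph.flagsAt v) →ₐ[k] TreeCoh k τ :=
  PiTensorProduct.singleAlgHom (R := k) (A := fun v : τ.graph.V => Coh k (τ.graph.flagsAt v)) v

variable {k}

/-- The componentwise action of the cohomology ring of a tree on its homology module. -/
def treeAct (act : ∀ S : PaintedSet.{u}, Coh k S →ₐ[k] Module.End k (Hlg k S))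
    (τ : StableTree.{u}) : TreeCoh k τ →ₗ[k] TreeHlg k τ →ₗ[k] TreeHlg k τ :=
  PiTensorProduct.map₂ fun v => (act (τ.graph.flagsAt v)).toLinearMap

end TreeCohomology

section Functors

open CategoryTheory

variable {k : Type w} [CommRing k]

/-- Contravariant functoriality of a family of pull-back maps, the values on isomorphisms, and the
values on contractions of one edge, expressed at the new vertex through the given
homomorphisms `res` attached to one-edge trees. -/
structure IsCohFunctor
    (res : ∀ {S S₁ S₂ : PaintedSet.{u}}, OneEdge S S₁ S₂ → (Coh k S →ₐ[k] Coh k S₁ ⊗[k] Coh k S₂))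
    (pull : ∀ {τ' τ : StableTree.{u}}, (τ' ⟶ τ) → (TreeCoh k τ →ₐ[k] TreeCoh k τ')) : Prop where
  map_id : ∀ τ : StableTree.{u}, pull (𝟙 τ) = AlgHom.id k (TreeCoh k τ)
  map_comp : ∀ {τ'' τ' τ : StableTree.{u}} (g : τ'' ⟶ τ') (f : τ' ⟶ τ),
    pull (g ≫ f) = (pull g).comp (pull f)
  iso : ∀ {τ' τ : StableTree.{u}} (f : τ' ⟶ τ) (hf : f.map.IsIso) (w : τ'.graph.V)
    (A : OrdPart (τ.graph.flagsAt (f.map.vert w))),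
    pull f (factor k τ (f.map.vert w) (cls k A)) =
      factor k τ' w (cls k (A.map (hf.flagIso w)))
  edge_other : ∀ {τ' τ : StableTree.{u}} (f : τ' ⟶ τ) (e : τ'.graph.F)
    (hf : f.map.IsEdgeContraction e) (w : τ'.graph.V) (h₁ : w ≠ τ'.graph.bd e)
    (h₂ : w ≠ τ'.graph.bd (τ'.graph.inv e)) (A : OrdPart (τ.graph.flagsAt (f.map.vert w))),
    pull f (factor k τ (f.map.vert w) (cls k A)) =
      factor k τ' w (cls k (A.map (hf.flagIso w h₁ h₂)))
  edge : ∀ {τ' τ : StableTree.{u}} (f : τ' ⟶ τ) (e : τ'.graph.F)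
    (hf : f.map.IsEdgeContraction e) (a : Coh k (τ.graph.flagsAt (f.map.vert (τ'.graph.bd e)))),
    pull f (factor k τ (f.map.vert (τ'.graph.bd e)) a) =
      Algebra.TensorProduct.productMap (factor k τ' (τ'.graph.bd e))
        (factor k τ' (τ'.graph.bd (τ'.graph.inv e))) (res (hf.oneEdge τ'.stable) a)

/-- Covariant functoriality of a family of push-forward maps, the values on isomorphisms, and the
values on contractions of one edge, expressed at the new vertex through the given homomorphisms
`glueMap` attached to one-edge trees. -/
structure IsHlgFunctor
    (glueMap : ∀ {S S₁ S₂ : PaintedSet.{u}},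
      OneEdge S S₁ S₂ → (Hlg k S₁ ⊗[k] Hlg k S₂ →ₗ[k] Hlg k S))
    (push : ∀ {τ' τ : StableTree.{u}}, (τ' ⟶ τ) → (TreeHlg k τ' →ₗ[k] TreeHlg k τ)) : Prop where
  map_id : ∀ τ : StableTree.{u}, push (𝟙 τ) = LinearMap.id
  map_comp : ∀ {τ'' τ' τ : StableTree.{u}} (g : τ'' ⟶ τ') (f : τ' ⟶ τ),
    push (g ≫ f) = (push f).comp (push g)
  iso : ∀ {τ' τ : StableTree.{u}} (f : τ' ⟶ τ) (hf : f.map.IsIso)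
    (T : ∀ w : τ'.graph.V, STree (τ'.graph.flagsAt w))
    (y : ∀ v : τ.graph.V, Hlg k (τ.graph.flagsAt v)),
    (∀ w, y (f.map.vert w) = mu k ((T w).relabel (hf.flagIso w))) →
    push f (PiTensorProduct.tprod k fun w => mu k (T w)) = PiTensorProduct.tprod k y
  edge : ∀ {τ' τ : StableTree.{u}} (f : τ' ⟶ τ) (e : τ'.graph.F)
    (hf : f.map.IsEdgeContraction e)
    (T : ∀ w : τ'.graph.V, STree (τ'.graph.flagsAt w))
    (y : ∀ v : τ.graph.V, Hlg k (τ.graph.flagsAt v)),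
    (∀ (w) (h₁ : w ≠ τ'.graph.bd e) (h₂ : w ≠ τ'.graph.bd (τ'.graph.inv e)),
      y (f.map.vert w) = mu k ((T w).relabel (hf.flagIso w h₁ h₂))) →
    y (f.map.vert (τ'.graph.bd e)) = glueMap (hf.oneEdge τ'.stable)
      (mu k (T (τ'.graph.bd e)) ⊗ₜ[k] mu k (T (τ'.graph.bd (τ'.graph.inv e)))) →
    push f (PiTensorProduct.tprod k fun w => mu k (T w)) = PiTensorProduct.tprod k y

end Functors

end PaintedTrees

end

open PaintedTrees CategoryTheory

/-!
Everything takes place in the cohomology ring of the set of tails.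

**Restriction.** An `S`-tree cuts `S` into the sets of flags at its vertices (`Splitting`). A stable
2-partition of `S` crosses an edge, or is given by an edge, or is induced by a partition of the flags
at a unique vertex. Call a function on stable 2-partitions balanced if it satisfies the linear
relations of all allowed quadruples. If a balanced function vanishes on the partitions that cross an
edge, then its restrictions to the vertices are balanced, and its value at an edge is minus the sum
of the contributions of the two halves (`Splitting.balanced_ext`, `Splitting.eq_neg_edgeSum`).
Conversely, balanced functions at the vertices extend in this way to a balanced function on `S`
(`Splitting.balanced`): for four tails, the linear relations at the vertices fail only where two of
the tails lie behind the same flag, and these defects are the contributions of the halves of edges. So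
there is a unique restriction homomorphism from the cohomology ring of `S` to that of the tree
(`Splitting.exists_isRes`). It is surjective, and its kernel is generated by the partitions that cross
an edge (`Splitting.IsRes.mem_crossIdeal`). For a one-edge tree this is `f_e^*` (`OneEdge.resHom`), in
general it is `STree.treeRes`.

**Homology.** The map that sends a tree to the monomial of its edges identifies the homology module
with the cohomology ring as soon as there is an `S`-tree (`toCoh_injective`, `toCoh_surjective`), and
the action is multiplication (`hlgAct`). The point is injectivity. Trees correspond to the sets of
pairwise non-crossing partitions (`equiv_of_edgeParts_eq`, `exists_edgeParts_eq`), the faces of a flag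
complex. The partitions of a face can be separated by linear relations (`unimodular_quadSpan`), and
this suffices to let the cohomology ring act on the module of faces modulo linear relations
(`FaceModule.op`). The orbit map of the empty face, followed by the map from faces to trees, which
respects the relations by `balanced_insertMu`, is a left inverse of the map to monomials.

**Contractions.** A contraction of `τ'` to `τ` identifies the tails, and the edges of `τ` become a
subset of the edges of `τ'`, as partitions of the tails. Both restriction homomorphisms start from
the cohomology ring of the set of tails, and the kernel grows with the set of edges. The pull-back is
the induced homomorphism between the images (`pull_treeRes`). The push-forward lifts a class to the
ring of the set of tails and multiplies it by the generators of the contracted edges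
(`pushCoh_treeRes`); this is well defined because generators of crossing partitions have product
zero. Functoriality and the projection formula are immediate from these descriptions. The values at
isomorphisms and at contractions of one edge are found by comparing the partitions that the vertices
of both trees induce on the tails (`ext_flagIso`, `side_branch`, `ext_part`). Uniqueness follows by
induction on the contraction, since the values at generators are prescribed.
-/

universe v

noncomputable section

namespace PaintedTrees

/-! ### Crossing partitions and balanced functions -/

section Partitions

variable {S : PaintedSet.{u}}

@[simp] theorem OrdPart.compl_val (A : OrdPart S) : A.compl.1 = A.1ᶜ := rfl

@[simp] theorem OrdPart.compl_compl (A : OrdPart S) : A.compl.compl = A :=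
  Subtype.ext (_root_.compl_compl _)

theorem OrdPart.ne_compl (A : OrdPart S) : A ≠ A.compl := by
  intro h
  obtain ⟨a, ha, -⟩ := A.2.white
  have : a ∈ A.compl.1 := h ▸ ha
  exact this ha

/-- The underlying unordered partition. -/
def OrdPart.toPart (A : OrdPart S) : Part S := Quotient.mk _ A

theorem OrdPart.toPart_eq_iff {A B : OrdPart S} : A.toPart = B.toPart ↔ A = B ∨ A = B.compl :=
  Quotient.eq

@[simp] theorem OrdPart.toPart_compl (A : OrdPart S) : A.compl.toPart = A.toPart :=
  OrdPart.toPart_eq_iff.2 (Or.inr rfl)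

theorem OrdPart.toPart_surjective : Function.Surjective (OrdPart.toPart (S := S)) :=
  Quotient.exists_rep

instance : Finite (Part S) := inferInstanceAs (Finite (Quotient (OrdPart.setoid S)))

instance : Fintype (Part S) := Fintype.ofFinite _

/-- Two sets cross if they cut the ambient set into four non-empty pieces. -/
def Crosses {α : Type*} (A B : Set α) : Prop :=
  (A ∩ B).Nonempty ∧ (A ∩ Bᶜ).Nonempty ∧ (Aᶜ ∩ B).Nonempty ∧ (Aᶜ ∩ Bᶜ).Nonempty

theorem Crosses.symm {α : Type*} {A B : Set α} (h : Crosses A B) : Crosses B A := by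
  obtain ⟨h1, h2, h3, h4⟩ := h
  exact ⟨by rwa [Set.inter_comm], by rwa [Set.inter_comm], by rwa [Set.inter_comm],
    by rwa [Set.inter_comm]⟩

theorem crosses_comm {α : Type*} {A B : Set α} : Crosses A B ↔ Crosses B A :=
  ⟨Crosses.symm, Crosses.symm⟩

@[simp] theorem crosses_compl_left {α : Type*} {A B : Set α} : Crosses Aᶜ B ↔ Crosses A B := by
  unfold Crosses
  rw [compl_compl]
  tauto

@[simp] theorem crosses_compl_right {α : Type*} {A B : Set α} : Crosses A Bᶜ ↔ Crosses A B := by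
  unfold Crosses
  rw [compl_compl]
  tauto

theorem not_crosses_of_subset {α : Type*} {A B : Set α} (h : A ⊆ B) : ¬ Crosses A B :=
  fun hc => by
    obtain ⟨x, hx, hx'⟩ := hc.2.1
    exact hx' (h hx)

theorem not_crosses_self {α : Type*} (A : Set α) : ¬ Crosses A A := not_crosses_of_subset le_rfl

theorem mem_sep {i j p q : S} {A : OrdPart S} :
    A ∈ sep i j p q ↔ i ∈ A.1 ∧ j ∈ A.1 ∧ p ∉ A.1 ∧ q ∉ A.1 := by
  simp [sep]

theorem compl_mem_sep {i j p q : S} {A : OrdPart S} :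
    A.compl ∈ sep i j p q ↔ A ∈ sep p q i j := by
  simp only [mem_sep, OrdPart.compl_val, Set.mem_compl_iff, not_not]
  tauto

theorem sep_swap_left (i j p q : S) : sep i j p q = sep j i p q := by
  ext A; simp only [mem_sep]; tauto

theorem crosses_of_mem_sep {i j p q : S} {A B : OrdPart S} (hA : A ∈ sep i j p q)
    (hB : B ∈ sep p j i q) : Crosses A.1 B.1 := by
  rw [mem_sep] at hA hB
  exact ⟨⟨j, hA.2.1, hB.2.1⟩, ⟨i, hA.1, hB.2.2.1⟩, ⟨p, hA.2.2.1, hB.1⟩, ⟨q, hA.2.2.2, hB.2.2.2⟩⟩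

/-- Crossing partitions separate some allowed quadruple in the two different ways. -/
theorem exists_allowed_of_crosses {A B : OrdPart S} (h : Crosses A.1 B.1) :
    ∃ i j p q : S, Allowed S.white i j p q ∧ A ∈ sep i j p q ∧ B ∈ sep p j i q := by
  have pick : ∀ X : Set S, X.Nonempty → ∃ x ∈ X, ∀ y ∈ X, y ∈ S.white → x ∈ S.white := by
    intro X hX
    by_cases hw : (X ∩ S.white).Nonempty
    · obtain ⟨x, hx, hxw⟩ := hw
      exact ⟨x, hx, fun _ _ _ => hxw⟩
    · obtain ⟨x, hx⟩ := hX
      exact ⟨x, hx, fun y hy hyw => absurd ⟨y, hy, hyw⟩ hw⟩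
  obtain ⟨j, hj, hj'⟩ := pick _ h.1
  obtain ⟨i, hi, hi'⟩ := pick _ h.2.1
  obtain ⟨p, hp, hp'⟩ := pick _ h.2.2.1
  obtain ⟨q, hq, hq'⟩ := pick _ h.2.2.2
  refine ⟨i, j, p, q, ⟨⟨?_, ?_, ?_, ?_, ?_, ?_⟩, ⟨?_, ?_⟩, ?_, ?_⟩, mem_sep.2 ⟨hi.1, hj.1, hp.1, hq.1⟩,
    mem_sep.2 ⟨hp.2, hj.2, hi.2, hq.2⟩⟩
  · rintro rfl; exact hi.2 hj.2
  · rintro rfl; exact hp.1 hi.1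
  · rintro rfl; exact hq.1 hi.1
  · rintro rfl; exact hp.1 hj.1
  · rintro rfl; exact hq.1 hj.1
  · rintro rfl; exact hq.2 hp.2
  · obtain ⟨x, hx, hw⟩ := A.2.white
    by_cases hB : x ∈ B.1
    · exact Or.inr (hj' x ⟨hx, hB⟩ hw)
    · exact Or.inl (hi' x ⟨hx, hB⟩ hw)
  · obtain ⟨x, hx, hw⟩ := A.2.white_compl
    by_cases hB : x ∈ B.1
    · exact Or.inl (hp' x ⟨hx, hB⟩ hw)
    · exact Or.inr (hq' x ⟨hx, hB⟩ hw)
  · obtain ⟨x, hx, hw⟩ := B.2.white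
    by_cases hA : x ∈ A.1
    · exact Or.inr (hj' x ⟨hA, hx⟩ hw)
    · exact Or.inl (hp' x ⟨hA, hx⟩ hw)
  · obtain ⟨x, hx, hw⟩ := B.2.white_compl
    by_cases hA : x ∈ A.1
    · exact Or.inl (hi' x ⟨hA, hx⟩ hw)
    · exact Or.inr (hq' x ⟨hA, hx⟩ hw)

/-- In a family of pairwise non-crossing partitions, every side `A` contains two elements, the
first one white, that do not lie together in a smaller side. -/
theorem exists_pair_of_not_crosses {C : Set (OrdPart S)}
    (hC : ∀ A ∈ C, ∀ B ∈ C, ¬ Crosses A.1 B.1) (A : OrdPart S) :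
    ∃ i j : S, i ∈ A.1 ∧ j ∈ A.1 ∧ i ≠ j ∧ i ∈ S.white ∧
      ∀ B ∈ C, B.1 ⊆ A.1 → i ∈ B.1 → j ∈ B.1 → B = A := by
  classical
  obtain ⟨i, hi, hiw⟩ := A.2.white
  -- The sides that contain `i` and lie properly inside `A` form a chain; `j` is taken outside of
  -- the largest one.
  have hne : ∃ B : Set S, (i ∈ B ∧ B ⊂ A.1) ∧ (B = {i} ∨ ∃ D ∈ C, D.1 = B) ∧
      ∀ D ∈ C, i ∈ D.1 → D.1 ⊂ A.1 → D.1.ncard ≤ B.ncard := by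
    by_cases hex : ∃ D ∈ C, i ∈ D.1 ∧ D.1 ⊂ A.1
    · obtain ⟨D, hD, hmax⟩ := Set.exists_max_image {D : OrdPart S | D ∈ C ∧ i ∈ D.1 ∧ D.1 ⊂ A.1}
        (fun D => D.1.ncard) (Set.toFinite _) (by obtain ⟨D, h1, h2⟩ := hex; exact ⟨D, h1, h2⟩)
      exact ⟨D.1, hD.2, Or.inr ⟨D, hD.1, rfl⟩, fun D' h1 h2 h3 => hmax D' ⟨h1, h2, h3⟩⟩
    · refine ⟨{i}, ⟨rfl, Set.ssubset_iff_subset_ne.2 ⟨by simpa using hi, ?_⟩⟩, Or.inl rfl,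
        fun D h1 h2 h3 => absurd ⟨D, h1, h2, h3⟩ hex⟩
      intro h
      have := A.2.two_le
      rw [← h, Set.ncard_singleton] at this
      omega
  obtain ⟨B, ⟨hiB, hBA⟩, hB, hmax⟩ := hne
  obtain ⟨j, hj, hjB⟩ := Set.exists_of_ssubset hBA
  refine ⟨i, j, hi, hj, by rintro rfl; exact hjB hiB, hiw, fun D hD hDA hiD hjD => ?_⟩
  by_contra hDne
  have hDA' : D.1 ⊂ A.1 := Set.ssubset_iff_subset_ne.2 ⟨hDA, fun h => hDne (Subtype.ext h)⟩
  have hcard := hmax D hD hiD hDA'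
  have hsub : B ⊆ D.1 := by
    rcases hB with rfl | ⟨E, hE, rfl⟩
    · simpa using hiD
    · have h1 := hC D hD E hE
      obtain ⟨z, hz⟩ := A.2.white_compl
      by_contra h2
      obtain ⟨y, hy, hy'⟩ := Set.not_subset.1 h2
      exact h1 ⟨⟨i, hiD, hiB⟩, ⟨j, hjD, hjB⟩, ⟨y, hy', hy⟩,
        ⟨z, fun h => hz.1 (hDA h), fun h => hz.1 (hBA.1 h)⟩⟩
  have := Set.eq_of_subset_of_ncard_le hsub hcard (Set.toFinite _)
  exact hjB (this ▸ hjD)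

/-- In a family of pairwise non-crossing partitions, every member can be singled out by a linear
relation: the relation involves no other member of the family. -/
theorem exists_dual {C : Set (OrdPart S)} (hc : ∀ B ∈ C, B.compl ∈ C)
    (hC : ∀ A ∈ C, ∀ B ∈ C, ¬ Crosses A.1 B.1) {A : OrdPart S} (hA : A ∈ C) :
    ∃ i j p q : S, Allowed S.white i j p q ∧ A ∈ sep i j p q ∧
      (∀ B ∈ C, B ∈ sep i j p q → B = A) ∧ ∀ B ∈ C, B ∉ sep p j i q := by
  obtain ⟨i, j, hi, hj, hij, hiw, h1⟩ := exists_pair_of_not_crosses hC A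
  obtain ⟨p, q, hp, hq, hpq, hpw, h2⟩ := exists_pair_of_not_crosses hC A.compl
  have hAs : A ∈ sep i j p q := mem_sep.2 ⟨hi, hj, hp, hq⟩
  refine ⟨i, j, p, q, ⟨⟨hij, ?_, ?_, ?_, ?_, hpq⟩, ⟨Or.inl hiw, Or.inl hpw⟩, Or.inl hpw, Or.inl hiw⟩,
    hAs, fun B hB hBs => ?_, fun B hB hBs => hC A hA B hB (crosses_of_mem_sep hAs hBs)⟩
  · rintro rfl; exact hp hi
  · rintro rfl; exact hq hi
  · rintro rfl; exact hp hj
  · rintro rfl; exact hq hj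
  · rw [mem_sep] at hBs
    obtain ⟨b1, b2, b3, b4⟩ := hBs
    by_cases hBA : B.1 ⊆ A.1
    · exact h1 B hB hBA b1 b2
    · have hAB : A.1 ⊆ B.1 := by
        by_contra h3
        obtain ⟨y, hy, hy'⟩ := Set.not_subset.1 h3
        obtain ⟨z, hz, hz'⟩ := Set.not_subset.1 hBA
        exact hC A hA B hB ⟨⟨i, hi, b1⟩, ⟨y, hy, hy'⟩, ⟨z, hz', hz⟩, ⟨p, hp, b3⟩⟩
      have := h2 B.compl (hc B hB) (Set.compl_subset_compl.2 hAB) b3 b4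
      rw [← B.compl_compl, this, A.compl_compl]

/-- A function on stable 2-partitions with values in an abelian group is balanced if it does not
depend on the order of the parts and satisfies the linear relations of all allowed quadruples. -/
structure Balanced {B : Type*} [AddCommGroup B] (Θ : OrdPart S → B) : Prop where
  symm : ∀ A, Θ A.compl = Θ A
  rel : ∀ i j p q : S, Allowed S.white i j p q →
    ∑ A ∈ sep i j p q, Θ A = ∑ A ∈ sep p j i q, Θ A

end Partitions

section CohLift

variable {k : Type w} [CommRing k] {S : PaintedSet.{u}}

theorem cls_mul_cls_of_crosses {A B : OrdPart S} (h : Crosses A.1 B.1) :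
    cls k A * cls k B = 0 := by
  obtain ⟨i, j, p, q, hall, hA, hB⟩ := exists_allowed_of_crosses h
  rw [cls, cls, ← map_mul, Ideal.Quotient.eq_zero_iff_mem]
  exact Ideal.subset_span (Or.inr ⟨i, j, p, q, hall, A, hA, B, hB, rfl⟩)

theorem balanced_cls : Balanced (cls k (S := S)) where
  symm := cls_compl k
  rel i j p q hall := by
    have h : linRel k i j p q ∈ relIdeal k S :=
      Ideal.subset_span (Or.inl ⟨i, j, p, q, hall, rfl⟩)
    rw [← Ideal.Quotient.eq_zero_iff_mem, linRel, map_sub, sub_eq_zero, map_sum, map_sum] at h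
    exact h

theorem Balanced.map {B C : Type*} [AddCommGroup B] [AddCommGroup C] {Θ : OrdPart S → B}
    (h : Balanced Θ) {F : Type*} [FunLike F B C] [AddMonoidHomClass F B C] (g : F) :
    Balanced fun A => g (Θ A) where
  symm A := congrArg g (h.symm A)
  rel i j p q hall := by
    rw [← map_sum, ← map_sum, h.rel i j p q hall]

theorem coh_adjoin : Algebra.adjoin k (Set.range (cls k (S := S))) = ⊤ := by
  have h1 : Set.range (cls k (S := S)) =
      (Ideal.Quotient.mkₐ k (relIdeal k S)) '' Set.range MvPolynomial.X := by
    ext x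
    constructor
    · rintro ⟨A, rfl⟩
      exact ⟨_, ⟨_, rfl⟩, rfl⟩
    · rintro ⟨_, ⟨ρ, rfl⟩, rfl⟩
      obtain ⟨A, rfl⟩ := OrdPart.toPart_surjective ρ
      exact ⟨A, rfl⟩
  rw [h1, ← AlgHom.map_adjoin, MvPolynomial.adjoin_range_X, Algebra.map_top, AlgHom.range_eq_top]
  exact Ideal.Quotient.mkₐ_surjective _ _

theorem coh_algHom_ext {B : Type*} [Semiring B] [Algebra k B] {f g : Coh k S →ₐ[k] B}
    (h : ∀ A, f (cls k A) = g (cls k A)) : f = g :=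
  AlgHom.ext_of_adjoin_eq_top coh_adjoin (by rintro _ ⟨A, rfl⟩; exact h A)

/-- Algebra homomorphisms out of the cohomology ring are given by balanced functions for which the
products of the values at crossing partitions vanish. -/
theorem exists_coh_lift {B : Type*} [CommRing B] [Algebra k B] {Θ : OrdPart S → B}
    (h : Balanced Θ) (h0 : ∀ A A' : OrdPart S, Crosses A.1 A'.1 → Θ A * Θ A' = 0) :
    ∃ f : Coh k S →ₐ[k] B, ∀ A, f (cls k A) = Θ A := by
  let θ : Part S → B := Quotient.lift Θ (by
    rintro A A' (rfl | rfl)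
    · rfl
    · exact h.symm A')
  have hgen : ∀ A : OrdPart S, MvPolynomial.aeval (R := k) θ (gen k A) = Θ A := fun A =>
    MvPolynomial.aeval_X _ _
  refine ⟨Ideal.Quotient.liftₐ (relIdeal k S) (MvPolynomial.aeval θ) ?_, fun A => ?_⟩
  · intro a ha
    change a ∈ RingHom.ker (MvPolynomial.aeval (R := k) θ)
    refine (Ideal.span_le.2 ?_ : relIdeal k S ≤ _) ha
    rintro _ (⟨i, j, p, q, hall, rfl⟩ | ⟨i, j, p, q, hall, A, hA, A', hA', rfl⟩)
    · change _ = _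
      simp only [linRel, map_sub, map_sum, hgen]
      rw [h.rel i j p q hall, sub_self]
    · change _ = _
      rw [map_mul, hgen, hgen, h0 A A' (crosses_of_mem_sep hA hA')]
  · exact hgen A

end CohLift

/-! ### Faces of a flag complex modulo linear relations -/

namespace FaceModule

open Classical Finset IsMulCommutative

variable {k : Type w} [CommRing k] {P : Type v}

/-! The polynomial ring in the variables `P` acts on the quotient of the free module on the faces by
the relations `rel`: a variable outside of a face is added to it, a variable of the face is first
replaced by other ones with the help of a dual function. -/

/-- The faces of the flag complex of the relation `r`. -/
def Face (r : P → P → Prop) (F : Finset P) : Prop := ∀ ρ ∈ F, ∀ σ ∈ F, r ρ σ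

theorem Face.mono {r : P → P → Prop} {F G : Finset P} (h : Face r G) (hFG : F ⊆ G) : Face r F :=
  fun ρ hρ σ hσ => h ρ (hFG hρ) σ (hFG hσ)

variable (r : P → P → Prop) (L : Submodule k (P → k))

/-- Every element of a face is dual to some function of `L`. -/
def Unimodular : Prop :=
  ∀ F, Face r F → ∀ ρ ∈ F, ∃ u ∈ L, u ρ = 1 ∧ ∀ σ ∈ F, σ ≠ ρ → u σ = 0

variable {r L}

/-- A function of `L` that is dual to the element `ρ` of the face `F`. -/
def dual (h : Unimodular r L) (F : Finset P) (ρ : P) : P → k :=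
  if hF : Face r F ∧ ρ ∈ F then (h F hF.1 ρ hF.2).choose else 0

theorem dual_spec (h : Unimodular r L) {F : Finset P} {ρ : P} (hF : Face r F) (hρ : ρ ∈ F) :
    dual h F ρ ∈ L ∧ dual h F ρ ρ = 1 ∧ ∀ σ ∈ F, σ ≠ ρ → dual h F ρ σ = 0 := by
  rw [dual, dif_pos ⟨hF, hρ⟩]
  exact (h F hF ρ hρ).choose_spec

theorem dual_mem (h : Unimodular r L) (F : Finset P) (ρ : P) : dual h F ρ ∈ L := by
  by_cases hF : Face r F ∧ ρ ∈ F
  · exact (dual_spec h hF.1 hF.2).1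
  · rw [dual, dif_neg hF]
    exact L.zero_mem

variable [Fintype P]

/-- The relations between faces: for a face `F` and a function `u` of the space `L` that vanishes on
`F`, the sum of the faces `F ∪ {τ}` with weights `u τ`. Sets that are not faces are zero. -/
def rel (r : P → P → Prop) (L : Submodule k (P → k)) : Submodule k (Finset P →₀ k) :=
  Submodule.span k ({x | ∃ F, ¬ Face r F ∧ x = Finsupp.single F 1} ∪
    {x | ∃ F, Face r F ∧ ∃ u ∈ L, (∀ σ ∈ F, u σ = 0) ∧
      x = ∑ τ ∈ Fᶜ, u τ • Finsupp.single (insert τ F) 1})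

variable (r : P → P → Prop) (L : Submodule k (P → k))

/-- The class of a set `F`, which is zero if `F` is not a face. -/
def face (F : Finset P) : (Finset P →₀ k) ⧸ rel r L := (rel r L).mkQ (Finsupp.single F 1)

variable {r L}

theorem face_eq_zero {F : Finset P} (h : ¬ Face r F) : face r L F = 0 := by
  rw [face, Submodule.mkQ_apply, Submodule.Quotient.mk_eq_zero]
  exact Submodule.subset_span (Or.inl ⟨F, h, rfl⟩)

theorem face_insert_eq_zero {F : Finset P} (h : ¬ Face r F) (τ : P) :
    face r L (insert τ F) = 0 :=
  face_eq_zero fun h' => h (h'.mono (subset_insert _ _))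

theorem sum_face_eq_zero {F : Finset P} {u : P → k} (hu : u ∈ L)
    (h : ∀ σ ∈ F, u σ = 0) : ∑ τ ∈ Fᶜ, u τ • face r L (insert τ F) = 0 := by
  by_cases hF : Face r F
  · have : (rel r L).mkQ (∑ τ ∈ Fᶜ, u τ • Finsupp.single (insert τ F) 1) = 0 := by
      rw [Submodule.mkQ_apply, Submodule.Quotient.mk_eq_zero]
      exact Submodule.subset_span (Or.inr ⟨F, hF, u, hu, h, rfl⟩)
    rw [map_sum] at this
    simp only [map_smul] at this
    exact this
  · exact sum_eq_zero fun τ _ => by rw [face_insert_eq_zero hF, smul_zero]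

/-- Multiplication by the variable `ρ` on the free module. -/
def opFree (h : Unimodular r L) (ρ : P) : (Finset P →₀ k) →ₗ[k] (Finset P →₀ k) ⧸ rel r L :=
  Finsupp.linearCombination k fun F =>
    if ρ ∈ F then - ∑ τ ∈ Fᶜ, dual h F ρ τ • face r L (insert τ F) else face r L (insert ρ F)

theorem opFree_of_not_face (h : Unimodular r L) (ρ : P) {F : Finset P} (hF : ¬ Face r F) :
    opFree h ρ (Finsupp.single F 1) = 0 := by
  rw [opFree, Finsupp.linearCombination_single, one_smul]
  split_ifs
  · rw [sum_eq_zero fun τ _ => by rw [face_insert_eq_zero hF, smul_zero], neg_zero]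
  · exact face_insert_eq_zero hF ρ

theorem opFree_of_notMem (h : Unimodular r L) {ρ : P} {F : Finset P} (hρ : ρ ∉ F) :
    opFree h ρ (Finsupp.single F 1) = face r L (insert ρ F) := by
  rw [opFree, Finsupp.linearCombination_single, one_smul, if_neg hρ]

/-- In the definition of the multiplication, the choice of the dual function does not matter. -/
theorem opFree_of_mem (h : Unimodular r L) {ρ : P} {F : Finset P} (hρ : ρ ∈ F) {u : P → k}
    (hu : u ∈ L) (h1 : u ρ = 1) (h2 : ∀ σ ∈ F, σ ≠ ρ → u σ = 0) :
    opFree h ρ (Finsupp.single F 1) = - ∑ τ ∈ Fᶜ, u τ • face r L (insert τ F) := by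
  rw [opFree, Finsupp.linearCombination_single, one_smul, if_pos hρ, neg_inj]
  by_cases hF : Face r F
  · obtain ⟨d1, d2, d3⟩ := dual_spec h hF hρ
    rw [← sub_eq_zero, ← sum_sub_distrib]
    simp only [← sub_smul]
    refine sum_face_eq_zero (u := dual h F ρ - u) (L.sub_mem d1 hu) fun σ hσ => ?_
    by_cases hσρ : σ = ρ
    · subst hσρ; simp [d2, h1]
    · simp [d3 σ hσ hσρ, h2 σ hσ hσρ]
  · exact sum_congr rfl fun τ _ => by rw [face_insert_eq_zero hF, smul_zero, smul_zero]

/-- The weighted sum of the faces `F ∪ {τ, τ'}` that computes products of two linear forms. -/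
def quad (h : Unimodular r L) (F : Finset P) (a b : P → k) : (Finset P →₀ k) ⧸ rel r L :=
  ∑ τ ∈ Fᶜ, a τ • ∑ τ' ∈ (insert τ F)ᶜ,
    (b τ' - b τ * dual h (insert τ F) τ τ') • face r L (insert τ' (insert τ F))

theorem quad_comm (h : Unimodular r L) (F : Finset P) (a b : P → k) :
    quad h F a b = quad h F b a := by
  have key : ∀ a b : P → k, quad h F a b =
      ∑ τ ∈ Fᶜ, ∑ τ' ∈ Fᶜ, (if τ' = τ then 0 else
        (a τ * b τ') • face r L (insert τ' (insert τ F))) -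
      ∑ τ ∈ Fᶜ, (a τ * b τ) • ∑ τ' ∈ (insert τ F)ᶜ,
        dual h (insert τ F) τ τ' • face r L (insert τ' (insert τ F)) := by
    intro a b
    rw [quad, ← sum_sub_distrib]
    refine sum_congr rfl fun τ hτ => ?_
    have : ∑ τ' ∈ Fᶜ, (if τ' = τ then 0 else
        (a τ * b τ') • face r L (insert τ' (insert τ F))) =
        ∑ τ' ∈ (insert τ F)ᶜ, (a τ * b τ') • face r L (insert τ' (insert τ F)) := by
      rw [compl_insert, ← sum_erase_add _ _ hτ, if_pos rfl, add_zero]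
      exact sum_congr rfl fun τ' hτ' => by rw [if_neg (ne_of_mem_erase hτ')]
    rw [this, smul_sum, smul_sum, ← sum_sub_distrib]
    refine sum_congr rfl fun τ' _ => ?_
    simp only [smul_smul, ← sub_smul]
    congr 1
    ring
  rw [key, key, sum_comm]
  congr 1
  · refine sum_congr rfl fun τ _ => sum_congr rfl fun τ' _ => ?_
    by_cases hτ : τ = τ'
    · rw [if_pos hτ, if_pos hτ.symm]
    · rw [if_neg hτ, if_neg (Ne.symm hτ), mul_comm, insert_comm]
  · exact sum_congr rfl fun τ _ => by rw [mul_comm]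

theorem quad_eq_zero (h : Unimodular r L) {F : Finset P} (a : P → k) {b : P → k} (hb : b ∈ L)
    (hF : ∀ σ ∈ F, b σ = 0) : quad h F a b = 0 := by
  refine sum_eq_zero fun τ hτ => ?_
  rw [mem_compl] at hτ
  by_cases hface : Face r (insert τ F)
  · obtain ⟨d1, d2, d3⟩ := dual_spec h hface (mem_insert_self τ F)
    have hz := sum_face_eq_zero (r := r) (F := insert τ F) (u := b - b τ • dual h (insert τ F) τ)
      (L.sub_mem hb (L.smul_mem _ d1)) (by
        intro σ hσ
        by_cases hστ : σ = τ
        · subst hστ; simp [d2]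
        · simp [d3 σ hσ hστ, hF σ (mem_of_mem_insert_of_ne hσ hστ)])
    simp only [Pi.sub_apply, Pi.smul_apply, smul_eq_mul] at hz
    rw [hz, smul_zero]
  · rw [sum_eq_zero fun τ' _ => by rw [face_insert_eq_zero hface, smul_zero], smul_zero]

theorem opFree_insert_of_mem (h : Unimodular r L) {ρ : P} {F : Finset P} (hρ : ρ ∈ F) {w : P → k}
    (hw : w ∈ L) (h1 : w ρ = 1) (h2 : ∀ σ ∈ F, σ ≠ ρ → w σ = 0) {τ : P} (hτ : τ ∉ F) :
    opFree h ρ (Finsupp.single (insert τ F) 1) = - ∑ τ' ∈ (insert τ F)ᶜ,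
      (w τ' - w τ * dual h (insert τ F) τ τ') • face r L (insert τ' (insert τ F)) := by
  by_cases hface : Face r (insert τ F)
  · obtain ⟨d1, d2, d3⟩ := dual_spec h hface (mem_insert_self τ F)
    have hne : ρ ≠ τ := by rintro rfl; exact hτ hρ
    rw [opFree_of_mem h (mem_insert_of_mem hρ) (u := w - w τ • dual h (insert τ F) τ)
      (L.sub_mem hw (L.smul_mem _ d1))]
    · rfl
    · simp [d3 ρ (mem_insert_of_mem hρ) hne, h1]
    · intro σ hσ hσρ
      by_cases hστ : σ = τ
      · subst hστ; simp [d2]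
      · simp [d3 σ hσ hστ, h2 σ (mem_of_mem_insert_of_ne hσ hστ) hσρ]
  · rw [opFree_of_not_face h ρ hface,
      sum_eq_zero fun τ' _ => by rw [face_insert_eq_zero hface, smul_zero], neg_zero]

theorem opFree_sum (h : Unimodular r L) {ρ : P} {F : Finset P} (hρ : ρ ∈ F) {w : P → k}
    (hw : w ∈ L) (h1 : w ρ = 1) (h2 : ∀ σ ∈ F, σ ≠ ρ → w σ = 0) (a : P → k) :
    opFree h ρ (∑ τ ∈ Fᶜ, a τ • Finsupp.single (insert τ F) 1) = - quad h F a w := by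
  rw [map_sum, quad, ← sum_neg_distrib]
  refine sum_congr rfl fun τ hτ => ?_
  rw [map_smul, opFree_insert_of_mem h hρ hw h1 h2 (mem_compl.1 hτ), smul_neg]

theorem rel_le_ker_opFree (h : Unimodular r L) (ρ : P) : rel r L ≤ LinearMap.ker (opFree h ρ) := by
  refine Submodule.span_le.2 ?_
  rintro _ (⟨F, hF, rfl⟩ | ⟨F, hF, u, hu, hu0, rfl⟩)
  · exact opFree_of_not_face h ρ hF
  · change opFree h ρ _ = 0
    by_cases hρ : ρ ∈ F
    · obtain ⟨d1, d2, d3⟩ := dual_spec h hF hρ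
      rw [opFree_sum h hρ d1 d2 d3, quad_comm, quad_eq_zero h _ hu hu0, neg_zero]
    by_cases hface : Face r (insert ρ F)
    · obtain ⟨d1, d2, d3⟩ := dual_spec h hface (mem_insert_self ρ F)
      have hz := sum_face_eq_zero (r := r) (F := insert ρ F) (u := u - u ρ • dual h (insert ρ F) ρ)
        (L.sub_mem hu (L.smul_mem _ d1)) (by
          intro σ hσ
          by_cases hσρ : σ = ρ
          · subst hσρ; simp [d2]
          · simp [d3 σ hσ hσρ, hu0 σ (mem_of_mem_insert_of_ne hσ hσρ)])
      rw [map_sum, ← sum_erase_add _ _ (mem_compl.2 hρ), map_smul,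
        opFree_of_mem h (mem_insert_self ρ F) d1 d2 d3, ← compl_insert, smul_neg, ← sub_eq_add_neg,
        smul_sum, ← sum_sub_distrib, ← hz]
      refine sum_congr rfl fun τ hτ => ?_
      rw [mem_compl, mem_insert, not_or] at hτ
      rw [map_smul, opFree_of_notMem h (by
        rw [mem_insert, not_or]; exact ⟨Ne.symm hτ.1, hρ⟩), insert_comm, smul_smul, ← sub_smul]
      rfl
    · have hz : ∀ τ, face r L (insert ρ (insert τ F)) = 0 := fun τ => by
        rw [insert_comm]; exact face_insert_eq_zero hface τ
      rw [map_sum]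
      refine sum_eq_zero fun τ _ => ?_
      rw [map_smul]
      by_cases hτ : ρ = τ
      · rw [← hτ, opFree_of_not_face h ρ hface, smul_zero]
      · rw [opFree_of_notMem h (by rw [mem_insert, not_or]; exact ⟨hτ, hρ⟩), hz, smul_zero]

/-- Multiplication by the variable `ρ`. -/
def op (h : Unimodular r L) (ρ : P) : Module.End k ((Finset P →₀ k) ⧸ rel r L) :=
  (rel r L).liftQ (opFree h ρ) (rel_le_ker_opFree h ρ)

theorem op_mkQ (h : Unimodular r L) (ρ : P) (x : Finset P →₀ k) :
    op h ρ ((rel r L).mkQ x) = opFree h ρ x := rfl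

theorem op_face (h : Unimodular r L) (ρ : P) (F : Finset P) :
    op h ρ (face r L F) = opFree h ρ (Finsupp.single F 1) := rfl

theorem op_face_of_mem (h : Unimodular r L) {ρ : P} {F : Finset P} (hρ : ρ ∈ F) :
    op h ρ (face r L F) =
      - (rel r L).mkQ (∑ τ ∈ Fᶜ, dual h F ρ τ • Finsupp.single (insert τ F) 1) := by
  rw [op_face, opFree, Finsupp.linearCombination_single, one_smul, if_pos hρ, map_sum]
  rfl

theorem end_ext {M : Type*} [AddCommGroup M] [Module k M]
    {f g : ((Finset P →₀ k) ⧸ rel r L) →ₗ[k] M}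
    (hfg : ∀ F, Face r F → f (face r L F) = g (face r L F)) : f = g := by
  refine Submodule.linearMap_qext _ (Finsupp.lhom_ext' fun F => LinearMap.ext_ring ?_)
  change f (face r L F) = g (face r L F)
  by_cases hF : Face r F
  · exact hfg F hF
  · rw [face_eq_zero hF, map_zero, map_zero]

theorem op_comm_of_mem_of_notMem (h : Unimodular r L) {ρ σ : P} {F : Finset P}
    (hρ : ρ ∈ F) (hσ : σ ∉ F) : op h ρ (op h σ (face r L F)) = op h σ (op h ρ (face r L F)) := by
  rw [op_face h σ, opFree_of_notMem h hσ, op_face]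
  by_cases hface : Face r (insert σ F)
  · have hρσ : ρ ≠ σ := by rintro rfl; exact hσ hρ
    obtain ⟨d1, d2, d3⟩ := dual_spec h hface (mem_insert_of_mem hρ)
    rw [opFree_of_mem h (mem_insert_of_mem hρ) d1 d2 d3, op_face, opFree_of_mem h hρ d1 d2
      fun τ hτ hτρ => d3 τ (mem_insert_of_mem hτ) hτρ, map_neg, map_sum, neg_inj,
      ← sum_erase_add _ _ (mem_compl.2 hσ), d3 σ (mem_insert_self _ _) hρσ.symm, zero_smul,
      map_zero, add_zero, ← compl_insert]
    refine sum_congr rfl fun τ hτ => ?_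
    rw [mem_compl, mem_insert, not_or] at hτ
    rw [map_smul, op_face, opFree_of_notMem h (by
        rw [mem_insert, not_or]; exact ⟨Ne.symm hτ.1, hσ⟩), insert_comm]
  · rw [opFree_of_not_face h ρ hface, op_face_of_mem h hρ, map_neg, op_mkQ, map_sum,
      sum_eq_zero, neg_zero]
    intro τ _
    rw [map_smul]
    by_cases hτ : σ = τ
    · rw [← hτ, opFree_of_not_face h σ hface, smul_zero]
    · rw [opFree_of_notMem h (by rw [mem_insert, not_or]; exact ⟨hτ, hσ⟩), insert_comm,
        face_insert_eq_zero hface, smul_zero]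

theorem op_comm (h : Unimodular r L) (ρ σ : P) : op h ρ * op h σ = op h σ * op h ρ := by
  refine end_ext fun F hF => ?_
  rw [Module.End.mul_apply, Module.End.mul_apply]
  by_cases hρ : ρ ∈ F <;> by_cases hσ : σ ∈ F
  · obtain ⟨d1, d2, d3⟩ := dual_spec h hF hρ
    obtain ⟨e1, e2, e3⟩ := dual_spec h hF hσ
    rw [op_face_of_mem h hρ, op_face_of_mem h hσ, map_neg, map_neg, op_mkQ, op_mkQ,
      opFree_sum h hρ d1 d2 d3, opFree_sum h hσ e1 e2 e3, quad_comm]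
  · exact op_comm_of_mem_of_notMem h hρ hσ
  · exact (op_comm_of_mem_of_notMem h hσ hρ).symm
  · rw [op_face, op_face, opFree_of_notMem h hρ, opFree_of_notMem h hσ, op_face, op_face]
    by_cases hρσ : ρ = σ
    · rw [hρσ]
    · rw [opFree_of_notMem h (by rw [mem_insert, not_or]; exact ⟨hρσ, hρ⟩),
        opFree_of_notMem h (by rw [mem_insert, not_or]; exact ⟨Ne.symm hρσ, hσ⟩), insert_comm]

/-- Two elements that cannot lie in one face multiply to zero. -/
theorem op_mul_op_eq_zero (h : Unimodular r L) (hr : ∀ ρ σ, r ρ σ → r σ ρ) {ρ σ : P}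
    (hρσ : ¬ r ρ σ) (hρ : r ρ ρ) : op h ρ * op h σ = 0 := by
  have key : ∀ F (ρ σ : P), ρ ∉ F → ρ ≠ σ → ¬ r ρ σ → op h σ (op h ρ (face r L F)) = 0 := by
    intro F ρ σ h1 h2 h3
    rw [op_face, opFree_of_notMem h h1, op_face]
    by_cases hσ : σ ∈ F
    · exact opFree_of_not_face h σ fun h' =>
        h3 (h' ρ (mem_insert_self _ _) σ (mem_insert_of_mem hσ))
    · rw [opFree_of_notMem h (by rw [mem_insert, not_or]; exact ⟨Ne.symm h2, hσ⟩)]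
      exact face_eq_zero fun h' => h3 (h' ρ (mem_insert_of_mem (mem_insert_self _ _)) σ
        (mem_insert_self _ _))
  have hne : ρ ≠ σ := by rintro rfl; exact hρσ hρ
  refine end_ext fun F hF => ?_
  rw [LinearMap.zero_apply]
  by_cases hF' : ρ ∈ F
  · have hσ : σ ∉ F := fun hσ => hρσ (hF ρ hF' σ hσ)
    exact key F σ ρ hσ hne.symm fun h' => hρσ (hr _ _ h')
  · rw [op_comm]
    exact key F ρ σ hF' hne hρσ

/-- The functions of `L` act by zero when they are read as linear forms in the variables. -/
theorem sum_smul_op_eq_zero (h : Unimodular r L) {u : P → k} (hu : u ∈ L) :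
    ∑ ρ, u ρ • op h ρ = 0 := by
  refine end_ext fun F hF => ?_
  rw [LinearMap.zero_apply, LinearMap.sum_apply, ← sum_add_sum_compl F]
  have hz := sum_face_eq_zero (r := r) (F := F) (u := u - ∑ ρ ∈ F, u ρ • dual h F ρ)
    (L.sub_mem hu (L.sum_mem fun ρ _ => L.smul_mem _ (dual_mem h F ρ))) (by
      intro σ hσ
      rw [Pi.sub_apply, Finset.sum_apply, sum_eq_single σ, Pi.smul_apply, (dual_spec h hF hσ).2.1,
        smul_eq_mul, mul_one, sub_self]
      · intro ρ hρ hρσ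
        rw [Pi.smul_apply, (dual_spec h hF hρ).2.2 σ hσ hρσ.symm, smul_zero]
      · exact fun h' => absurd hσ h')
  rw [← hz]
  simp only [Pi.sub_apply, Finset.sum_apply, Pi.smul_apply, smul_eq_mul, sub_smul,
    sum_sub_distrib, LinearMap.smul_apply]
  rw [add_comm, sub_eq_add_neg]
  congr 1
  · exact sum_congr rfl fun ρ hρ => by rw [op_face, opFree_of_notMem h (mem_compl.1 hρ)]
  · simp only [sum_smul, mul_smul]
    rw [sum_comm, ← sum_neg_distrib]
    refine sum_congr rfl fun ρ hρ => ?_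
    rw [op_face_of_mem h hρ, smul_neg, map_sum, smul_sum]
    rfl

theorem prod_op_face (h : Unimodular r L) (φ : MvPolynomial P k →ₐ[k]
    Module.End k ((Finset P →₀ k) ⧸ rel r L)) (hφ : ∀ ρ, φ (MvPolynomial.X ρ) = op h ρ)
    (F : Finset P) :
    φ (∏ ρ ∈ F, MvPolynomial.X ρ) (face r L ∅) = face r L F := by
  induction F using Finset.induction_on with
  | empty => simp
  | insert ρ F hρ ih =>
    rw [prod_insert hρ, map_mul, Module.End.mul_apply, ih, hφ, op_face, opFree_of_notMem h hρ]

/-- The action of the polynomial ring on the classes of faces. -/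
theorem exists_action (h : Unimodular r L) :
    ∃ φ : MvPolynomial P k →ₐ[k] Module.End k ((Finset P →₀ k) ⧸ rel r L),
      ∀ ρ, φ (MvPolynomial.X ρ) = op h ρ := by
  -- `MvPolynomial.aeval` needs a commutative target: the subalgebra generated by the operators.
  have : IsMulCommutative (Algebra.adjoin k (Set.range (op h))) :=
    Algebra.isMulCommutative_adjoin k (by
      rintro _ ⟨ρ, rfl⟩ _ ⟨σ, rfl⟩
      exact op_comm h ρ σ)
  let θ : P → Algebra.adjoin k (Set.range (op h)) :=
    fun ρ => ⟨op h ρ, Algebra.subset_adjoin ⟨ρ, rfl⟩⟩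
  refine ⟨(Algebra.adjoin k (Set.range (op h))).val.comp (MvPolynomial.aeval θ), fun ρ => ?_⟩
  exact congrArg Subtype.val (MvPolynomial.aeval_X θ ρ)

end FaceModule

/-! ### Sums over the partitions that cut off one element -/

instance (S : PaintedSet.{u}) : Fintype S := Fintype.ofFinite _

section Cut

open Classical

variable {S : PaintedSet.{u}} {B : Type*} [AddCommGroup B] {Θ : OrdPart S → B}

/-- The sum of `Θ` over the partitions that separate the element `x` from two other elements, at
least one of which is white. For balanced `Θ` and white `x`, the choice of these two elements
does not matter. The sum is zero by convention if they do not exist. -/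
def cut (Θ : OrdPart S → B) (x : S) : B :=
  if h : ∃ ab : S × S, ab.1 ≠ ab.2 ∧ ab.1 ≠ x ∧ ab.2 ≠ x ∧ (ab.1 ∈ S.white ∨ ab.2 ∈ S.white) then
    ∑ A ∈ sep h.choose.1 h.choose.2 x x, Θ A
  else 0

theorem sum_sep_split (i j p q c : S) : ∑ A ∈ sep i j p q, Θ A =
    ∑ A ∈ (sep i j p q).filter (fun A => c ∈ A.1), Θ A +
      ∑ A ∈ (sep i j p q).filter (fun A => c ∉ A.1), Θ A :=
  (Finset.sum_filter_add_sum_filter_not _ _ _).symm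

theorem Balanced.sum_sep_compl (h : Balanced Θ) (i j p q : S) :
    ∑ A ∈ sep i j p q, Θ A = ∑ A ∈ sep p q i j, Θ A := by
  refine Finset.sum_nbij' OrdPart.compl OrdPart.compl (fun A hA => ?_) (fun A hA => ?_)
    (fun A _ => A.compl_compl) (fun A _ => A.compl_compl) (fun A _ => (h.symm A).symm)
  · exact compl_mem_sep.2 hA
  · exact compl_mem_sep.2 hA

theorem Balanced.sum_sep_change (h : Balanced Θ) {x a b c : S} (hx : x ∈ S.white)
    (ha : a ∈ S.white) (hax : a ≠ x) (hbx : b ≠ x) (hcx : c ≠ x) (hab : a ≠ b) (hac : a ≠ c) :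
    ∑ A ∈ sep a b x x, Θ A = ∑ A ∈ sep a c x x, Θ A := by
  by_cases hbc : b = c
  · rw [hbc]
  have hrel := h.rel b a c x ⟨⟨hab.symm, hbc, hbx, hac, hax, hcx⟩, ⟨Or.inr ha, Or.inr hx⟩,
    Or.inr ha, Or.inr hx⟩
  rw [sum_sep_split a b x x c, sum_sep_split a c x x b]
  congr 1
  · refine Finset.sum_congr ?_ fun _ _ => rfl
    ext A; simp only [Finset.mem_filter, mem_sep]; tauto
  · convert hrel using 2 <;> (ext A; simp only [Finset.mem_filter, mem_sep]; tauto)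

theorem Balanced.sum_sep_eq_cut (h : Balanced Θ) {x a b : S} (hx : x ∈ S.white) (hab : a ≠ b)
    (hax : a ≠ x) (hbx : b ≠ x) (hw : a ∈ S.white ∨ b ∈ S.white) :
    ∑ A ∈ sep a b x x, Θ A = cut Θ x := by
  have key : ∀ a b c d : S, a ≠ b → a ≠ x → b ≠ x → a ∈ S.white → c ≠ d → c ≠ x → d ≠ x →
      c ∈ S.white → ∑ A ∈ sep a b x x, Θ A = ∑ A ∈ sep c d x x, Θ A := by
    intro a b c d hab hax hbx ha hcd hcx hdx hc
    by_cases hac : a = c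
    · subst hac
      exact h.sum_sep_change hx ha hax hbx hdx hab hcd
    · rw [h.sum_sep_change hx ha hax hbx hcx hab hac, sep_swap_left,
        h.sum_sep_change hx hc hcx hax hdx (Ne.symm hac) hcd]
  have hex : ∃ ab : S × S, ab.1 ≠ ab.2 ∧ ab.1 ≠ x ∧ ab.2 ≠ x ∧
      (ab.1 ∈ S.white ∨ ab.2 ∈ S.white) := ⟨(a, b), hab, hax, hbx, hw⟩
  rw [cut, dif_pos hex]
  obtain ⟨h1, h2, h3, h4⟩ := hex.choose_spec
  generalize hex.choose = cd at *
  rcases hw with hw | hw <;> rcases h4 with h4 | h4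
  · exact key _ _ _ _ hab hax hbx hw h1 h2 h3 h4
  · rw [sep_swap_left cd.1]; exact key _ _ _ _ hab hax hbx hw h1.symm h3 h2 h4
  · rw [sep_swap_left a]; exact key _ _ _ _ hab.symm hbx hax hw h1 h2 h3 h4
  · rw [sep_swap_left a, sep_swap_left cd.1]
    exact key _ _ _ _ hab.symm hbx hax hw h1.symm h3 h2 h4

/-- The sum of the contributions `cut Θ x` of those `x` at which both elements of one pair, and
none of the other pair, are placed. -/
def cutSum (Θ : OrdPart S → B) (i j p q : S) : B :=
  ∑ x, if (i = x ∧ j = x ∧ p ≠ x ∧ q ≠ x) ∨ (p = x ∧ q = x ∧ i ≠ x ∧ j ≠ x) then cut Θ x else 0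

theorem cutSum_comm (i j p q : S) : cutSum Θ i j p q = cutSum Θ p q i j := by
  unfold cutSum
  simp only [or_comm]

theorem cutSum_eq_zero {i j p q : S} (hij : i ≠ j) (hpq : p ≠ q) : cutSum Θ i j p q = 0 := by
  refine Finset.sum_eq_zero fun x _ => if_neg ?_
  rintro (⟨rfl, rfl, -⟩ | ⟨rfl, rfl, -⟩)
  · exact hij rfl
  · exact hpq rfl

theorem sum_sep_eq_zero {i j p q : S} (h : i = p ∨ i = q ∨ j = p ∨ j = q) :
    ∑ A ∈ sep i j p q, Θ A = 0 := by
  refine Finset.sum_eq_zero fun A hA => ?_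
  rw [mem_sep] at hA
  rcases h with rfl | rfl | rfl | rfl
  · exact absurd hA.1 hA.2.2.1
  · exact absurd hA.1 hA.2.2.2
  · exact absurd hA.2.1 hA.2.2.1
  · exact absurd hA.2.1 hA.2.2.2

theorem Balanced.sum_sep_self (h : Balanced Θ) (h3 : 3 ≤ Nat.card S) {i p q : S}
    (hi : i ∈ S.white) (hpq : p = q → p ∈ S.white) (hw : p ∈ S.white ∨ q ∈ S.white) :
    ∑ A ∈ sep i i p q, Θ A = cutSum Θ i i p q := by
  by_cases hip : i = p
  · rw [sum_sep_eq_zero (Or.inl hip), cutSum, Finset.sum_eq_zero]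
    subst hip
    exact fun x _ => if_neg (by rintro (⟨h1, -, h2, -⟩ | ⟨h1, -, h2, -⟩) <;> exact h2 h1)
  by_cases hiq : i = q
  · rw [sum_sep_eq_zero (Or.inr (Or.inl hiq)), cutSum, Finset.sum_eq_zero]
    subst hiq
    exact fun x _ => if_neg (by rintro (⟨h1, -, -, h2⟩ | ⟨-, h1, -, h2⟩) <;> exact h2 h1)
  by_cases hpq' : p = q
  · subst hpq'
    obtain ⟨c, hc⟩ : ∃ c, c ∉ ({i, p} : Finset S) := by
      by_contra hcon
      push Not at hcon
      have h1 : Fintype.card S ≤ ({i, p} : Finset S).card :=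
        Finset.card_le_card (fun x _ => hcon x)
      have h2 := Finset.card_le_two (a := i) (b := p)
      rw [Nat.card_eq_fintype_card] at h3
      omega
    simp only [Finset.mem_insert, Finset.mem_singleton, not_or] at hc
    have e1 := h.sum_sep_eq_cut hi (a := p) (b := c) (Ne.symm hc.2) (Ne.symm hip) hc.1
      (Or.inl (hpq rfl))
    have e2 := h.sum_sep_eq_cut (hpq rfl) (a := i) (b := c) (Ne.symm hc.1) hip hc.2 (Or.inl hi)
    have e3 : cutSum Θ i i p p = cut Θ i + cut Θ p := by
      rw [cutSum, ← Finset.sum_subset (Finset.subset_univ {i, p}), Finset.sum_pair hip,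
        if_pos (Or.inl ⟨rfl, rfl, Ne.symm hip, Ne.symm hip⟩), if_pos (Or.inr ⟨rfl, rfl, hip, hip⟩)]
      intro x _ hx
      simp only [Finset.mem_insert, Finset.mem_singleton, not_or] at hx
      exact if_neg (by rintro (⟨h1, -⟩ | ⟨h1, -⟩); exacts [hx.1 h1.symm, hx.2 h1.symm])
    rw [e3, ← e1, ← e2, h.sum_sep_compl p c, sum_sep_split i i p p c, add_comm]
    congr 1 <;> refine Finset.sum_congr ?_ fun _ _ => rfl <;>
      (ext A; simp only [Finset.mem_filter, mem_sep]; tauto)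
  · rw [h.sum_sep_compl, h.sum_sep_eq_cut hi hpq' (Ne.symm hip) (Ne.symm hiq) hw, cutSum,
      Finset.sum_eq_single i, if_pos (Or.inl ⟨rfl, rfl, Ne.symm hip, Ne.symm hiq⟩)]
    · intro x _ hx
      exact if_neg (by rintro (⟨h1, -⟩ | ⟨h1, h2, -⟩); exacts [hx h1.symm, hpq' (h1.trans h2.symm)])
    · simp

theorem Balanced.sum_sep_of_eq (h : Balanced Θ) (h3 : 3 ≤ Nat.card S) {i j p q : S}
    (hij : i = j → i ∈ S.white) (hpq : p = q → p ∈ S.white) (hw : i ∈ S.white ∨ j ∈ S.white)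
    (hw' : p ∈ S.white ∨ q ∈ S.white) (heq : i = j ∨ p = q) :
    ∑ A ∈ sep i j p q, Θ A = cutSum Θ i j p q := by
  rcases heq with rfl | rfl
  · exact h.sum_sep_self h3 (hij rfl) hpq hw'
  · rw [h.sum_sep_compl, cutSum_comm]
    exact h.sum_sep_self h3 (hpq rfl) hij hw

/-- The linear relation of four elements that need not be distinct: elements that coincide are
white, and contribute the sums of the partitions that cut them off. -/
theorem Balanced.sum_sep_sub_sum_sep (h : Balanced Θ) (h3 : 3 ≤ Nat.card S) {i j p q : S}
    (hij : i = j → i ∈ S.white) (hpq : p = q → p ∈ S.white) (hpj : p = j → p ∈ S.white)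
    (hiq : i = q → i ∈ S.white) (w1 : i ∈ S.white ∨ j ∈ S.white) (w2 : p ∈ S.white ∨ q ∈ S.white)
    (w3 : p ∈ S.white ∨ j ∈ S.white) (w4 : i ∈ S.white ∨ q ∈ S.white) :
    ∑ A ∈ sep i j p q, Θ A - ∑ A ∈ sep p j i q, Θ A = cutSum Θ i j p q - cutSum Θ p j i q := by
  by_cases c1 : i = j ∨ p = q
  · rw [h.sum_sep_of_eq h3 hij hpq w1 w2 c1]
    by_cases c2 : p = j ∨ i = q
    · rw [h.sum_sep_of_eq h3 hpj hiq w3 w4 c2]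
    · rw [not_or] at c2
      rw [cutSum_eq_zero c2.1 c2.2, sum_sep_eq_zero]
      rcases c1 with c1 | c1
      · exact Or.inr (Or.inr (Or.inl c1.symm))
      · exact Or.inr (Or.inl c1)
  · rw [not_or] at c1
    by_cases c2 : p = j ∨ i = q
    · rw [h.sum_sep_of_eq h3 hpj hiq w3 w4 c2, cutSum_eq_zero c1.1 c1.2, sum_sep_eq_zero]
      rcases c2 with c2 | c2
      · exact Or.inr (Or.inr (Or.inl c2.symm))
      · exact Or.inr (Or.inl c2)
    · rw [not_or] at c2
      rw [cutSum_eq_zero c1.1 c1.2, cutSum_eq_zero c2.1 c2.2, sub_self]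
      by_cases c3 : i = p
      · rw [sum_sep_eq_zero (Or.inl c3), sum_sep_eq_zero (Or.inl c3.symm), sub_self]
      by_cases c4 : j = q
      · rw [sum_sep_eq_zero (Or.inr (Or.inr (Or.inr c4))),
          sum_sep_eq_zero (Or.inr (Or.inr (Or.inr c4))), sub_self]
      rw [h.rel i j p q ⟨⟨c1.1, c3, c2.2, Ne.symm c2.1, c4, c1.2⟩, ⟨w1, w2⟩, w3, w4⟩, sub_self]

end Cut

/-! ### Splittings of a painted set -/

/-- A splitting of the painted set `S` into the painted sets `X v`, modelled on a painted stable tree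
with tails `S`, vertices `v` and sets of flags `X v`: the map `br v` sends a tail to the flag at
`v` behind which it lies. Edges appear only through the stable sets `br v ⁻¹' {x}` of tails behind
their halves. By `sep`, distinct vertices `v` and `w` have flags pointing to each other such that
every tail lies behind one of them; by `flip`, the other half of an edge is a flag, too; by `cover`, a
stable part that crosses no edge is a union of sets of tails behind the flags of some vertex. -/
structure Splitting (S : PaintedSet.{u}) (V : Type v) where
  X : V → PaintedSet.{u}
  br : ∀ v, S → X v
  surj : ∀ v, Function.Surjective (br v)
  white_iff : ∀ v x, x ∈ (X v).white ↔ ∃ s ∈ S.white, br v s = x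
  stable : ∀ v s s', s ≠ s' → br v s = br v s' → IsStablePart (br v ⁻¹' {br v s})
  three_le : ∀ v, 3 ≤ Nat.card (X v)
  sep : ∀ v w, v ≠ w → ∃ x y, ∀ s, br v s = x ∨ br w s = y
  flip : ∀ v x, IsStablePart (br v ⁻¹' {x}) → ∃ w y, br w ⁻¹' {y} = (br v ⁻¹' {x})ᶜ
  cover : ∀ A : Set S, IsStablePart A →
    (∀ v x, IsStablePart (br v ⁻¹' {x}) → ¬ Crosses A (br v ⁻¹' {x})) →
      ∃ v, ∀ s s', br v s = br v s' → s ∈ A → s' ∈ A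

namespace Splitting

open Classical

variable {S : PaintedSet.{u}} {V : Type v} (𝒯 : Splitting S V)

/-- The ordered partitions of `S` given by the edges. -/
def IsEdge (A : OrdPart S) : Prop := ∃ v x, 𝒯.br v ⁻¹' {x} = A.1

variable {𝒯}

theorem isEdge_compl {A : OrdPart S} (h : 𝒯.IsEdge A) : 𝒯.IsEdge A.compl := by
  obtain ⟨v, x, h⟩ := h
  obtain ⟨w, y, h'⟩ := 𝒯.flip v x (by rw [h]; exact A.2)
  exact ⟨w, y, by rw [h', h]; rfl⟩

variable (𝒯)

/-- The partition of `S` induced by a partition of `X v`. -/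
def ext (v : V) (α : OrdPart (𝒯.X v)) : OrdPart S :=
  ⟨𝒯.br v ⁻¹' α.1, by
    have card : ∀ α : Set (𝒯.X v), 2 ≤ α.ncard → 2 ≤ (𝒯.br v ⁻¹' α).ncard := fun α h =>
      h.trans (by
        have := Set.ncard_image_le (f := 𝒯.br v) (Set.toFinite (𝒯.br v ⁻¹' α))
        rwa [Set.image_preimage_eq _ (𝒯.surj v)] at this)
    have white : ∀ α : Set (𝒯.X v), (α ∩ (𝒯.X v).white).Nonempty →
        (𝒯.br v ⁻¹' α ∩ S.white).Nonempty := by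
      rintro α ⟨x, hx, hw⟩
      obtain ⟨s, hs, rfl⟩ := (𝒯.white_iff v x).1 hw
      exact ⟨s, hx, hs⟩
    exact ⟨card _ α.2.two_le, card _ α.2.two_le_compl, white _ α.2.white, white _ α.2.white_compl⟩⟩

variable {𝒯}

theorem mem_ext {v : V} {α : OrdPart (𝒯.X v)} {s : S} : s ∈ (𝒯.ext v α).1 ↔ 𝒯.br v s ∈ α.1 :=
  Iff.rfl

theorem ext_compl (v : V) (α : OrdPart (𝒯.X v)) : 𝒯.ext v α.compl = (𝒯.ext v α).compl := rfl

theorem ext_mem_sep {v : V} {α : OrdPart (𝒯.X v)} {i j p q : S} :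
    𝒯.ext v α ∈ PaintedTrees.sep i j p q ↔
      α ∈ PaintedTrees.sep (𝒯.br v i) (𝒯.br v j) (𝒯.br v p) (𝒯.br v q) := by
  rw [mem_sep, mem_sep]
  rfl

theorem exists_two {X : PaintedSet.{u}} {α : Set X} (h : IsStablePart α) (x : X) :
    ∃ y ∈ α, y ≠ x := by
  obtain ⟨a, ha, b, hb, hab⟩ := (Set.one_lt_ncard (Set.toFinite _)).1 h.two_le
  by_cases hax : a = x
  · exact ⟨b, hb, fun hbx => hab (hax.trans hbx.symm)⟩
  · exact ⟨a, ha, hax⟩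

/-- Seen from a vertex `v`, one side of every edge lies behind one flag. -/
theorem fiber_subset (v w : V) (y : 𝒯.X w) :
    ∃ x, 𝒯.br w ⁻¹' {y} ⊆ 𝒯.br v ⁻¹' {x} ∨ (𝒯.br w ⁻¹' {y})ᶜ ⊆ 𝒯.br v ⁻¹' {x} := by
  by_cases hvw : v = w
  · subst hvw
    exact ⟨y, Or.inl le_rfl⟩
  · obtain ⟨x, y', h⟩ := 𝒯.sep v w hvw
    refine ⟨x, ?_⟩
    by_cases hy : y = y'
    · subst hy
      exact Or.inr fun s hs => (h s).resolve_right hs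
    · exact Or.inl fun s hs => (h s).resolve_right fun h' => hy (Eq.trans (Eq.symm hs) h')

theorem not_crosses_ext_fiber (v w : V) (α : Set (𝒯.X v)) (y : 𝒯.X w) :
    ¬ Crosses (𝒯.br v ⁻¹' α) (𝒯.br w ⁻¹' {y}) := by
  have key : ∀ (B : Set S) (x : 𝒯.X v), B ⊆ 𝒯.br v ⁻¹' {x} → ¬ Crosses B (𝒯.br v ⁻¹' α) := by
    intro B x hB
    by_cases hx : x ∈ α
    · exact not_crosses_of_subset fun s hs => by
        have := hB hs
        rw [Set.mem_preimage, Set.mem_singleton_iff] at this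
        rwa [Set.mem_preimage, this]
    · rw [← crosses_compl_right]
      exact not_crosses_of_subset fun s hs => by
        have := hB hs
        rw [Set.mem_preimage, Set.mem_singleton_iff] at this
        rwa [Set.mem_compl_iff, Set.mem_preimage, this]
  rw [crosses_comm]
  obtain ⟨x, h | h⟩ := 𝒯.fiber_subset v w y
  · exact key _ x h
  · rw [← crosses_compl_left]
    exact key _ x h

theorem not_crosses_ext_edge {v : V} (α : OrdPart (𝒯.X v)) {A : OrdPart S} (hA : 𝒯.IsEdge A) :
    ¬ Crosses (𝒯.ext v α).1 A.1 := by
  obtain ⟨w, y, h⟩ := hA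
  rw [← h]
  exact not_crosses_ext_fiber v w α.1 y

theorem not_crosses_edges {A A' : OrdPart S} (hA : 𝒯.IsEdge A) (hA' : 𝒯.IsEdge A') :
    ¬ Crosses A.1 A'.1 := by
  obtain ⟨v, x, h⟩ := hA
  obtain ⟨w, y, h'⟩ := hA'
  rw [← h, ← h']
  exact not_crosses_ext_fiber v w {x} y

/-- Partitions induced from different vertices: after a choice of the order of the parts, one part
of the first one lies behind a flag at the second vertex. -/
theorem ext_subset {v w : V} (hvw : v ≠ w) (α : OrdPart (𝒯.X v)) :
    ∃ α' : OrdPart (𝒯.X v), (α' = α ∨ α' = α.compl) ∧ ∃ y, (𝒯.ext v α').1 ⊆ 𝒯.br w ⁻¹' {y} := by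
  obtain ⟨x, y, h⟩ := 𝒯.sep v w hvw
  by_cases hx : x ∈ α.1
  · exact ⟨α.compl, Or.inr rfl, y, fun s hs => (h s).resolve_left fun h' => hs (h' ▸ hx)⟩
  · exact ⟨α, Or.inl rfl, y, fun s hs => (h s).resolve_left fun h' =>
      hx (h' ▸ (show 𝒯.br v s ∈ α.1 from hs))⟩

theorem not_crosses_ext_ext {v w : V} (hvw : v ≠ w) (α : OrdPart (𝒯.X v))
    (β : OrdPart (𝒯.X w)) : ¬ Crosses (𝒯.ext v α).1 (𝒯.ext w β).1 := by
  obtain ⟨α', hα', y, hy⟩ := 𝒯.ext_subset hvw α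
  have : ¬ Crosses (𝒯.ext v α').1 (𝒯.ext w β).1 := by
    by_cases hyb : y ∈ β.1
    · exact not_crosses_of_subset fun s hs => by
        have := hy hs
        rw [Set.mem_preimage, Set.mem_singleton_iff] at this
        rwa [mem_ext, this]
    · rw [← crosses_compl_right]
      exact not_crosses_of_subset fun s hs => by
        have := hy hs
        rw [Set.mem_preimage, Set.mem_singleton_iff] at this
        rwa [Set.mem_compl_iff, mem_ext, this]
  rcases hα' with rfl | rfl
  · exact this
  · rwa [ext_compl, OrdPart.compl_val, crosses_compl_left] at this

theorem crosses_ext_iff {v : V} {α β : OrdPart (𝒯.X v)} :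
    Crosses (𝒯.ext v α).1 (𝒯.ext v β).1 ↔ Crosses α.1 β.1 := by
  have key : ∀ A : Set (𝒯.X v), (𝒯.br v ⁻¹' A).Nonempty ↔ A.Nonempty := fun A =>
    (𝒯.surj v).nonempty_preimage
  unfold Crosses
  rw [← key, ← key, ← key, ← key]
  rfl

theorem not_isEdge_ext (v : V) (α : OrdPart (𝒯.X v)) : ¬ 𝒯.IsEdge (𝒯.ext v α) := by
  have key : ∀ (α : OrdPart (𝒯.X v)) (x : 𝒯.X v), ¬ (𝒯.ext v α).1 ⊆ 𝒯.br v ⁻¹' {x} := by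
    intro α x h
    obtain ⟨y, hy, hyx⟩ := exists_two α.2 x
    obtain ⟨s, rfl⟩ := 𝒯.surj v y
    exact hyx (h hy)
  rintro ⟨w, y, h⟩
  obtain ⟨x, hx⟩ := 𝒯.fiber_subset v w y
  rw [h] at hx
  rcases hx with hx | hx
  · exact key α x hx
  · exact key α.compl x hx

theorem ext_injective {v w : V} {α : OrdPart (𝒯.X v)} {β : OrdPart (𝒯.X w)}
    (h : 𝒯.ext v α = 𝒯.ext w β) : (⟨v, α⟩ : Σ v, OrdPart (𝒯.X v)) = ⟨w, β⟩ := by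
  by_cases hvw : v = w
  · subst hvw
    congr 1
    apply Subtype.ext
    exact (𝒯.surj v).preimage_injective (congrArg Subtype.val h)
  · exfalso
    have key : ∀ (β : OrdPart (𝒯.X w)) (y : 𝒯.X w), ¬ (𝒯.ext w β).1 ⊆ 𝒯.br w ⁻¹' {y} := by
      intro α x h
      obtain ⟨y, hy, hyx⟩ := exists_two α.2 x
      obtain ⟨s, rfl⟩ := 𝒯.surj w y
      exact hyx (h hy)
    obtain ⟨α', hα', y, hy⟩ := 𝒯.ext_subset hvw α
    rcases hα' with rfl | rfl
    · rw [h] at hy; exact key β y hy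
    · rw [ext_compl, h] at hy; exact key β.compl y hy

/-- Every partition crosses an edge, or is given by an edge, or is induced from a vertex. -/
theorem exists_ext {A : OrdPart S} (h : ∀ B, 𝒯.IsEdge B → ¬ Crosses A.1 B.1)
    (hA : ¬ 𝒯.IsEdge A) : ∃ v α, 𝒯.ext v α = A := by
  obtain ⟨v, hv⟩ := 𝒯.cover A.1 A.2 (fun v x hx => h ⟨_, hx⟩ ⟨v, x, rfl⟩)
  have hpre : ∀ s, 𝒯.br v s ∈ 𝒯.br v '' A.1 ↔ s ∈ A.1 := fun s =>
    ⟨fun ⟨t, ht, hts⟩ => hv t s hts ht, fun hs => ⟨s, hs, rfl⟩⟩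
  have two : ∀ B : OrdPart S, ¬ 𝒯.IsEdge B → (∀ s s', 𝒯.br v s = 𝒯.br v s' → s ∈ B.1 → s' ∈ B.1) →
      2 ≤ (𝒯.br v '' B.1).ncard ∧ (𝒯.br v '' B.1 ∩ (𝒯.X v).white).Nonempty := by
    intro B hB hB'
    constructor
    · obtain ⟨s, hs, hsw⟩ := B.2.white
      refine (Set.one_lt_ncard (Set.toFinite _)).2 ⟨_, ⟨s, hs, rfl⟩, ?_⟩
      by_contra hcon
      push Not at hcon
      refine hB ⟨v, 𝒯.br v s, Set.Subset.antisymm (fun t ht => hB' s t (Eq.symm ht) hs)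
        fun t ht => (hcon _ ⟨t, ht, rfl⟩).symm⟩
    · obtain ⟨s, hs, hsw⟩ := B.2.white
      exact ⟨_, ⟨s, hs, rfl⟩, (𝒯.white_iff v _).2 ⟨s, hsw, rfl⟩⟩
  have hc : (𝒯.br v '' A.1)ᶜ = 𝒯.br v '' A.compl.1 := by
    ext x
    obtain ⟨s, rfl⟩ := 𝒯.surj v x
    rw [Set.mem_compl_iff, hpre]
    exact ⟨fun hs => ⟨s, hs, rfl⟩, fun ⟨t, ht, hts⟩ hs => ht (hv s t hts.symm hs)⟩
  have t1 := two A hA hv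
  have t2 := two A.compl (fun h' => hA (by simpa using isEdge_compl h'))
    (fun s s' hss hs hs' => hs (hv s' s hss.symm hs'))
  rw [← hc] at t2
  exact ⟨v, ⟨𝒯.br v '' A.1, t1.1, t2.1, t1.2, t2.2⟩, Subtype.ext (Set.ext hpre)⟩

theorem fiber_nonempty (v : V) (x : 𝒯.X v) : (𝒯.br v ⁻¹' {x}).Nonempty :=
  (𝒯.surj v).nonempty_preimage.2 ⟨x, rfl⟩

theorem exists_third (v : V) (x y : 𝒯.X v) : ∃ s, 𝒯.br v s ≠ x ∧ 𝒯.br v s ≠ y := by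
  by_contra hcon
  push Not at hcon
  have h1 : Fintype.card (𝒯.X v) ≤ ({x, y} : Finset (𝒯.X v)).card := by
    refine Finset.card_le_card fun z _ => ?_
    obtain ⟨s, rfl⟩ := 𝒯.surj v z
    by_cases h : 𝒯.br v s = x
    · simp [h]
    · simp [hcon s h]
  have h2 := Finset.card_le_two (a := x) (b := y)
  have h3 := 𝒯.three_le v
  rw [Nat.card_eq_fintype_card] at h3
  omega

/-- The flags are determined by the sets of tails behind them. -/
theorem fiber_injective {v w : V} {x : 𝒯.X v} {y : 𝒯.X w} (h : 𝒯.br v ⁻¹' {x} = 𝒯.br w ⁻¹' {y}) :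
    (⟨v, x⟩ : Σ v, 𝒯.X v) = ⟨w, y⟩ := by
  by_cases hvw : v = w
  · subst hvw
    obtain ⟨s, hs⟩ := fiber_nonempty v x
    have hs' : s ∈ 𝒯.br v ⁻¹' {y} := h ▸ hs
    rw [show x = y from Eq.trans (Eq.symm hs) hs']
  · exfalso
    have key : ∀ {v w : V} {x : 𝒯.X v} {y : 𝒯.X w}, 𝒯.br v ⁻¹' {x} = 𝒯.br w ⁻¹' {y} →
        ∀ x0 y0, (∀ s, 𝒯.br v s = x0 ∨ 𝒯.br w s = y0) → x = x0 := by
      intro v w x y h x0 y0 h0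
      by_contra hx
      have hsub : ∀ s, 𝒯.br v s = x → 𝒯.br w s = y0 := fun s hs =>
        (h0 s).resolve_left fun h' => hx (hs.symm.trans h')
      have hy : y = y0 := by
        obtain ⟨s, hs⟩ := fiber_nonempty v x
        exact Eq.trans (Eq.symm (show s ∈ 𝒯.br w ⁻¹' {y} from h ▸ hs)) (hsub s hs)
      subst hy
      obtain ⟨s, hs1, hs2⟩ := exists_third v x x0
      have : s ∈ 𝒯.br v ⁻¹' {x} := h ▸ (h0 s).resolve_left hs2
      exact hs1 this
    obtain ⟨x0, y0, h0⟩ := 𝒯.sep v w hvw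
    have hx := key h x0 y0 h0
    have hy := key h.symm y0 x0 fun s => (h0 s).symm
    subst hx hy
    obtain ⟨s, hs, -⟩ := exists_third v x x
    have hs' : s ∈ 𝒯.br v ⁻¹' {x} := h ▸ (h0 s).resolve_left hs
    exact hs hs'

end Splitting

namespace Splitting

open Classical

/-! ### Balanced functions on a splitting -/

section Sums

variable {S : PaintedSet.{u}} {V : Type v} {𝒯 : Splitting S V}

theorem white_of_eq {v : V} {s t : S} (hst : s ≠ t) (h : 𝒯.br v s = 𝒯.br v t) :
    𝒯.br v s ∈ (𝒯.X v).white := by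
  obtain ⟨a, ha, haw⟩ := (𝒯.stable v s t hst h).white
  exact (𝒯.white_iff v _).2 ⟨a, haw, ha⟩

variable [Fintype V] (𝒯) {B : Type*} [AddCommGroup B] {Θ : OrdPart S → B}

/-- The sum of the contributions of the two halves of the edge that gives the partition `A`. -/
def edgeSum (Θ : OrdPart S → B) (A : OrdPart S) : B :=
  ∑ v, ∑ x, if 𝒯.br v ⁻¹' {x} = A.1 ∨ 𝒯.br v ⁻¹' {x} = A.1ᶜ then
    cut (fun α => Θ (𝒯.ext v α)) x else 0

variable {𝒯}

theorem edgeSum_eq {A : OrdPart S} {v w : V} {x : 𝒯.X v} {y : 𝒯.X w}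
    (hx : 𝒯.br v ⁻¹' {x} = A.1) (hy : 𝒯.br w ⁻¹' {y} = A.1ᶜ) :
    𝒯.edgeSum Θ A = cut (fun α => Θ (𝒯.ext v α)) x + cut (fun α => Θ (𝒯.ext w α)) y := by
  have hne : (⟨v, x⟩ : Σ v, 𝒯.X v) ≠ ⟨w, y⟩ := by
    intro h
    obtain ⟨rfl, h⟩ := Sigma.mk.inj h
    obtain rfl := eq_of_heq h
    obtain ⟨s, hs⟩ := fiber_nonempty v x
    have h1 := hs
    rw [hx] at h1
    rw [hy] at hs
    exact hs h1
  have h := Fintype.sum_sigma (fun p : Σ v, 𝒯.X v =>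
    if 𝒯.br p.1 ⁻¹' {p.2} = A.1 ∨ 𝒯.br p.1 ⁻¹' {p.2} = A.1ᶜ then
      cut (fun α => Θ (𝒯.ext p.1 α)) p.2 else 0)
  rw [edgeSum]
  refine h.symm.trans ?_
  rw [← Finset.sum_subset (Finset.subset_univ {⟨v, x⟩, ⟨w, y⟩}), Finset.sum_pair hne,
    if_pos (Or.inl hx), if_pos (Or.inr hy)]
  rintro ⟨z, t⟩ _ hz
  simp only [Finset.mem_insert, Finset.mem_singleton, not_or] at hz
  refine if_neg ?_
  rintro (h' | h')
  · exact hz.1 (fiber_injective (h'.trans hx.symm))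
  · exact hz.2 (fiber_injective (h'.trans hy.symm))

theorem edgeSum_compl (A : OrdPart S) : 𝒯.edgeSum Θ A.compl = 𝒯.edgeSum Θ A := by
  unfold edgeSum
  simp only [OrdPart.compl_val, compl_compl, or_comm]

/-- Separation of a sum into the contributions of the vertices and of the edges. -/
theorem sum_sep_eq (h0 : ∀ A B, 𝒯.IsEdge B → Crosses A.1 B.1 → Θ A = 0) (i j p q : S) :
    ∑ A ∈ PaintedTrees.sep i j p q, Θ A =
      (∑ v, ∑ α ∈ PaintedTrees.sep (𝒯.br v i) (𝒯.br v j) (𝒯.br v p) (𝒯.br v q), Θ (𝒯.ext v α)) +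
        ∑ A ∈ (PaintedTrees.sep i j p q).filter 𝒯.IsEdge, Θ A := by
  rw [← Finset.sum_filter_not_add_sum_filter _ 𝒯.IsEdge]
  congr 1
  rw [Finset.sum_sigma']
  symm
  refine Finset.sum_of_injOn (fun z => 𝒯.ext z.1 z.2) (fun a _ b _ h => ext_injective h) ?_ ?_
    (fun _ _ => rfl)
  · rintro ⟨v, α⟩ h
    rw [Finset.mem_coe, Finset.mem_sigma] at h
    exact Finset.mem_filter.2 ⟨ext_mem_sep.2 h.2, not_isEdge_ext v α⟩
  · intro A hA hA'
    rw [Finset.mem_filter] at hA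
    by_contra hne
    obtain ⟨v, α, rfl⟩ := exists_ext (𝒯 := 𝒯) (A := A) (fun B hB hAB => hne (h0 A B hB hAB)) hA.2
    refine hA' ⟨⟨v, α⟩, ?_, rfl⟩
    rw [Finset.mem_coe, Finset.mem_sigma]
    exact ⟨Finset.mem_univ _, ext_mem_sep.1 hA.1⟩

theorem sum_ite_eq_or {s : Finset (OrdPart S)} (A₀ : OrdPart S) (c : B) :
    (∑ A ∈ s, if A = A₀ ∨ A = A₀.compl then c else 0) =
      (if A₀ ∈ s then c else 0) + if A₀.compl ∈ s then c else 0 := by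
  have : ∀ A, (if A = A₀ ∨ A = A₀.compl then c else 0) =
      (if A = A₀ then c else 0) + if A = A₀.compl then c else 0 := by
    intro A
    by_cases h1 : A = A₀
    · subst h1; simp [A.ne_compl]
    · simp [h1]
  simp only [this, Finset.sum_add_distrib, Finset.sum_ite_eq']

theorem sum_edgeSum {i j p q : S} (hij : i ≠ j) (hpq : p ≠ q) :
    ∑ A ∈ (PaintedTrees.sep i j p q).filter 𝒯.IsEdge, 𝒯.edgeSum Θ A =
      ∑ v, cutSum (fun α => Θ (𝒯.ext v α)) (𝒯.br v i) (𝒯.br v j) (𝒯.br v p) (𝒯.br v q) := by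
  unfold edgeSum
  rw [Finset.sum_comm]
  refine Finset.sum_congr rfl fun v _ => ?_
  rw [Finset.sum_comm, cutSum]
  refine Finset.sum_congr rfl fun x _ => ?_
  by_cases hst : IsStablePart (𝒯.br v ⁻¹' {x})
  · obtain ⟨A₀, hA₀⟩ : ∃ A₀ : OrdPart S, 𝒯.br v ⁻¹' {x} = A₀.1 := ⟨⟨_, hst⟩, rfl⟩
    have h1 : ∀ A : OrdPart S, (𝒯.br v ⁻¹' {x} = A.1 ∨ 𝒯.br v ⁻¹' {x} = A.1ᶜ) ↔
        (A = A₀ ∨ A = A₀.compl) := by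
      intro A
      rw [hA₀]
      constructor
      · rintro (h | h)
        · exact Or.inl (Subtype.ext h.symm)
        · exact Or.inr (Subtype.ext (by rw [OrdPart.compl_val, h, compl_compl]))
      · rintro (rfl | rfl)
        · exact Or.inl rfl
        · exact Or.inr (compl_compl _).symm
    have hE : 𝒯.IsEdge A₀ := ⟨v, x, hA₀⟩
    have hmem : ∀ s, s ∈ A₀.1 ↔ 𝒯.br v s = x := fun s => by rw [← hA₀]; rfl
    simp only [h1, sum_ite_eq_or, Finset.mem_filter, hE, isEdge_compl hE, and_true, mem_sep,
      OrdPart.compl_val, Set.mem_compl_iff, hmem, not_not]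
    by_cases h2 : 𝒯.br v i = x ∧ 𝒯.br v j = x ∧ 𝒯.br v p ≠ x ∧ 𝒯.br v q ≠ x
    · rw [if_pos h2, if_neg (by tauto), if_pos (Or.inl h2), add_zero]
    · rw [if_neg h2, zero_add]
      exact if_congr (by tauto) rfl rfl
  · rw [Finset.sum_eq_zero, if_neg]
    · rintro (⟨h1, h2, -⟩ | ⟨h1, h2, -⟩)
      · exact hst (by rw [← h1]; exact 𝒯.stable v i j hij (h1.trans h2.symm))
      · exact hst (by rw [← h1]; exact 𝒯.stable v p q hpq (h1.trans h2.symm))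
    · intro A _
      refine if_neg ?_
      rintro (h | h)
      · exact hst (by rw [h]; exact A.2)
      · exact hst (by rw [h]; exact A.2.compl)

/-- If `Θ` is balanced at every vertex, then the linear relations fail for the vertices alone exactly
by the contributions of the edges. -/
theorem sum_vertices (hΘ : ∀ v, Balanced fun α => Θ (𝒯.ext v α)) {i j p q : S}
    (hall : Allowed S.white i j p q) :
    (∑ v, ∑ α ∈ PaintedTrees.sep (𝒯.br v i) (𝒯.br v j) (𝒯.br v p) (𝒯.br v q), Θ (𝒯.ext v α)) -
      (∑ v, ∑ α ∈ PaintedTrees.sep (𝒯.br v p) (𝒯.br v j) (𝒯.br v i) (𝒯.br v q), Θ (𝒯.ext v α)) =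
    ∑ A ∈ (PaintedTrees.sep i j p q).filter 𝒯.IsEdge, 𝒯.edgeSum Θ A -
      ∑ A ∈ (PaintedTrees.sep p j i q).filter 𝒯.IsEdge, 𝒯.edgeSum Θ A := by
  obtain ⟨⟨n1, n2, n3, n4, n5, n6⟩, ⟨w1, w2⟩, w3, w4⟩ := hall
  rw [sum_edgeSum n1 n6, sum_edgeSum n4.symm n3, ← Finset.sum_sub_distrib,
    ← Finset.sum_sub_distrib]
  have white : ∀ v s, s ∈ S.white → 𝒯.br v s ∈ (𝒯.X v).white :=
    fun v s hs => (𝒯.white_iff v _).2 ⟨s, hs, rfl⟩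
  refine Finset.sum_congr rfl fun v _ => (hΘ v).sum_sep_sub_sum_sep (𝒯.three_le v)
    (white_of_eq n1) (white_of_eq n6) (white_of_eq n4.symm) (white_of_eq n3)
    (w1.imp (white v _) (white v _)) (w2.imp (white v _) (white v _))
    (w3.imp (white v _) (white v _)) (w4.imp (white v _) (white v _))

/-- A function that vanishes on the partitions crossing an edge is balanced if it is balanced at
every vertex and takes the appropriate values at the edges. -/
theorem balanced (h0 : ∀ A B, 𝒯.IsEdge B → Crosses A.1 B.1 → Θ A = 0)
    (hsymm : ∀ A, Θ A.compl = Θ A) (hΘ : ∀ v, Balanced fun α => Θ (𝒯.ext v α))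
    (hE : ∀ A, 𝒯.IsEdge A → Θ A = - 𝒯.edgeSum Θ A) : Balanced Θ where
  symm := hsymm
  rel i j p q hall := by
    have key : ∀ s : Finset (OrdPart S), ∑ A ∈ s.filter 𝒯.IsEdge, Θ A =
        - ∑ A ∈ s.filter 𝒯.IsEdge, 𝒯.edgeSum Θ A := by
      intro s
      rw [← Finset.sum_neg_distrib]
      exact Finset.sum_congr rfl fun A hA => hE A (Finset.mem_filter.1 hA).2
    rw [← sub_eq_zero, sum_sep_eq h0, sum_sep_eq h0, key, key, add_sub_add_comm,
      sum_vertices hΘ hall]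
    abel

theorem balanced_ext (h0 : ∀ A B, 𝒯.IsEdge B → Crosses A.1 B.1 → Θ A = 0) (hΘ : Balanced Θ)
    (v : V) : Balanced fun α => Θ (𝒯.ext v α) where
  symm α := hΘ.symm (𝒯.ext v α)
  rel I J P Q hall := by
    obtain ⟨⟨n1, n2, n3, n4, n5, n6⟩, ⟨w1, w2⟩, w3, w4⟩ := hall
    -- Choose a tail behind every flag, which is white whenever the flag is white.
    have pick : ∀ x : 𝒯.X v, ∃ s, 𝒯.br v s = x ∧ (x ∈ (𝒯.X v).white → s ∈ S.white) := by
      intro x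
      by_cases hx : x ∈ (𝒯.X v).white
      · obtain ⟨s, hs, h⟩ := (𝒯.white_iff v x).1 hx
        exact ⟨s, h, fun _ => hs⟩
      · obtain ⟨s, h⟩ := 𝒯.surj v x
        exact ⟨s, h, fun h' => absurd h' hx⟩
    obtain ⟨i, rfl, wi⟩ := pick I
    obtain ⟨j, rfl, wj⟩ := pick J
    obtain ⟨p, rfl, wp⟩ := pick P
    obtain ⟨q, rfl, wq⟩ := pick Q
    have hrel := hΘ.rel i j p q ⟨⟨ne_of_apply_ne _ n1, ne_of_apply_ne _ n2, ne_of_apply_ne _ n3,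
      ne_of_apply_ne _ n4, ne_of_apply_ne _ n5, ne_of_apply_ne _ n6⟩, ⟨w1.imp wi wj, w2.imp wp wq⟩,
      w3.imp wp wj, w4.imp wi wq⟩
    -- No other vertex and no edge separates the four tails into pairs.
    have far : ∀ (B : OrdPart S) (x : 𝒯.X v), B.1 ⊆ 𝒯.br v ⁻¹' {x} → ∀ a b c d : S,
        𝒯.br v a ≠ 𝒯.br v b → 𝒯.br v c ≠ 𝒯.br v d → B ∉ PaintedTrees.sep a b c d ∧
          B.compl ∉ PaintedTrees.sep a b c d := by
      intro B x hB a b c d hab hcd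
      rw [compl_mem_sep, mem_sep, mem_sep]
      exact ⟨fun h => hab (Eq.trans (hB h.1) (Eq.symm (hB h.2.1))),
        fun h => hcd (Eq.trans (hB h.1) (Eq.symm (hB h.2.1)))⟩
    have farw : ∀ w, w ≠ v → ∀ a b c d : S, 𝒯.br v a ≠ 𝒯.br v b → 𝒯.br v c ≠ 𝒯.br v d →
        ∑ α ∈ PaintedTrees.sep (𝒯.br w a) (𝒯.br w b) (𝒯.br w c) (𝒯.br w d), Θ (𝒯.ext w α) = 0 := by
      intro w hw a b c d hab hcd
      refine Finset.sum_eq_zero fun α hα => ?_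
      exfalso
      rw [← ext_mem_sep] at hα
      obtain ⟨α', hα', y, hy⟩ := ext_subset hw α
      rcases hα' with rfl | rfl
      · exact (far _ y hy a b c d hab hcd).1 hα
      · refine (far _ y hy a b c d hab hcd).2 ?_
        rwa [ext_compl, OrdPart.compl_compl]
    have fare : ∀ a b c d : S, 𝒯.br v a ≠ 𝒯.br v b → 𝒯.br v c ≠ 𝒯.br v d →
        ∑ A ∈ (PaintedTrees.sep a b c d).filter 𝒯.IsEdge, Θ A = 0 := by
      intro a b c d hab hcd
      refine Finset.sum_eq_zero fun A hA => ?_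
      exfalso
      obtain ⟨hA, w, y, hy⟩ := Finset.mem_filter.1 hA
      obtain ⟨x, hx | hx⟩ := fiber_subset v w y
      · exact (far A x (by rwa [← hy]) a b c d hab hcd).1 hA
      · refine (far A.compl x (by rwa [OrdPart.compl_val, ← hy]) a b c d hab hcd).2 ?_
        rwa [OrdPart.compl_compl]
    rwa [sum_sep_eq h0, sum_sep_eq h0, fare i j p q n1 n6, fare p j i q (Ne.symm n4) n3, add_zero,
      add_zero, Finset.sum_eq_single v (fun w _ hw => farw w hw i j p q n1 n6) (by simp),
      Finset.sum_eq_single v (fun w _ hw => farw w hw p j i q (Ne.symm n4) n3) (by simp)] at hrel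

/-- The values of a balanced function at the edges. -/
theorem eq_neg_edgeSum (h0 : ∀ A B, 𝒯.IsEdge B → Crosses A.1 B.1 → Θ A = 0) (hΘ : Balanced Θ)
    {A : OrdPart S} (hA : 𝒯.IsEdge A) : Θ A = - 𝒯.edgeSum Θ A := by
  obtain ⟨i, j, p, q, hall, hAs, h1, h2⟩ := exists_dual (C := {A | 𝒯.IsEdge A})
    (fun B hB => isEdge_compl hB) (fun A hA B hB => not_crosses_edges hA hB) hA
  have e1 : (PaintedTrees.sep i j p q).filter 𝒯.IsEdge = {A} := by
    ext B
    rw [Finset.mem_filter, Finset.mem_singleton]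
    exact ⟨fun h => h1 B h.2 h.1, by rintro rfl; exact ⟨hAs, hA⟩⟩
  have e2 : (PaintedTrees.sep p j i q).filter 𝒯.IsEdge = ∅ :=
    Finset.filter_eq_empty_iff.2 fun B hB hB' => h2 B hB' hB
  have hv := sum_vertices (balanced_ext h0 hΘ) hall
  have hrel := hΘ.rel i j p q hall
  rw [sum_sep_eq h0, sum_sep_eq h0, e1, e2, Finset.sum_singleton, Finset.sum_empty, add_zero] at hrel
  rw [e1, e2, Finset.sum_singleton, Finset.sum_empty, sub_zero, ← hrel, sub_add_cancel_left] at hv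
  rw [← hv, neg_neg]

end Sums

/-! ### Cohomology of a splitting -/

section Restriction

variable {k : Type w} [CommRing k] {S : PaintedSet.{u}} {V : Type v}
  (𝒯 : Splitting S V) {B : Type*} [CommRing B] [Algebra k B]

/-- A homomorphism from the cohomology ring of `S` that is given at the vertices of the splitting
by the homomorphisms `φ v`, and kills the generators of the partitions that cross an edge. -/
structure IsRes (φ : ∀ v, Coh k (𝒯.X v) →ₐ[k] B) (r : Coh k S →ₐ[k] B) : Prop where
  ext : ∀ v α, r (cls k (𝒯.ext v α)) = φ v (cls k α)
  crosses : ∀ A A', 𝒯.IsEdge A' → Crosses A.1 A'.1 → r (cls k A) = 0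

variable {𝒯} {φ : ∀ v, Coh k (𝒯.X v) →ₐ[k] B}

variable (k 𝒯) in
/-- The ideal generated by the partitions that cross an edge. -/
def crossIdeal : Ideal (Coh k S) :=
  Ideal.span {x | ∃ A A', 𝒯.IsEdge A' ∧ Crosses A.1 A'.1 ∧ x = cls k A}

theorem cls_mem_crossIdeal {A A' : OrdPart S} (hA' : 𝒯.IsEdge A') (h : Crosses A.1 A'.1) :
    cls k A ∈ 𝒯.crossIdeal k :=
  Ideal.subset_span ⟨A, A', hA', h, rfl⟩

theorem IsRes.range_le {r : Coh k S →ₐ[k] B} (hr : 𝒯.IsRes φ r) (v : V) :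
    (φ v).range ≤ r.range := by
  rw [← Algebra.map_top, ← coh_adjoin, AlgHom.map_adjoin]
  refine Algebra.adjoin_le ?_
  rintro _ ⟨_, ⟨α, rfl⟩, rfl⟩
  exact ⟨_, hr.ext v α⟩

variable [Fintype V]

theorem IsRes.edge {r : Coh k S →ₐ[k] B} (hr : 𝒯.IsRes φ r) {A : OrdPart S} (hA : 𝒯.IsEdge A) :
    r (cls k A) = - 𝒯.edgeSum (fun A => r (cls k A)) A :=
  eq_neg_edgeSum (Θ := fun A => r (cls k A)) hr.crosses (balanced_cls.map r) hA

/-- A partition crosses an edge, or is induced from a vertex, or is given by an edge, and the values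
at the edges are determined by those at the vertices. -/
theorem IsRes.unique {r r' : Coh k S →ₐ[k] B} (hr : 𝒯.IsRes φ r) (hr' : 𝒯.IsRes φ r') : r = r' := by
  refine coh_algHom_ext fun A => ?_
  by_cases hA : 𝒯.IsEdge A
  · rw [hr.edge hA, hr'.edge hA]
    simp only [edgeSum, hr.ext, hr'.ext]
  by_cases hc : ∃ A', 𝒯.IsEdge A' ∧ Crosses A.1 A'.1
  · obtain ⟨A', h1, h2⟩ := hc
    rw [hr.crosses A A' h1 h2, hr'.crosses A A' h1 h2]
  · push Not at hc
    obtain ⟨v, α, rfl⟩ := exists_ext hc hA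
    rw [hr.ext, hr'.ext]

variable (φ) in
/-- Homomorphisms at the vertices extend to the cohomology ring of `S`, with the values at the edges
that are dictated by `eq_neg_edgeSum`. -/
theorem exists_isRes : ∃ r : Coh k S →ₐ[k] B, 𝒯.IsRes φ r := by
  let θ : OrdPart S → B := fun A =>
    if h : ∃ z : Σ v, OrdPart (𝒯.X v), 𝒯.ext z.1 z.2 = A then φ _ (cls k h.choose.2) else 0
  have hext : ∀ v α, θ (𝒯.ext v α) = φ v (cls k α) := by
    intro v α
    have hex : ∃ z : Σ v, OrdPart (𝒯.X v), 𝒯.ext z.1 z.2 = 𝒯.ext v α := ⟨⟨v, α⟩, rfl⟩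
    have h : hex.choose = ⟨v, α⟩ := ext_injective hex.choose_spec
    change dite _ _ _ = _
    rw [dif_pos hex, h]
  let Θ : OrdPart S → B := fun A => if 𝒯.IsEdge A then - 𝒯.edgeSum θ A else θ A
  have hΘext : ∀ v α, Θ (𝒯.ext v α) = φ v (cls k α) := fun v α =>
    (if_neg (not_isEdge_ext v α)).trans (hext v α)
  have h0 : ∀ A A', 𝒯.IsEdge A' → Crosses A.1 A'.1 → Θ A = 0 := by
    intro A A' hA' hc
    have h1 : ¬ 𝒯.IsEdge A := fun hA => not_crosses_edges hA hA' hc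
    have h2 : ¬ ∃ z : Σ v, OrdPart (𝒯.X v), 𝒯.ext z.1 z.2 = A := by
      rintro ⟨z, rfl⟩
      exact not_crosses_ext_edge z.2 hA' hc
    exact (if_neg h1).trans (dif_neg h2)
  have hE : ∀ A, 𝒯.IsEdge A → Θ A = - 𝒯.edgeSum Θ A := by
    intro A hA
    refine (if_pos hA).trans ?_
    simp only [edgeSum, hext, hΘext]
  have hv : ∀ v, Balanced fun α => Θ (𝒯.ext v α) := by
    intro v
    simp only [hΘext]
    exact balanced_cls.map (φ v)
  have hsymm : ∀ A, Θ A.compl = Θ A := by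
    intro A
    by_cases hA : 𝒯.IsEdge A
    · rw [hE A hA, hE _ (isEdge_compl hA), edgeSum_compl]
    by_cases hc : ∃ A', 𝒯.IsEdge A' ∧ Crosses A.1 A'.1
    · obtain ⟨A', h1, h2⟩ := hc
      rw [h0 A A' h1 h2, h0 A.compl A' h1 (crosses_compl_left.2 h2)]
    · push Not at hc
      obtain ⟨v, α, rfl⟩ := exists_ext hc hA
      exact (hv v).symm α
  have hprod : ∀ A A' : OrdPart S, Crosses A.1 A'.1 → Θ A * Θ A' = 0 := by
    intro A A' hc
    by_cases h1 : ∃ D, 𝒯.IsEdge D ∧ Crosses A.1 D.1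
    · obtain ⟨D, h1, h2⟩ := h1
      rw [h0 A D h1 h2, zero_mul]
    by_cases h2 : ∃ D, 𝒯.IsEdge D ∧ Crosses A'.1 D.1
    · obtain ⟨D, h1, h2⟩ := h2
      rw [h0 A' D h1 h2, mul_zero]
    push Not at h1 h2
    obtain ⟨v, α, rfl⟩ := exists_ext h1 fun hA => h2 A hA hc.symm
    obtain ⟨w, β, rfl⟩ := exists_ext h2 fun hA' => h1 A' hA' hc
    by_cases hvw : v = w
    · subst hvw
      rw [hΘext, hΘext, ← map_mul, cls_mul_cls_of_crosses (crosses_ext_iff.1 hc), map_zero]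
    · exact absurd hc (not_crosses_ext_ext hvw α β)
  obtain ⟨r, hr⟩ := exists_coh_lift (k := k) (balanced h0 hsymm hv hE) hprod
  exact ⟨r, fun v α => (hr _).trans (hΘext v α), fun A A' h1 h2 => (hr A).trans (h0 A A' h1 h2)⟩

variable (k 𝒯) in
/-- The cohomology of a vertex maps to the cohomology ring of `S` modulo the partitions that cross
an edge. -/
theorem exists_vertexHom (v : V) : ∃ ψ : Coh k (𝒯.X v) →ₐ[k] Coh k S ⧸ 𝒯.crossIdeal k,
    ∀ α, ψ (cls k α) = Ideal.Quotient.mkₐ k (𝒯.crossIdeal k) (cls k (𝒯.ext v α)) := by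
  refine exists_coh_lift (k := k) (B := Coh k S ⧸ 𝒯.crossIdeal k) (balanced_ext (𝒯 := 𝒯) (v := v)
    (Θ := fun A => Ideal.Quotient.mkₐ k (𝒯.crossIdeal k) (cls k A)) ?_ ?_) ?_
  · intro A A' hA' h
    exact Ideal.Quotient.eq_zero_iff_mem.2 (cls_mem_crossIdeal hA' h)
  · exact balanced_cls.map _
  · intro α β h
    rw [← map_mul, cls_mul_cls_of_crosses (crosses_ext_iff.2 h), map_zero]

/-- The kernel of the restriction homomorphism, when the target is the coproduct of the cohomology
rings of the vertices. -/
theorem IsRes.mem_crossIdeal {r : Coh k S →ₐ[k] B} (hr : 𝒯.IsRes φ r)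
    (hB : ∀ ψ : ∀ v, Coh k (𝒯.X v) →ₐ[k] Coh k S ⧸ 𝒯.crossIdeal k,
      ∃ Ψ : B →ₐ[k] Coh k S ⧸ 𝒯.crossIdeal k, ∀ v a, Ψ (φ v a) = ψ v a)
    {a : Coh k S} (ha : r a = 0) : a ∈ 𝒯.crossIdeal k := by
  choose ψ hψ using exists_vertexHom k 𝒯
  obtain ⟨Ψ, hΨ⟩ := hB ψ
  have h1 : 𝒯.IsRes (B := Coh k S ⧸ 𝒯.crossIdeal k) ψ (Ψ.comp r) :=
    ⟨fun v α => by rw [AlgHom.comp_apply, hr.ext, hΨ], fun A A' h h' => by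
      rw [AlgHom.comp_apply, hr.crosses A A' h h', map_zero]⟩
  have h2 : 𝒯.IsRes (B := Coh k S ⧸ 𝒯.crossIdeal k) ψ (Ideal.Quotient.mkₐ k (𝒯.crossIdeal k)) :=
    ⟨fun v α => (hψ v α).symm, fun A A' h h' =>
      Ideal.Quotient.eq_zero_iff_mem.2 (cls_mem_crossIdeal h h')⟩
  have h3 := DFunLike.congr_fun (h1.unique h2) a
  rw [AlgHom.comp_apply, ha, map_zero] at h3
  exact Ideal.Quotient.eq_zero_iff_mem.1 h3.symm

end Restriction

end Splitting

/-! ### The splitting given by a tree -/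

namespace Graph

variable {G : Graph.{u}}

theorem not_reach_back (hG : G.IsTree) {x : G.F} (hx : G.inv x ≠ x) :
    ¬ G.Reach {x} (G.bd (G.inv x)) (G.bd x) := fun h => hG.bridge x hx h.symm

theorem exists_toward (hG : G.IsTree) (v w : G.V) :
    w = v ∨ ∃ x, G.bd x = v ∧ G.inv x ≠ x ∧ G.Reach {x} (G.bd (G.inv x)) w := by
  induction hG.connected v w with
  | refl => exact Or.inl rfl
  | @tail y z _ hs ih =>
    obtain ⟨g, -, -, rfl, rfl⟩ := hs
    rcases ih with ih | ⟨x, hx, hxe, hr⟩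
    · by_cases hg : G.inv g = g
      · left; rw [hg, ih]
      · exact Or.inr ⟨g, ih, hg, .refl⟩
    · by_cases h1 : g = x
      · subst h1; exact Or.inr ⟨g, hx, hxe, .refl⟩
      by_cases h2 : G.inv g = x
      · left; rw [h2, hx]
      · exact Or.inr ⟨x, hx, hxe, hr.tail ⟨g, h1, h2, rfl, rfl⟩⟩

theorem toward_unique (hG : G.IsTree) {x y : G.F} (hx : G.inv x ≠ x) (hy : G.inv y ≠ y)
    (hxy : G.bd x = G.bd y) {w : G.V} (h : G.Reach {x} (G.bd (G.inv x)) w)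
    (h' : G.Reach {y} (G.bd (G.inv y)) w) : x = y := by
  by_contra hne
  exact hG.bridge x hx ((reach_mono hG hx hy (Ne.symm hne) hxy.symm h').trans h.symm)

theorem exists_third (hG : G.IsStable) (x y : G.F) (v : G.V) : ∃ z, G.bd z = v ∧ z ≠ x ∧ z ≠ y := by
  classical
  by_contra hcon
  push Not at hcon
  have h1 : {f | G.bd f = v} ⊆ {x, y} := fun z hz => by
    by_cases h : z = x
    · exact Or.inl h
    · exact Or.inr (hcon z hz h)
  have h2 := Set.ncard_le_ncard h1 (Set.toFinite _)
  have h3 : ({x, y} : Set G.F).ncard ≤ 2 := (Set.ncard_insert_le x {y}).trans (by simp)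
  have h4 := hG.three_le v
  omega

end Graph

namespace STree

variable {S : PaintedSet.{u}} (T : STree S)

/-- The labels of the tails that lie behind the flag `x`, seen from its vertex. -/
def behind (x : T.graph.F) : Set S :=
  {s | T.mark s = x ∨
    (T.graph.inv x ≠ x ∧ T.graph.Reach {x} (T.graph.bd (T.graph.inv x)) (T.graph.bd (T.mark s)))}

variable {T}

theorem inv_mark (s : S) : T.graph.inv (T.mark s) = T.mark s := (T.mark_tail _).2 ⟨s, rfl⟩

theorem behind_mark (s : S) : T.behind (T.mark s) = {s} := by
  ext t
  constructor
  · rintro (h | h)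
    · exact T.mark_inj h
    · exact absurd (T.inv_mark s) h.1
  · rintro rfl
    exact Or.inl rfl

theorem behind_edge (f : T.EdgeFlag) : T.behind f.1 = (T.part f.flip).1 := by
  ext s
  change _ ↔ T.graph.Reach {T.graph.inv f.1} (T.graph.bd (T.graph.inv f.1)) (T.graph.bd (T.mark s))
  rw [Graph.reach_inv_iff]
  constructor
  · rintro (h | h)
    · exact absurd (h ▸ T.inv_mark s) f.2
    · exact h.2
  · exact fun h => Or.inr ⟨f.2, h⟩

theorem behind_inv {x : T.graph.F} (hx : T.graph.inv x ≠ x) :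
    T.behind (T.graph.inv x) = (T.behind x)ᶜ := by
  have h1 := T.behind_edge ⟨x, hx⟩
  have h2 := T.behind_edge (EdgeFlag.flip ⟨x, hx⟩)
  have h3 := T.part_flip (EdgeFlag.flip ⟨x, hx⟩)
  rw [h1]
  exact h2.trans (congrArg Subtype.val h3)

theorem exists_behind (v : T.graph.V) (s : S) : ∃ x, T.graph.bd x = v ∧ s ∈ T.behind x := by
  rcases Graph.exists_toward T.stable.toIsTree v (T.graph.bd (T.mark s)) with h | ⟨x, h1, h2, h3⟩
  · exact ⟨_, h, Or.inl rfl⟩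
  · exact ⟨x, h1, Or.inr ⟨h2, h3⟩⟩

theorem behind_unique {x y : T.graph.F} (hxy : T.graph.bd x = T.graph.bd y) {s : S}
    (hx : s ∈ T.behind x) (hy : s ∈ T.behind y) : x = y := by
  have key : ∀ {y : T.graph.F}, T.graph.bd (T.mark s) = T.graph.bd y → ¬ (T.graph.inv y ≠ y ∧
      T.graph.Reach {y} (T.graph.bd (T.graph.inv y)) (T.graph.bd (T.mark s))) := fun h h' =>
    Graph.not_reach_back T.stable.toIsTree h'.1 (h ▸ h'.2)
  rcases hx with rfl | hx <;> rcases hy with rfl | hy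
  · rfl
  · exact absurd hy (key hxy)
  · exact absurd hx (key hxy.symm)
  · exact Graph.toward_unique T.stable.toIsTree hx.1 hy.1 hxy hx.2 hy.2

theorem tail_or_edge (x : T.graph.F) : (∃ s, T.mark s = x) ∨ T.graph.inv x ≠ x := by
  by_cases h : T.graph.inv x = x
  · exact Or.inl ((T.mark_tail x).1 h)
  · exact Or.inr h

theorem behind_nonempty (x : T.graph.F) : (T.behind x).Nonempty := by
  rcases tail_or_edge x with ⟨s, rfl⟩ | hx
  · exact ⟨s, Or.inl rfl⟩
  · rw [T.behind_edge ⟨x, hx⟩]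
    obtain ⟨s, hs, -⟩ := (T.part (EdgeFlag.flip ⟨x, hx⟩)).2.white
    exact ⟨s, hs⟩

/-- The tails at the two ends of a path: everything lies behind one of its two end flags. -/
theorem exists_behind_or {v w : T.graph.V} (hvw : v ≠ w) : ∃ x y, T.graph.bd x = v ∧
    T.graph.bd y = w ∧ T.graph.inv x ≠ x ∧ ∀ s, s ∈ T.behind x ∨ s ∈ T.behind y := by
  have hG := T.stable.toIsTree
  obtain ⟨x, hx, hxe, hxr⟩ := (Graph.exists_toward hG v w).resolve_left hvw.symm
  obtain ⟨y, hy, hye, hyr⟩ := (Graph.exists_toward hG w v).resolve_left hvw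
  refine ⟨x, y, hx, hy, hxe, fun s => ?_⟩
  by_cases hs : s ∈ T.behind y
  · exact Or.inr hs
  left
  have h1 : T.graph.Reach {y} (T.graph.bd y) (T.graph.bd (T.mark s)) := by
    refine (Graph.reach_or hG y _).resolve_right fun h => hs (Or.inr ⟨hye, h⟩)
  rw [hy] at h1
  refine Or.inr ⟨hxe, hxr.trans ?_⟩
  -- The path does not leave the side of `w`, so that it does not pass through `v`.
  generalize T.graph.bd (T.mark s) = z at h1
  have hne : ∀ z, T.graph.Reach {y} w z → z ≠ v := by
    rintro z hz rfl
    exact hG.bridge y hye (by rw [hy]; exact hz.trans hyr.symm)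
  induction h1 with
  | refl => exact .refl
  | @tail a b ha hs ih =>
    have hb := hne b (ha.tail hs)
    obtain ⟨g, -, -, rfl, rfl⟩ := hs
    refine ih.tail ⟨g, ?_, ?_, rfl, rfl⟩
    · rintro rfl; exact hne _ ha hx
    · intro hg; rw [Set.mem_singleton_iff.1 hg] at hb; exact hb hx

/-- A partition that crosses no edge does not cut the sets of tails behind the flags of some
vertex. -/
theorem exists_vertex_of_not_crosses (A : Set S)
    (hA : ∀ f : T.EdgeFlag, ¬ Crosses A (T.part f).1) :
    ∃ v, ∀ x, T.graph.bd x = v → T.behind x ⊆ A ∨ T.behind x ⊆ Aᶜ := by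
  have hinv : ∀ x, T.graph.inv x ≠ x → ¬ (T.behind x ⊆ A ∨ T.behind x ⊆ Aᶜ) →
      T.behind (T.graph.inv x) ⊆ A ∨ T.behind (T.graph.inv x) ⊆ Aᶜ := by
    intro x hx hn
    have h := hA (EdgeFlag.flip ⟨x, hx⟩)
    rw [← T.behind_edge ⟨x, hx⟩] at h
    rw [T.behind_inv hx]
    rw [not_or, Set.not_subset, Set.not_subset] at hn
    obtain ⟨⟨a, ha, ha'⟩, ⟨b, hb, hb'⟩⟩ := hn
    by_contra hc
    rw [not_or, Set.not_subset, Set.not_subset] at hc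
    obtain ⟨⟨c, hc, hc'⟩, ⟨d, hd, hd'⟩⟩ := hc
    rw [Set.mem_compl_iff, not_not] at hb' hd'
    exact h ⟨⟨b, hb', hb⟩, ⟨d, hd', hd⟩, ⟨a, ha', ha⟩, ⟨c, hc', hc⟩⟩
  by_cases hex : ∃ x, ¬ (T.behind x ⊆ A ∨ T.behind x ⊆ Aᶜ)
  · -- Take the vertex on the far side of a cut flag with the smallest number of tails behind it.
    obtain ⟨x, hx, hmin⟩ := Set.exists_min_image {x | ¬ (T.behind x ⊆ A ∨ T.behind x ⊆ Aᶜ)}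
      (fun x => (T.behind x).ncard) (Set.toFinite _) hex
    have hxe : T.graph.inv x ≠ x := by
      rcases tail_or_edge x with ⟨s, rfl⟩ | hxe
      · refine absurd ?_ hx
        rw [behind_mark]
        by_cases hs : s ∈ A
        · exact Or.inl (by simpa using hs)
        · exact Or.inr (by simpa using hs)
      · exact hxe
    refine ⟨T.graph.bd (T.graph.inv x), fun y hy => ?_⟩
    by_cases hyx : y = T.graph.inv x
    · subst hyx; exact hinv x hxe hx
    by_contra hn
    have hsub : T.behind y ⊆ T.behind x := by
      intro s hs
      by_contra hs'
      exact hyx (behind_unique hy hs (by rw [T.behind_inv hxe]; exact hs'))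
    have heq := Set.eq_of_subset_of_ncard_le hsub (hmin y hn) (Set.toFinite _)
    obtain ⟨z, hz, hz1, hz2⟩ := Graph.exists_third T.stable y (T.graph.inv x)
      (T.graph.bd (T.graph.inv x))
    obtain ⟨s, hs⟩ := T.behind_nonempty z
    by_cases hsx : s ∈ T.behind x
    · rw [← heq] at hsx
      exact hz1 (behind_unique (hz.trans hy.symm) hs hsx)
    · exact hz2 (behind_unique hz hs (by rw [T.behind_inv hxe]; exact hsx))
  · push Not at hex
    obtain ⟨v⟩ := T.stable.nonempty
    exact ⟨v, fun x _ => hex x⟩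

variable (T)

/-- The flag at `v` behind which the tail with label `s` lies. -/
def branch (v : T.graph.V) (s : S) : T.graph.flagsAt v :=
  ⟨(T.exists_behind v s).choose, (T.exists_behind v s).choose_spec.1⟩

variable {T}

theorem branch_eq_iff {v : T.graph.V} {s : S} {x : T.graph.flagsAt v} :
    T.branch v s = x ↔ s ∈ T.behind x.1 := by
  have h := (T.exists_behind v s).choose_spec
  constructor
  · rintro rfl
    exact h.2
  · intro hs
    exact Subtype.ext (behind_unique (h.1.trans (Eq.symm x.2)) h.2 hs)

theorem branch_preimage (v : T.graph.V) (x : T.graph.flagsAt v) :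
    T.branch v ⁻¹' {x} = T.behind x.1 := Set.ext fun _ => branch_eq_iff

theorem branch_preimage_self (x : T.graph.F) :
    T.branch (T.graph.bd x) ⁻¹' {(⟨x, rfl⟩ : T.graph.flagsAt _)} = T.behind x :=
  branch_preimage _ _

variable (T)

/-- The splitting of `S` given by an `S`-tree. -/
def splitting : Splitting S T.graph.V where
  X := T.graph.flagsAt
  br := T.branch
  surj v x := by
    obtain ⟨s, hs⟩ := T.behind_nonempty x.1
    exact ⟨s, branch_eq_iff.2 hs⟩
  white_iff v x := by
    simp only [branch_eq_iff]
    change x.1 ∈ T.graph.white ↔ _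
    rcases tail_or_edge x.1 with ⟨s, hs⟩ | hx
    · simp [← hs, behind_mark, T.mark_white]
    · rw [T.behind_edge ⟨x.1, hx⟩]
      obtain ⟨s, hs, hw⟩ := (T.part (EdgeFlag.flip ⟨x.1, hx⟩)).2.white
      exact ⟨fun _ => ⟨s, hw, hs⟩, fun _ => T.graph.edge_white _ hx⟩
  stable v s s' hne h := by
    rw [branch_preimage]
    rcases tail_or_edge (T.branch v s).1 with ⟨t, ht⟩ | hx
    · have h1 := branch_eq_iff.1 (rfl : T.branch v s = _)
      have h2 := branch_eq_iff.1 h.symm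
      rw [← ht, behind_mark] at h1 h2
      exact absurd (Eq.trans h1 (Eq.symm h2)) hne
    · rw [T.behind_edge ⟨_, hx⟩]
      exact (T.part _).2
  three_le v := by
    have := T.stable.three_le v
    rwa [← Nat.card_coe_set_eq] at this
  sep v w hvw := by
    obtain ⟨x, y, hx, hy, -, h⟩ := T.exists_behind_or hvw
    exact ⟨⟨x, hx⟩, ⟨y, hy⟩, fun s => (h s).imp (branch_eq_iff (x := ⟨x, hx⟩)).2
      (branch_eq_iff (x := ⟨y, hy⟩)).2⟩
  flip v x hx := by
    rw [branch_preimage] at hx ⊢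
    rcases tail_or_edge x.1 with ⟨s, hs⟩ | hxe
    · rw [← hs, behind_mark] at hx
      have := hx.two_le
      rw [Set.ncard_singleton] at this
      omega
    · exact ⟨_, ⟨T.graph.inv x.1, rfl⟩, (branch_preimage_self _).trans (T.behind_inv hxe)⟩
  cover A _ h := by
    obtain ⟨v, hv⟩ := T.exists_vertex_of_not_crosses A fun f => by
      have h1 : T.behind f.flip.1 = (T.part f).1 := by
        rw [T.behind_edge f.flip]
        exact congrArg (fun f => (T.part f).1) (Subtype.ext (T.graph.inv_inv _))
      have h2 := (branch_preimage_self f.flip.1).trans h1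
      have h3 : ∀ B, T.branch _ ⁻¹' {(⟨f.flip.1, rfl⟩ : T.graph.flagsAt _)} = B →
          IsStablePart B → ¬ Crosses A B := by
        rintro B rfl
        exact h _ _
      exact h3 _ h2 (T.part f).2
    refine ⟨v, fun s s' hss hs => ?_⟩
    have h1 := branch_eq_iff.1 hss
    have h2 := branch_eq_iff.1 (rfl : T.branch v s' = _)
    rcases hv _ (T.branch v s').2 with h3 | h3
    · exact h3 h2
    · exact absurd hs (h3 h1)

variable {T}

theorem EdgeFlag.flip_flip (f : T.EdgeFlag) : f.flip.flip = f := Subtype.ext (T.graph.inv_inv _)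

theorem splitting_isEdge_iff {A : OrdPart S} : T.splitting.IsEdge A ↔ ∃ f, T.part f = A := by
  constructor
  · rintro ⟨v, x, h⟩
    have h' : T.behind x.1 = A.1 := (branch_preimage v x).symm.trans h
    rcases tail_or_edge x.1 with ⟨s, hs⟩ | hxe
    · rw [← hs, behind_mark] at h'
      have := A.2.two_le
      rw [← h', Set.ncard_singleton] at this
      omega
    · exact ⟨EdgeFlag.flip ⟨x.1, hxe⟩, Subtype.ext ((T.behind_edge ⟨x.1, hxe⟩).symm.trans h')⟩
  · rintro ⟨f, rfl⟩
    refine ⟨_, (⟨f.flip.1, rfl⟩ : T.graph.flagsAt _), (branch_preimage _ _).trans ?_⟩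
    rw [T.behind_edge f.flip, f.flip_flip]

theorem part_injective : Function.Injective T.part := by
  intro f g h
  have hf := (branch_preimage _ (⟨f.flip.1, rfl⟩ : T.graph.flagsAt _)).trans (T.behind_edge f.flip)
  have hg := (branch_preimage _ (⟨g.flip.1, rfl⟩ : T.graph.flagsAt _)).trans (T.behind_edge g.flip)
  rw [EdgeFlag.flip_flip] at hf hg
  have := Splitting.fiber_injective (𝒯 := T.splitting) (hf.trans ((congrArg Subtype.val h).trans
    hg.symm))
  have h2 : f.flip.1 = g.flip.1 :=
    congrArg (fun z : Σ v, T.graph.flagsAt v => z.2.1) this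
  have h3 : f.flip = g.flip := Subtype.ext h2
  rw [← f.flip_flip, h3, g.flip_flip]

open Classical in
variable (T) in
/-- The set of unordered partitions given by the edges of the tree. -/
def edgeParts : Finset (Part S) := Finset.univ.filter fun ρ => ∃ f, (T.part f).toPart = ρ

theorem mem_edgeParts {ρ : Part S} : ρ ∈ T.edgeParts ↔ ∃ f, (T.part f).toPart = ρ := by
  simp [edgeParts]

theorem toPart_mem_edgeParts {A : OrdPart S} : A.toPart ∈ T.edgeParts ↔ ∃ f, T.part f = A := by
  rw [mem_edgeParts]
  constructor
  · rintro ⟨f, hf⟩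
    rcases OrdPart.toPart_eq_iff.1 hf with h | h
    · exact ⟨f, h⟩
    · exact ⟨f.flip, by rw [part_flip, h, OrdPart.compl_compl]⟩
  · rintro ⟨f, rfl⟩
    exact ⟨f, rfl⟩

/-- The generator of the cohomology ring indexed by an unordered partition. -/
def _root_.PaintedTrees.partCls (k : Type w) [CommRing k] (ρ : Part S) : Coh k S :=
  Ideal.Quotient.mk (relIdeal k S) (MvPolynomial.X ρ)

theorem _root_.PaintedTrees.partCls_toPart (k : Type w) [CommRing k] (A : OrdPart S) :
    partCls k A.toPart = cls k A := rfl

variable (T) in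
/-- The unordered partition given by an edge. -/
def edgePart (e : T.Edge) : Part S :=
  Quotient.lift (fun f : T.EdgeFlag => (T.part f).toPart) (by
    rintro f g (rfl | rfl)
    · rfl
    · rw [part_flip, OrdPart.toPart_compl]) e

theorem edgePart_edge (f : T.EdgeFlag) : T.edgePart f.edge = (T.part f).toPart := rfl

theorem edgePart_injective : Function.Injective T.edgePart := by
  intro e e' h
  induction e using Quotient.ind with | _ f
  induction e' using Quotient.ind with | _ g
  rcases OrdPart.toPart_eq_iff.1 h with h | h
  · exact congrArg _ (part_injective h)
  · exact Quotient.sound (Or.inr (part_injective (h.trans (T.part_flip g).symm)))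

theorem edgeCls_eq (k : Type w) [CommRing k] (e : T.Edge) : T.edgeCls k e = partCls k (T.edgePart e) := by
  induction e using Quotient.ind with | _ f
  rfl

theorem image_edgePart [DecidableEq (Part S)] : Finset.univ.image T.edgePart = T.edgeParts := by
  ext ρ
  rw [mem_edgeParts, Finset.mem_image]
  constructor
  · rintro ⟨e, -, rfl⟩
    obtain ⟨f, rfl⟩ := Quotient.exists_rep e
    exact ⟨f, rfl⟩
  · rintro ⟨f, rfl⟩
    exact ⟨f.edge, Finset.mem_univ _, rfl⟩

theorem monomialCls_eq (k : Type w) [CommRing k] :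
    T.monomialCls k = ∏ ρ ∈ T.edgeParts, partCls k ρ := by
  classical
  rw [monomialCls, ← image_edgePart, Finset.prod_image fun _ _ _ _ h => edgePart_injective h]
  exact Finset.prod_congr rfl fun e _ => edgeCls_eq k e

open Classical in
theorem monomialClsErase_eq (k : Type w) [CommRing k] (f : T.EdgeFlag) :
    T.monomialClsErase k f.edge = ∏ ρ ∈ T.edgeParts.erase (T.part f).toPart, partCls k ρ := by
  rw [monomialClsErase, ← image_edgePart, ← edgePart_edge,
    ← Finset.image_erase edgePart_injective,
    Finset.prod_image fun _ _ _ _ h => edgePart_injective h]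
  exact Finset.prod_congr rfl fun e _ => edgeCls_eq k e

/-- To compare the partitions of edges in two trees it is enough to compare them in one direction,
for both halves of the edges. -/
theorem mem_part_iff_of_imp {S' : PaintedSet.{u}} {T' : STree S'} {f : T.EdgeFlag} {g : T'.EdgeFlag}
    {π : S → S'} (h1 : ∀ s, s ∈ (T.part f).1 → π s ∈ (T'.part g).1)
    (h2 : ∀ s, s ∈ (T.part f.flip).1 → π s ∈ (T'.part g.flip).1) (s : S) :
    s ∈ (T.part f).1 ↔ π s ∈ (T'.part g).1 := by
  refine ⟨h1 s, fun h => ?_⟩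
  by_contra hs
  have h3 : s ∈ (T.part f.flip).1 := by rw [part_flip]; exact hs
  have h4 := h2 s h3
  rw [part_flip] at h4
  exact h4 h

end STree

/-! ### Trees are determined by the partitions of their edges -/

namespace STree

variable {S : PaintedSet.{u}} {T T' : STree S}

theorem behind_injective : Function.Injective T.behind := by
  intro x y h
  have := Splitting.fiber_injective (𝒯 := T.splitting)
    ((branch_preimage_self x).trans (h.trans (branch_preimage_self y).symm))
  exact congrArg (fun z : Σ v, T.graph.flagsAt v => z.2.1) this

theorem inv_ne_iff {x : T.graph.F} : T.graph.inv x ≠ x ↔ 2 ≤ (T.behind x).ncard := by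
  constructor
  · intro hx
    rw [T.behind_edge ⟨x, hx⟩]
    exact (T.part _).2.two_le
  · intro h hx
    obtain ⟨s, rfl⟩ := (T.mark_tail x).1 hx
    rw [behind_mark, Set.ncard_singleton] at h
    omega

/-- A criterion for two flags of a tree to belong to the same vertex. It is formulated in terms of the
sets `B` and `C` of tails behind the flags and of the family `E` of the sets of tails behind the
halves of edges: there is no edge between the two flags. -/
def SameVertex (E : Set (Set S)) (B C : Set S) : Prop :=
  B = C ∨ (Disjoint B C ∧ B ∪ C ≠ Set.univ ∧
    ∀ D ∈ E, B ⊂ D → Disjoint D C → D ∪ C = Set.univ)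

variable (T) in
/-- The sets of tails behind the halves of edges. -/
def sides : Set (Set S) := {D | ∃ x, T.graph.inv x ≠ x ∧ T.behind x = D}

theorem disjoint_behind {x y : T.graph.F} (h : T.graph.bd x = T.graph.bd y) (hxy : x ≠ y) :
    Disjoint (T.behind x) (T.behind y) :=
  Set.disjoint_left.2 fun _ hx hy => hxy (behind_unique h hx hy)

theorem bd_eq_iff (f g : T.graph.F) :
    T.graph.bd f = T.graph.bd g ↔ SameVertex T.sides (T.behind f) (T.behind g) := by
  constructor
  · intro h
    by_cases hfg : f = g
    · exact Or.inl (congrArg _ hfg)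
    refine Or.inr ⟨disjoint_behind h hfg, fun hu => ?_, ?_⟩
    · obtain ⟨z, hz, h1, h2⟩ := Graph.exists_third T.stable f g (T.graph.bd f)
      obtain ⟨s, hs⟩ := T.behind_nonempty z
      rcases (hu ▸ Set.mem_univ s : s ∈ T.behind f ∪ T.behind g) with h' | h'
      · exact h1 (behind_unique hz hs h')
      · exact h2 (behind_unique (hz.trans h) hs h')
    · rintro _ ⟨d, hd, rfl⟩ hss hdis
      obtain ⟨x, hx⟩ := Splitting.fiber_subset (𝒯 := T.splitting) (T.graph.bd f) (T.graph.bd d)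
        ⟨d, rfl⟩
      have e1 : T.splitting.br (T.graph.bd d) ⁻¹' {⟨d, rfl⟩} = T.behind d := branch_preimage_self d
      have e2 : T.splitting.br (T.graph.bd f) ⁻¹' {x} = T.behind x.1 := branch_preimage _ x
      rw [e1, e2] at hx
      change T.behind d ⊆ T.behind x.1 ∨ (T.behind d)ᶜ ⊆ T.behind x.1 at hx
      have hxb : T.graph.bd x.1 = T.graph.bd f := x.2
      rcases hx with hx | hx
      · obtain ⟨s, hs⟩ := T.behind_nonempty f
        have : x.1 = f := behind_unique hxb (hx (hss.1 hs)) hs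
        rw [this] at hx
        exact absurd hx hss.2
      · obtain ⟨s, hs⟩ := T.behind_nonempty g
        have : x.1 = g := behind_unique (hxb.trans h) (hx fun h' =>
          Set.disjoint_left.1 hdis h' hs) hs
        rw [this] at hx
        ext t
        by_cases ht : t ∈ T.behind d
        · simp [ht]
        · simp [hx ht]
  · rintro (h | ⟨h1, h2, h3⟩)
    · rw [behind_injective h]
    by_contra hne
    obtain ⟨x, y, hx, hy, hxe, hxy⟩ := T.exists_behind_or hne
    by_cases hfx : f = x
    · subst hfx
      by_cases hgy : g = y
      · subst hgy
        exact h2 (Set.eq_univ_of_forall hxy)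
      · obtain ⟨s, hs⟩ := T.behind_nonempty g
        exact Set.disjoint_left.1 h1 ((hxy s).resolve_right fun h' =>
          hgy (behind_unique hy.symm hs h')) hs
    by_cases hgy : g = y
    · subst hgy
      obtain ⟨s, hs⟩ := T.behind_nonempty f
      exact Set.disjoint_left.1 h1 hs ((hxy s).resolve_left fun h' =>
        hfx (behind_unique hx.symm hs h'))
    have hgx : ∀ s, s ∉ T.behind y → s ∈ T.behind x := fun s hs => (hxy s).resolve_right hs
    have h4 := h3 (T.behind x)ᶜ
      ⟨T.graph.inv x, Graph.inv_ne hxe, T.behind_inv hxe⟩ ⟨fun s hs hs' =>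
        hfx (behind_unique hx.symm hs hs'), fun hsub => ?_⟩ ?_
    · obtain ⟨z, hz, hz1, hz2⟩ := Graph.exists_third T.stable g y (T.graph.bd g)
      obtain ⟨s, hs⟩ := T.behind_nonempty z
      have hsx := hgx s fun h' => hz2 (behind_unique (hz.trans hy.symm) hs h')
      rcases (h4 ▸ Set.mem_univ s : s ∈ (T.behind x)ᶜ ∪ T.behind g) with h' | h'
      · exact h' hsx
      · exact hz1 (behind_unique hz hs h')
    · obtain ⟨z, hz, hz1, hz2⟩ := Graph.exists_third T.stable f x (T.graph.bd f)
      obtain ⟨s, hs⟩ := T.behind_nonempty z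
      exact hz1 (behind_unique hz hs (hsub fun h' => hz2 (behind_unique (hz.trans hx.symm) hs h')))
    · refine Set.disjoint_left.2 fun s hs hs' => hs (hgx s fun h' => ?_)
      exact hgy (behind_unique hy.symm hs' h')

theorem exists_behind_eq (h : T.edgeParts = T'.edgeParts) (x : T'.graph.F) :
    ∃ y, T.behind y = T'.behind x := by
  rcases tail_or_edge x with ⟨s, rfl⟩ | hx
  · exact ⟨T.mark s, by rw [behind_mark, behind_mark]⟩
  · have h1 : (T'.part (EdgeFlag.flip ⟨x, hx⟩)).toPart ∈ T.edgeParts := by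
      rw [h]
      exact mem_edgeParts.2 ⟨_, rfl⟩
    obtain ⟨f, hf⟩ := toPart_mem_edgeParts.1 h1
    refine ⟨f.flip.1, ?_⟩
    rw [behind_edge f.flip, EdgeFlag.flip_flip, T'.behind_edge ⟨x, hx⟩, hf]

theorem sides_eq (h : T.edgeParts = T'.edgeParts) : T.sides = T'.sides := by
  have key : ∀ {T T' : STree S}, T.edgeParts = T'.edgeParts → T.sides ⊆ T'.sides := by
    rintro T T' h _ ⟨x, hx, rfl⟩
    obtain ⟨y, hy⟩ := exists_behind_eq h.symm x
    exact ⟨y, inv_ne_iff.2 (by rw [hy]; exact inv_ne_iff.1 hx), hy⟩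
  exact Set.Subset.antisymm (key h) (key h.symm)

/-- Two trees whose edges give the same partitions are isomorphic. -/
theorem equiv_of_edgeParts_eq (h : T.edgeParts = T'.edgeParts) : T ≈ T' := by
  choose φ hφ using exists_behind_eq h
  choose ψ hψ using exists_behind_eq h.symm
  have hφψ : ∀ x, φ (ψ x) = x := fun x => behind_injective ((hφ _).trans (hψ x))
  have hbd : ∀ x y, T'.graph.bd x = T'.graph.bd y ↔ T.graph.bd (φ x) = T.graph.bd (φ y) := by
    intro x y
    rw [bd_eq_iff, bd_eq_iff, hφ, hφ, sides_eq h]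
  have hflag : ∀ v : T.graph.V, ∃ x, T.graph.bd x = v := fun v => by
    obtain ⟨s⟩ : Nonempty S := by
      obtain ⟨x⟩ : Nonempty T.graph.F := by
        by_contra hc
        have := T.stable.three_le v
        rw [not_nonempty_iff] at hc
        rw [Set.eq_empty_of_isEmpty {f | T.graph.bd f = v}, Set.ncard_empty] at this
        omega
      exact ⟨(T.behind_nonempty x).choose⟩
    exact ⟨_, (T.exists_behind v s).choose_spec.1⟩
  choose a ha using hflag
  have hedge : ∀ x, T.graph.inv (φ x) ≠ φ x ↔ T'.graph.inv x ≠ x := fun x => by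
    rw [inv_ne_iff, inv_ne_iff, hφ]
  have hmark : ∀ s, φ (T'.mark s) = T.mark s := fun s => behind_injective (by
    rw [hφ, behind_mark, behind_mark])
  have hvert : ∀ x, T'.graph.bd (ψ (a (T.graph.bd (φ x)))) = T'.graph.bd x := fun x => by
    rw [hbd, hφψ, ha]
  refine ⟨⟨φ, fun v => T'.graph.bd (ψ (a v))⟩,
    { flag_inj := fun x y hxy => behind_injective (by
        have h' : φ x = φ y := hxy
        rw [← hφ, h', hφ])
      flag_inv := fun x => behind_injective ?_
      vert_bd := hvert
      white_iff := fun x => ?_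
      flag_surj := fun x => ⟨ψ x, hφψ x⟩
      vert_bij := ⟨fun v w hvw => ?_, fun v => ?_⟩ }, hmark⟩
  · change T.behind (φ _) = T.behind (T.graph.inv (φ x))
    rw [hφ]
    by_cases hx : T'.graph.inv x = x
    · have := (not_congr (hedge x)).2 (not_not.2 hx)
      rw [not_not.1 this, hx, hφ]
    · rw [T'.behind_inv hx, T.behind_inv ((hedge x).2 hx), hφ]
  · change φ x ∈ _ ↔ _
    rcases tail_or_edge x with ⟨s, rfl⟩ | hx
    · rw [hmark, T.mark_white, T'.mark_white]
    · exact ⟨fun _ => T'.graph.edge_white x hx, fun _ => T.graph.edge_white _ ((hedge x).2 hx)⟩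
  · have h1 := (hbd _ _).1 hvw
    rwa [hφψ, hφψ, ha, ha] at h1
  · obtain ⟨x, hx⟩ : ∃ x, T'.graph.bd x = v := by
      obtain ⟨z, hz, -⟩ := Graph.exists_third T'.stable (ψ (a (Classical.choice T.stable.nonempty)))
        (ψ (a (Classical.choice T.stable.nonempty))) v
      exact ⟨z, hz⟩
    exact ⟨T.graph.bd (φ x), (hvert x).trans hx⟩

theorem edgeParts_eq_of_equiv (h : T ≈ T') : T.edgeParts = T'.edgeParts := by
  have key : ∀ {T T' : STree S}, T ≈ T' → T'.edgeParts ⊆ T.edgeParts := by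
    rintro T T' ⟨c, hc, hm⟩ ρ hρ
    obtain ⟨f, rfl⟩ := mem_edgeParts.1 hρ
    let g : ∀ f : T'.EdgeFlag, T.EdgeFlag := fun f => ⟨c.flag f.1, fun h => f.2 (hc.flag_inj
      ((hc.flag_inv f.1).trans h))⟩
    have hflip : ∀ f, (g f).flip = g f.flip := fun f => Subtype.ext (hc.flag_inv f.1).symm
    have hreach : ∀ (x : T'.graph.F) {v w : T.graph.V}, T.graph.Reach {c.flag x} v w →
        T'.graph.Reach {x} (c.vert v) (c.vert w) := by
      intro x v w hr
      induction hr with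
      | refl => exact .refl
      | tail _ hs ih =>
        obtain ⟨y, h1, h2, rfl, rfl⟩ := hs
        obtain ⟨y, rfl⟩ := hc.flag_surj y
        rw [← hc.flag_inv] at h2 ⊢
        exact ih.tail ⟨y, fun h => h1 (congrArg c.flag h), fun h => h2 (congrArg c.flag h),
          (hc.vert_bd y).symm, (hc.vert_bd _).symm⟩
    have himp : ∀ f s, s ∈ (T.part (g f)).1 → s ∈ (T'.part f).1 := by
      intro f s hs
      have := hreach f.1 hs
      rwa [← hm s, hc.vert_bd, hc.vert_bd] at this
    refine mem_edgeParts.2 ⟨g f, congrArg _ (Subtype.ext (Set.ext fun s => ?_))⟩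
    exact mem_part_iff_of_imp (π := fun s => s) (himp f)
      (fun s hs => himp f.flip s (by rwa [← hflip])) s
  exact Finset.Subset.antisymm (key (Setoid.symm h)) (key h)

theorem mu_eq_mu (k : Type w) [CommRing k] (h : T.edgeParts = T'.edgeParts) : mu k T = mu k T' := by
  rw [mu, mu, muFree, muFree, Quotient.sound (equiv_of_edgeParts_eq h)]

/-! ### Insertion of edges -/

section Insert

variable (v : T.graph.V) (A : OrdPart (T.graph.flagsAt v))

/-- An edge of the tree as an edge of the tree with an additional edge. -/
def oldEdge (f : T.EdgeFlag) : (T.insert v A).EdgeFlag :=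
  ⟨Sum.inl f.1, fun h => f.2 (Sum.inl.inj h)⟩

theorem part_oldEdge (f : T.EdgeFlag) : (T.insert v A).part (T.oldEdge v A f) = T.part f := by
  have himp : ∀ f s, s ∈ ((T.insert v A).part (T.oldEdge v A f)).1 → s ∈ (T.part f).1 := by
    intro f s hs
    have h := Graph.insert_proj_reach (G := T.graph) (v := v) (A := A.1) hs
    have h1 := Graph.insert_proj (G := T.graph) (v := v) (A := A.1) f.1
    have h2 := Graph.insert_proj (G := T.graph) (v := v) (A := A.1) (T.mark s)
    change T.graph.Reach {f.1} (((T.graph.insert v A.1).bd (Sum.inl f.1)).getD v)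
      (((T.graph.insert v A.1).bd (Sum.inl (T.mark s))).getD v) at h
    rwa [h1, h2] at h
  exact Subtype.ext (Set.ext fun s => mem_part_iff_of_imp (π := fun s => s) (himp f)
    (himp f.flip) s)

theorem insert_reach_behind {x : T.graph.F} (hx : T.graph.bd x = v) {s : S} (hs : s ∈ T.behind x) :
    (T.graph.insert v A.1).Reach {Sum.inr true} ((T.graph.insert v A.1).bd (Sum.inl x))
      ((T.graph.insert v A.1).bd (Sum.inl (T.mark s))) := by
  have hold : ∀ g, T.graph.bd g ≠ v →
      (T.graph.insert v A.1).bd (Sum.inl g) = some (T.graph.bd g) := fun g hg =>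
    Graph.insert_bd_neg fun h => hg (Graph.bd_of_mem h)
  rcases hs with rfl | ⟨hxe, hr⟩
  · exact .refl
  have hne : ∀ z, T.graph.Reach {x} (T.graph.bd (T.graph.inv x)) z → z ≠ v := by
    rintro z hz rfl
    exact Graph.not_reach_back T.stable.toIsTree hxe (by rw [hx]; exact hz)
  have hfirst : (T.graph.insert v A.1).Reach {Sum.inr true} ((T.graph.insert v A.1).bd (Sum.inl x))
      (some (T.graph.bd (T.graph.inv x))) := by
    refine .single ⟨Sum.inl x, fun h => Sum.inl_ne_inr (Set.mem_singleton_iff.1 h), fun h =>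
      Sum.inl_ne_inr (show Sum.inl (T.graph.inv x) = Sum.inr true from h), rfl, ?_⟩
    exact hold _ (hne _ .refl)
  rw [hold _ (hne _ hr)]
  refine hfirst.trans ?_
  clear hfirst
  generalize T.graph.bd (T.mark s) = z at hr ⊢
  induction hr with
  | refl => exact .refl
  | @tail y z hy hs ih =>
    have h1 := hne _ hy
    have h2 := hne _ (hy.tail hs)
    obtain ⟨g, hg1, hg2, rfl, rfl⟩ := hs
    exact ih.tail ⟨Sum.inl g, fun h => Sum.inl_ne_inr (Set.mem_singleton_iff.1 h), fun h =>
      Sum.inl_ne_inr (show Sum.inl (T.graph.inv g) = Sum.inr true from h), hold _ h1, hold _ h2⟩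

theorem part_newEdge : (T.insert v A).part (T.newEdge v A) = T.splitting.ext v A := by
  have hmem : ∀ s, (T.branch v s).1 ∈ Subtype.val '' A.1 ↔ T.branch v s ∈ A.1 := fun s =>
    ⟨fun ⟨y, hy, h⟩ => (Subtype.ext h : y = T.branch v s) ▸ hy, fun h => ⟨_, h, rfl⟩⟩
  apply Subtype.ext
  ext s
  have hr := T.insert_reach_behind v A (T.branch v s).2
    (branch_eq_iff.1 (rfl : T.branch v s = T.branch v s))
  change _ ↔ T.branch v s ∈ A.1
  by_cases hs : T.branch v s ∈ A.1
  · rw [Graph.insert_bd_pos ((hmem s).2 hs)] at hr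
    exact iff_of_true hr hs
  · refine iff_of_false (fun h => ?_) hs
    rw [Graph.insert_bd_neg (fun h' => hs ((hmem s).1 h'))] at hr
    have h' : s ∈ ((T.insert v A).part (T.newEdge v A).flip).1 := by
      change (T.graph.insert v A.1).Reach {(T.graph.insert v A.1).inv (Sum.inr true)} (some v) _
      refine (Graph.reach_inv_iff (G := T.graph.insert v A.1) (Sum.inr true) _ _).2 ?_
      have h2 : T.graph.bd (T.branch v s).1 = v := (T.branch v s).2
      rwa [h2] at hr
    rw [part_flip] at h'
    exact h' h

open Classical in
theorem edgeParts_insert : (T.insert v A).edgeParts =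
    Insert.insert (T.splitting.ext v A).toPart T.edgeParts := by
  ext ρ
  rw [Finset.mem_insert, mem_edgeParts, mem_edgeParts]
  constructor
  · rintro ⟨⟨f | b, hf⟩, rfl⟩
    · right
      have hf' : T.graph.inv f ≠ f := fun h => hf (congrArg Sum.inl h)
      exact ⟨⟨f, hf'⟩, congrArg _ (T.part_oldEdge v A ⟨f, hf'⟩).symm⟩
    · left
      rw [← part_newEdge]
      cases b
      · have : (⟨Sum.inr false, hf⟩ : (T.insert v A).EdgeFlag) = (T.newEdge v A).flip := rfl
        rw [this, part_flip, OrdPart.toPart_compl]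
      · rfl
  · rintro (rfl | ⟨f, rfl⟩)
    · exact ⟨T.newEdge v A, by rw [part_newEdge]⟩
    · exact ⟨T.oldEdge v A f, by rw [part_oldEdge]⟩

end Insert

theorem ext_notMem_edgeParts (v : T.graph.V) (A : OrdPart (T.graph.flagsAt v)) :
    (T.splitting.ext v A).toPart ∉ T.edgeParts := by
  intro h
  obtain ⟨f, hf⟩ := toPart_mem_edgeParts.1 h
  exact Splitting.not_isEdge_ext (𝒯 := T.splitting) v A (splitting_isEdge_iff.2 ⟨f, hf⟩)

/-! ### Existence of trees with given edges -/

/-- The unordered partitions `ρ` and `σ` do not cross. -/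
def _root_.PaintedTrees.Part.Compat (ρ σ : Part S) : Prop :=
  ∀ A B : OrdPart S, A.toPart = ρ → B.toPart = σ → ¬ Crosses A.1 B.1

theorem _root_.PaintedTrees.Part.compat_iff {A B : OrdPart S} :
    A.toPart.Compat B.toPart ↔ ¬ Crosses A.1 B.1 := by
  refine ⟨fun h => h A B rfl rfl, fun h A' B' hA hB => ?_⟩
  rcases OrdPart.toPart_eq_iff.1 hA with rfl | rfl <;>
    rcases OrdPart.toPart_eq_iff.1 hB with rfl | rfl <;> simpa using h

theorem _root_.PaintedTrees.Part.Compat.symm {ρ σ : Part S} (h : ρ.Compat σ) : σ.Compat ρ :=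
  fun A B hA hB hc => h B A hB hA hc.symm

theorem exists_white (T : STree S) : ∃ s, s ∈ S.white := by
  obtain ⟨v⟩ := T.stable.nonempty
  obtain ⟨f, hf⟩ : ∃ f, f ∈ T.graph.white := by
    by_cases hs : {f | T.graph.bd f = v ∧ T.graph.inv f ≠ f}.Subsingleton
    · obtain ⟨f, hf, -⟩ := T.stable.end_white v hs
      exact ⟨f, hf⟩
    · rw [Set.not_subsingleton_iff] at hs
      obtain ⟨f, hf⟩ := hs.nonempty
      exact ⟨f, T.graph.edge_white f hf.2⟩
  obtain ⟨s, hs, -⟩ := (T.splitting.white_iff _ (⟨f, rfl⟩ : T.graph.flagsAt _)).1 hf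
  exact ⟨s, hs⟩

theorem three_le_card (T : STree S) : 3 ≤ Nat.card S := by
  obtain ⟨v⟩ := T.stable.nonempty
  exact (T.splitting.three_le v).trans (Nat.card_le_card_of_surjective _ (T.splitting.surj v))

/-- The tree with one vertex. -/
def corolla (h3 : 3 ≤ Nat.card S) (hw : ∃ s, s ∈ S.white) : STree S where
  graph :=
    { V := PUnit
      F := S
      bd := fun _ => ⟨⟩
      inv := fun s => s
      inv_inv := fun _ => rfl
      white := S.white
      edge_white := fun _ h => absurd rfl h }
  stable :=
    { nonempty := ⟨⟨⟩⟩
      connected := fun _ _ => .refl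
      bridge := fun _ h => absurd rfl h
      three_le := fun v => by
        have : {f : S | (PUnit.unit : PUnit.{u + 1}) = v} = Set.univ := Set.eq_univ_of_forall fun _ => rfl
        change 3 ≤ {f : S | (PUnit.unit : PUnit.{u + 1}) = v}.ncard
        rwa [this, Set.ncard_univ]
      end_white := fun v _ => by
        obtain ⟨s, hs⟩ := hw
        exact ⟨s, hs, rfl, rfl⟩ }
  mark := fun s => s
  mark_inj := Function.injective_id
  mark_tail := fun f => ⟨fun _ => ⟨f, rfl⟩, fun _ => rfl⟩
  mark_white := fun _ => Iff.rfl

theorem edgeParts_corolla (h3 : 3 ≤ Nat.card S) (hw : ∃ s, s ∈ S.white) :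
    (corolla h3 hw).edgeParts = ∅ := by
  refine Finset.eq_empty_of_forall_notMem fun ρ hρ => ?_
  obtain ⟨f, -⟩ := mem_edgeParts.1 hρ
  exact f.2 rfl

theorem face_edgeParts (T : STree S) : FaceModule.Face Part.Compat T.edgeParts := by
  intro ρ hρ σ hσ
  obtain ⟨f, rfl⟩ := mem_edgeParts.1 hρ
  obtain ⟨g, rfl⟩ := mem_edgeParts.1 hσ
  exact Part.compat_iff.2 (Splitting.not_crosses_edges (splitting_isEdge_iff.2 ⟨f, rfl⟩)
    (splitting_isEdge_iff.2 ⟨g, rfl⟩))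

/-- Every set of pairwise non-crossing partitions is the set of partitions of the edges of a tree. -/
theorem exists_edgeParts_eq (T₀ : STree S) (F : Finset (Part S))
    (hF : FaceModule.Face Part.Compat F) : ∃ T : STree S, T.edgeParts = F := by
  classical
  induction F using Finset.induction_on with
  | empty => exact ⟨corolla T₀.three_le_card T₀.exists_white, edgeParts_corolla _ _⟩
  | insert ρ F hρ ih =>
    obtain ⟨T, rfl⟩ := ih (hF.mono (Finset.subset_insert _ _))
    obtain ⟨A, rfl⟩ := OrdPart.toPart_surjective ρ
    obtain ⟨v, α, hα⟩ := Splitting.exists_ext (𝒯 := T.splitting) (A := A) (fun B hB => by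
        obtain ⟨f, rfl⟩ := splitting_isEdge_iff.1 hB
        exact Part.compat_iff.1 (hF _ (Finset.mem_insert_self _ _) _
          (Finset.mem_insert_of_mem (mem_edgeParts.2 ⟨f, rfl⟩))))
      (fun h => hρ (toPart_mem_edgeParts.2 (splitting_isEdge_iff.1 h)))
    refine ⟨T.insert v α, (edgeParts_insert (T := T) v α).trans ?_⟩
    rw [hα]

end STree

/-! ### Homology as the cohomology ring -/

instance (G : Graph.{u}) : Fintype G.V := Fintype.ofFinite _

section ToCoh

variable {k : Type w} [CommRing k] {S : PaintedSet.{u}}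

theorem balanced_cls_mul (m : Coh k S) : Balanced fun A => cls k A * m :=
  balanced_cls.map (AddMonoidHom.mulRight m)

namespace STree

variable (T : STree S)

theorem cls_mul_monomialCls_of_crosses {A A' : OrdPart S} (hA' : T.splitting.IsEdge A')
    (h : Crosses A.1 A'.1) : cls k A * T.monomialCls k = 0 := by
  classical
  obtain ⟨f, rfl⟩ := splitting_isEdge_iff.1 hA'
  rw [monomialCls_eq, ← Finset.mul_prod_erase _ _ (mem_edgeParts.2 ⟨f, rfl⟩), partCls_toPart,
    ← mul_assoc, cls_mul_cls_of_crosses h, zero_mul]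

theorem monomialCls_insert (v : T.graph.V) (A : OrdPart (T.graph.flagsAt v)) :
    (T.insert v A).monomialCls k = cls k (T.splitting.ext v A) * T.monomialCls k := by
  classical
  rw [monomialCls_eq, monomialCls_eq, ← partCls_toPart]
  exact (Finset.prod_congr (edgeParts_insert v A) fun _ _ => rfl).trans
    (Finset.prod_insert (ext_notMem_edgeParts v A))

theorem monomialCls_corolla (h3 : 3 ≤ Nat.card S) (hw : ∃ s, s ∈ S.white) :
    (corolla h3 hw).monomialCls k = 1 := by
  rw [monomialCls_eq, edgeParts_corolla, Finset.prod_empty]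

theorem balanced_monomialCls (v : T.graph.V) :
    Balanced fun α : OrdPart (T.graph.flagsAt v) => cls k (T.splitting.ext v α) * T.monomialCls k :=
  Splitting.balanced_ext (𝒯 := T.splitting) (Θ := fun A => cls k A * T.monomialCls k)
    (fun _ _ h h' => T.cls_mul_monomialCls_of_crosses h h') (balanced_cls_mul _) v

theorem cls_part_mul_monomialCls (e : T.EdgeFlag) :
    cls k (T.part e) * T.monomialCls k =
      - cut (fun α => cls k (T.splitting.ext _ α) * T.monomialCls k)
          (⟨e.1, rfl⟩ : T.graph.flagsAt (T.graph.bd e.1)) -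
        cut (fun α => cls k (T.splitting.ext _ α) * T.monomialCls k)
          (⟨e.flip.1, rfl⟩ : T.graph.flagsAt (T.graph.bd e.flip.1)) := by
  have h1 := Splitting.eq_neg_edgeSum (𝒯 := T.splitting)
    (Θ := fun A => cls k A * T.monomialCls k)
    (fun _ _ h h' => T.cls_mul_monomialCls_of_crosses h h') (balanced_cls_mul _)
    (splitting_isEdge_iff.2 ⟨e, rfl⟩)
  have h2 : T.branch _ ⁻¹' {(⟨e.flip.1, rfl⟩ : T.graph.flagsAt _)} = (T.part e).1 :=
    (branch_preimage_self _).trans ((T.behind_edge e.flip).trans (by rw [e.flip_flip]))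
  have h3 : T.branch _ ⁻¹' {(⟨e.1, rfl⟩ : T.graph.flagsAt _)} = (T.part e).1ᶜ :=
    (branch_preimage_self _).trans ((T.behind_edge e).trans (by rw [part_flip]; rfl))
  have h4 := Splitting.edgeSum_eq (𝒯 := T.splitting) (Θ := fun A => cls k A * T.monomialCls k)
    h2 h3
  rw [h4] at h1
  refine h1.trans ?_
  rw [neg_add_rev]
  exact (sub_eq_add_neg _ _).symm

end STree

variable (k S) in
/-- The homomorphism from the homology module to the cohomology ring that maps the class of a tree
to its monomial. -/
def toCoh : Hlg k S →ₗ[k] Coh k S :=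
  (relSubmodule k S).liftQ (Finsupp.linearCombination k (Quotient.lift
    (fun T : STree S => T.monomialCls k) fun T T' h => by
      rw [STree.monomialCls_eq, STree.monomialCls_eq, STree.edgeParts_eq_of_equiv h])) (by
    refine Submodule.span_le.2 ?_
    rintro _ ⟨T, v, I, J, K, L, hall, rfl⟩
    change Finsupp.linearCombination k _ _ = 0
    rw [stdRel, map_sub, map_sum, map_sum, sub_eq_zero]
    simp only [muFree, Finsupp.linearCombination_single, one_smul, Quotient.lift_mk,
      STree.monomialCls_insert]
    exact (T.balanced_monomialCls v).rel I J K L hall)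

@[simp] theorem toCoh_mu (T : STree S) : toCoh k S (mu k T) = T.monomialCls k := by
  change Finsupp.linearCombination k _ (muFree k T) = _
  rw [muFree, Finsupp.linearCombination_single, one_smul]
  rfl

theorem hlg_ext {M : Type*} [AddCommGroup M] [Module k M] {f g : Hlg k S →ₗ[k] M}
    (h : ∀ T, f (mu k T) = g (mu k T)) : f = g := by
  refine Submodule.linearMap_qext _ (Finsupp.lhom_ext' fun F => LinearMap.ext_ring ?_)
  induction F using Quotient.ind with | _ T
  exact h T

theorem span_mu : Submodule.span k (Set.range (mu k (S := S))) = ⊤ := by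
  have h : (Submodule.span k (Set.range (mu k (S := S)))).mkQ = 0 := hlg_ext fun T => by
    rw [LinearMap.zero_apply, Submodule.mkQ_apply, Submodule.Quotient.mk_eq_zero]
    exact Submodule.subset_span ⟨T, rfl⟩
  rw [← Submodule.ker_mkQ (Submodule.span k (Set.range (mu k (S := S)))), h, LinearMap.ker_zero]

/-! ### The linear relations as a space of functions on partitions -/

open Classical in
/-- The linear relation of a quadruple as a function on unordered partitions. -/
def quadFun (k : Type w) [CommRing k] (i j p q : S) : Part S → k :=
  ∑ A ∈ sep i j p q, Pi.single A.toPart 1 - ∑ A ∈ sep p j i q, Pi.single A.toPart 1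

variable (k S) in
/-- The span of the linear relations of allowed quadruples. -/
def quadSpan : Submodule k (Part S → k) :=
  Submodule.span k {u | ∃ i j p q : S, Allowed S.white i j p q ∧ u = quadFun k i j p q}

theorem sum_quadFun_smul {M : Type*} [AddCommGroup M] [Module k M] (Θ : Part S → M)
    (i j p q : S) : ∑ ρ, quadFun k i j p q ρ • Θ ρ =
      ∑ A ∈ sep i j p q, Θ A.toPart - ∑ A ∈ sep p j i q, Θ A.toPart := by
  classical
  have key : ∀ s : Finset (OrdPart S),
      ∑ ρ, (∑ A ∈ s, Pi.single A.toPart (1 : k) : Part S → k) ρ • Θ ρ = ∑ A ∈ s, Θ A.toPart := by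
    intro s
    simp only [Finset.sum_apply, Finset.sum_smul]
    rw [Finset.sum_comm]
    refine Finset.sum_congr rfl fun A _ => ?_
    rw [Finset.sum_eq_single A.toPart]
    · rw [Pi.single_eq_same, one_smul]
    · intro ρ _ h
      rw [Pi.single_eq_of_ne h, zero_smul]
    · simp
  rw [← key, ← key, ← Finset.sum_sub_distrib]
  refine Finset.sum_congr rfl fun ρ _ => ?_
  rw [← sub_smul]
  unfold quadFun
  rw [Pi.sub_apply]

theorem unimodular_quadSpan : FaceModule.Unimodular Part.Compat (quadSpan k S) := by
  classical
  intro F hF ρ hρ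
  obtain ⟨A, rfl⟩ := OrdPart.toPart_surjective ρ
  obtain ⟨i, j, p, q, hall, hA, h1, h2⟩ := exists_dual (C := {B : OrdPart S | B.toPart ∈ F})
    (fun B hB => by rwa [Set.mem_ofPred_eq, OrdPart.toPart_compl])
    (fun B hB C hC => Part.compat_iff.1 (hF _ hB _ hC)) hρ
  have hval : ∀ σ ∈ F, quadFun k i j p q σ = if A.toPart = σ then 1 else 0 := by
    intro σ hσ
    have e1 : ∑ B ∈ sep i j p q, (Pi.single B.toPart (1 : k) : Part S → k) σ =
        if A.toPart = σ then 1 else 0 := by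
      rw [Finset.sum_eq_single A]
      · rw [Pi.single_apply]
        simp only [eq_comm]
      · intro B hB hne
        refine Pi.single_eq_of_ne (fun h => hne (h1 B ?_ hB)) _
        rw [Set.mem_ofPred_eq, ← h]
        exact hσ
      · exact fun h => absurd hA h
    have e2 : ∑ B ∈ sep p j i q, (Pi.single B.toPart (1 : k) : Part S → k) σ = 0 := by
      refine Finset.sum_eq_zero fun B hB => Pi.single_eq_of_ne (fun h => h2 B ?_ hB) _
      rw [Set.mem_ofPred_eq, ← h]
      exact hσ
    unfold quadFun
    rw [Pi.sub_apply, Finset.sum_apply, Finset.sum_apply]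
    refine Eq.trans ?_ (sub_zero _)
    rw [← e1, ← e2]
  refine ⟨_, Submodule.subset_span ⟨i, j, p, q, hall, rfl⟩, ?_, fun σ hσ hne => ?_⟩
  · rw [hval _ hρ, if_pos rfl]
  · rw [hval _ hσ, if_neg hne.symm]

variable (k S) in
/-- The map from cohomology to the module of faces: the class of a monomial acts on the empty face. -/
theorem exists_toFace : ∃ g : Coh k S →ₗ[k] _ ⧸ FaceModule.rel Part.Compat (quadSpan k S),
    ∀ F : Finset (Part S), g (∏ ρ ∈ F, partCls k ρ) = FaceModule.face _ _ F := by
  obtain ⟨φ, hφ⟩ := FaceModule.exists_action (unimodular_quadSpan (k := k) (S := S))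
  have hker : ∀ a ∈ relIdeal k S, φ a = 0 := by
    suffices relIdeal k S ≤ RingHom.ker φ from fun a ha => this ha
    refine Ideal.span_le.2 ?_
    rintro _ (⟨i, j, p, q, hall, rfl⟩ | ⟨i, j, p, q, hall, A, hA, B, hB, rfl⟩)
    · change φ _ = 0
      have h := FaceModule.sum_smul_op_eq_zero (unimodular_quadSpan (k := k) (S := S))
        (Submodule.subset_span ⟨i, j, p, q, hall, rfl⟩ : quadFun k i j p q ∈ quadSpan k S)
      have h' := (sum_quadFun_smul (fun ρ => FaceModule.op _ ρ) i j p q).symm.trans h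
      simp only [← hφ] at h'
      rw [linRel, map_sub, map_sum, map_sum]
      exact h'
    · change φ _ = 0
      have h1 : ¬ Part.Compat A.toPart B.toPart := fun h =>
        Part.compat_iff.1 h (crosses_of_mem_sep hA hB)
      rw [map_mul]
      change φ (MvPolynomial.X A.toPart) * φ (MvPolynomial.X B.toPart) = 0
      rw [hφ, hφ]
      exact FaceModule.op_mul_op_eq_zero _ (fun _ _ h => h.symm) h1
        (Part.compat_iff.2 (not_crosses_self _))
  let Φ := Ideal.Quotient.liftₐ (relIdeal k S) φ hker
  refine ⟨(LinearMap.applyₗ (FaceModule.face _ _ ∅)).comp Φ.toLinearMap, fun F => ?_⟩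
  rw [← FaceModule.prod_op_face _ φ hφ F]
  change Φ _ _ = _
  have : ∏ ρ ∈ F, partCls k ρ = Ideal.Quotient.mk (relIdeal k S) (∏ ρ ∈ F, MvPolynomial.X ρ) := by
    rw [map_prod]
    rfl
  rw [this]
  rfl

open Classical in
/-- The homology class of the tree with a given set of partitions. -/
def faceMu (k : Type w) [CommRing k] (F : Finset (Part S)) : Hlg k S :=
  if h : ∃ T : STree S, T.edgeParts = F then mu k h.choose else 0

theorem faceMu_edgeParts (T : STree S) : faceMu k T.edgeParts = mu k T := by
  have h : ∃ T' : STree S, T'.edgeParts = T.edgeParts := ⟨T, rfl⟩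
  rw [faceMu, dif_pos h]
  exact STree.mu_eq_mu k h.choose_spec

open Classical in
/-- The class of the tree with an additional edge that gives the partition `A`; for the partitions
of the edges of the tree, the value is dictated by the linear relations. -/
def insertMu (k : Type w) [CommRing k] (T : STree S) (A : OrdPart S) : Hlg k S :=
  if T.splitting.IsEdge A then
    - T.splitting.edgeSum (fun A => faceMu k (insert A.toPart T.edgeParts)) A
  else faceMu k (insert A.toPart T.edgeParts)

open Classical in
theorem balanced_insertMu (T : STree S) : Balanced (insertMu k T) := by
  unfold insertMu
  set θ : OrdPart S → Hlg k S := fun A => faceMu k (insert A.toPart T.edgeParts) with hθ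
  have hsymm : ∀ A, θ A.compl = θ A := fun A => by simp only [hθ, OrdPart.toPart_compl]
  have hext : ∀ v α, θ (T.splitting.ext v α) = mu k (T.insert v α) := fun v α => by
    have h := T.edgeParts_insert v α
    have h' := faceMu_edgeParts (k := k) (T.insert v α)
    rw [h] at h'
    exact h'
  set Θ : OrdPart S → Hlg k S := fun A =>
    if T.splitting.IsEdge A then - T.splitting.edgeSum θ A else θ A with hΘ
  have hΘext : ∀ v α, Θ (T.splitting.ext v α) = θ (T.splitting.ext v α) := fun v α =>
    if_neg (Splitting.not_isEdge_ext v α)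
  refine Splitting.balanced (𝒯 := T.splitting) (Θ := Θ) (fun A A' hA' hc => ?_) (fun A => ?_)
    (fun v => ?_) (fun A hA => ?_)
  · have h1 : ¬ T.splitting.IsEdge A := fun hA => Splitting.not_crosses_edges hA hA' hc
    have h2 : ¬ ∃ T' : STree S, T'.edgeParts = insert A.toPart T.edgeParts := by
      rintro ⟨T', hT'⟩
      obtain ⟨f, rfl⟩ := STree.splitting_isEdge_iff.1 hA'
      have hF := T'.face_edgeParts
      rw [hT'] at hF
      exact Part.compat_iff.1 (hF _ (Finset.mem_insert_self _ _) _
        (Finset.mem_insert_of_mem (STree.mem_edgeParts.2 ⟨f, rfl⟩))) hc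
    exact (if_neg h1).trans (dif_neg h2)
  · have hiff : T.splitting.IsEdge A.compl ↔ T.splitting.IsEdge A :=
      ⟨fun h => by simpa using Splitting.isEdge_compl h, Splitting.isEdge_compl⟩
    simp only [hΘ, hiff, Splitting.edgeSum_compl, hsymm]
  · have h1 : (fun α => Θ (T.splitting.ext v α)) =
        fun α : OrdPart (T.graph.flagsAt v) => mu k (T.insert v α) :=
      funext fun α => (hΘext v α).trans (hext v α)
    have h2 : Balanced fun α : OrdPart (T.graph.flagsAt v) => mu k (T.insert v α) := by
      constructor
      · intro α
        exact (hext v α.compl).symm.trans ((hsymm (T.splitting.ext v α)).trans (hext v α))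
      · intro I J K L hall
        have h3 : (relSubmodule k S).mkQ (stdRel k T v I J K L) = 0 := by
          rw [Submodule.mkQ_apply, Submodule.Quotient.mk_eq_zero]
          exact Submodule.subset_span ⟨T, v, I, J, K, L, hall, rfl⟩
        rw [stdRel, map_sub, map_sum, map_sum, sub_eq_zero] at h3
        exact h3
    exact h1 ▸ h2
  · refine (if_pos hA).trans ?_
    unfold Splitting.edgeSum
    simp only [hΘext]

open Classical in
theorem sum_smul_faceMu_eq_zero (T : STree S) {u : Part S → k}
    (hu : u ∈ quadSpan k S) (h0 : ∀ σ ∈ T.edgeParts, u σ = 0) :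
    ∑ τ ∈ T.edgePartsᶜ, u τ • faceMu k (insert τ T.edgeParts) = 0 := by
  have hb := balanced_insertMu (k := k) T
  let Θ : Part S → Hlg k S := Quotient.lift (insertMu k T) (by
    rintro A A' (rfl | rfl)
    · rfl
    · exact hb.symm A')
  have hΘ : ∀ τ ∉ T.edgeParts, Θ τ = faceMu k (insert τ T.edgeParts) := by
    intro τ hτ
    obtain ⟨A, rfl⟩ := OrdPart.toPart_surjective τ
    exact if_neg fun hA => hτ (STree.toPart_mem_edgeParts.2 (STree.splitting_isEdge_iff.1 hA))
  have hsum : ∑ ρ, u ρ • Θ ρ = 0 := by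
    clear h0
    induction hu using Submodule.span_induction with
    | mem u hu =>
      obtain ⟨i, j, p, q, hall, rfl⟩ := hu
      rw [sum_quadFun_smul, sub_eq_zero]
      exact hb.rel i j p q hall
    | zero => simp
    | add u v _ _ h1 h2 => simp only [Pi.add_apply, add_smul, Finset.sum_add_distrib, h1, h2, add_zero]
    | smul c u _ h => simp only [Pi.smul_apply, smul_assoc, ← Finset.smul_sum, h, smul_zero]
  rw [← Finset.sum_add_sum_compl T.edgeParts,
    Finset.sum_eq_zero fun τ hτ => by rw [h0 τ hτ, zero_smul], zero_add] at hsum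
  rw [← hsum]
  exact Finset.sum_congr rfl fun τ hτ => by rw [hΘ τ (Finset.mem_compl.1 hτ)]

/-- The monomials of the trees satisfy no other relations than the homology classes of the trees. -/
theorem toCoh_injective : Function.Injective (toCoh k S) := by
  classical
  by_cases hS : IsEmpty (STree S)
  · have h : Subsingleton (Hlg k S) := by
      refine ⟨fun x y => ?_⟩
      have h1 : (LinearMap.id : Hlg k S →ₗ[k] Hlg k S) = 0 := hlg_ext fun T => hS.elim T
      rw [← LinearMap.id_apply (R := k) x, ← LinearMap.id_apply (R := k) y, h1,
        LinearMap.zero_apply, LinearMap.zero_apply]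
    exact Function.injective_of_subsingleton _
  rw [not_isEmpty_iff] at hS
  obtain ⟨T₀⟩ := hS
  obtain ⟨g, hg⟩ := exists_toFace k S
  let h : (_ ⧸ FaceModule.rel Part.Compat (quadSpan k S)) →ₗ[k] Hlg k S :=
    (FaceModule.rel Part.Compat (quadSpan k S)).liftQ (Finsupp.linearCombination k (faceMu k)) (by
      refine Submodule.span_le.2 ?_
      rintro _ (⟨F, hF, rfl⟩ | ⟨F, hF, u, hu, hu0, rfl⟩)
      · change Finsupp.linearCombination k _ _ = 0
        rw [Finsupp.linearCombination_single, one_smul]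
        refine dif_neg ?_
        rintro ⟨T, rfl⟩
        exact hF T.face_edgeParts
      · obtain ⟨T, rfl⟩ := STree.exists_edgeParts_eq T₀ F hF
        change Finsupp.linearCombination k _ _ = 0
        rw [map_sum]
        simp only [map_smul, Finsupp.linearCombination_single, one_smul]
        exact sum_smul_faceMu_eq_zero T hu hu0)
  have hcomp : (h.comp g).comp (toCoh k S) = LinearMap.id := hlg_ext fun T => by
    rw [LinearMap.comp_apply, LinearMap.comp_apply, toCoh_mu, STree.monomialCls_eq, hg,
      LinearMap.id_apply]
    change Finsupp.linearCombination k (faceMu k) (Finsupp.single _ 1) = _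
    rw [Finsupp.linearCombination_single, one_smul, faceMu_edgeParts]
  exact Function.LeftInverse.injective (g := h.comp g) fun x => LinearMap.congr_fun hcomp x

/-! ### The action -/

theorem STree.cls_mul_monomialCls_mem (T : STree S) (A : OrdPart S) :
    cls k A * T.monomialCls k ∈ LinearMap.range (toCoh k S) := by
  have hext : ∀ v (α : OrdPart (T.graph.flagsAt v)),
      cls k (T.splitting.ext v α) * T.monomialCls k ∈ LinearMap.range (toCoh k S) := fun v α =>
    ⟨mu k (T.insert v α), by rw [toCoh_mu, monomialCls_insert]⟩
  by_cases hA : T.splitting.IsEdge A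
  · obtain ⟨e, rfl⟩ := splitting_isEdge_iff.1 hA
    have hcut : ∀ v (x : T.graph.flagsAt v), cut (fun α => cls k (T.splitting.ext v α) *
        T.monomialCls k) x ∈ LinearMap.range (toCoh k S) := by
      intro v x
      unfold cut
      split_ifs
      · exact Submodule.sum_mem _ fun α _ => hext v α
      · exact Submodule.zero_mem _
    rw [cls_part_mul_monomialCls]
    exact Submodule.sub_mem _ (Submodule.neg_mem _ (hcut _ _)) (hcut _ _)
  by_cases hc : ∃ A', T.splitting.IsEdge A' ∧ Crosses A.1 A'.1
  · obtain ⟨A', h1, h2⟩ := hc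
    rw [T.cls_mul_monomialCls_of_crosses h1 h2]
    exact Submodule.zero_mem _
  · push Not at hc
    obtain ⟨v, α, rfl⟩ := Splitting.exists_ext hc hA
    exact hext v α

theorem exists_toCoh_eq_mul (a : Coh k S) (x : Hlg k S) : ∃ y, toCoh k S y = a * toCoh k S x := by
  have ha : a ∈ Algebra.adjoin k (Set.range (cls k (S := S))) := by
    rw [coh_adjoin]
    exact Algebra.mem_top
  induction ha using Algebra.adjoin_induction generalizing x with
  | mem a ha =>
    obtain ⟨A, rfl⟩ := ha
    have hx : x ∈ Submodule.span k (Set.range (mu k (S := S))) := by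
      rw [span_mu]
      exact Submodule.mem_top
    induction hx using Submodule.span_induction with
    | mem x hx =>
      obtain ⟨T, rfl⟩ := hx
      rw [toCoh_mu]
      exact T.cls_mul_monomialCls_mem A
    | zero => exact ⟨0, by rw [map_zero, mul_zero]⟩
    | add x y _ _ h1 h2 =>
      obtain ⟨x', h1⟩ := h1
      obtain ⟨y', h2⟩ := h2
      exact ⟨x' + y', by rw [map_add, map_add, mul_add, h1, h2]⟩
    | smul c x _ h =>
      obtain ⟨x', h⟩ := h
      exact ⟨c • x', by rw [map_smul, map_smul, mul_smul_comm, h]⟩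
  | algebraMap c => exact ⟨c • x, (map_smul _ c x).trans (Algebra.smul_def c _)⟩
  | add a b _ _ h1 h2 =>
    obtain ⟨y, h1⟩ := h1 x
    obtain ⟨z, h2⟩ := h2 x
    exact ⟨y + z, by rw [map_add, h1, h2, add_mul]⟩
  | mul a b _ _ h1 h2 =>
    obtain ⟨y, hy⟩ := h2 x
    obtain ⟨z, hz⟩ := h1 y
    exact ⟨z, by rw [hz, hy, mul_assoc]⟩

theorem toCoh_surjective (T₀ : STree S) : Function.Surjective (toCoh k S) := fun a => by
  obtain ⟨y, hy⟩ := exists_toCoh_eq_mul a (mu k (S := S) (STree.corolla T₀.three_le_card T₀.exists_white))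
  exact ⟨y, by rw [hy, toCoh_mu, STree.monomialCls_corolla, mul_one]⟩

variable (k S) in
theorem exists_hlgAct : ∃ act : Coh k S →ₐ[k] Module.End k (Hlg k S),
    ∀ a x, toCoh k S (act a x) = a * toCoh k S x := by
  choose g hg using exists_toCoh_eq_mul (k := k) (S := S)
  let f : Coh k S → Module.End k (Hlg k S) := fun a =>
    { toFun := g a
      map_add' := fun x y => toCoh_injective (by rw [map_add, hg, hg, hg, map_add, mul_add])
      map_smul' := fun c x => toCoh_injective (by
        rw [RingHom.id_apply, map_smul, hg, hg, map_smul, mul_smul_comm]) }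
  have hf : ∀ a x, toCoh k S (f a x) = a * toCoh k S x := hg
  refine ⟨AlgHom.ofLinearMap
    { toFun := f
      map_add' := fun a b => LinearMap.ext fun x => toCoh_injective (by
        rw [LinearMap.add_apply, map_add, hf, hf, hf, add_mul])
      map_smul' := fun c a => LinearMap.ext fun x => toCoh_injective (by
        rw [RingHom.id_apply, LinearMap.smul_apply, map_smul, hf, hf, smul_mul_assoc]) }
    (LinearMap.ext fun x => toCoh_injective ((hf _ _).trans (one_mul _)))
    (fun a b => LinearMap.ext fun x => toCoh_injective ((hf _ _).trans ((mul_assoc a b _).trans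
      ((congrArg _ (hf b x).symm).trans (hf a _).symm)))), hf⟩

variable (k S) in
/-- The action of the cohomology ring on the homology module: the module structure for which the
homomorphism `toCoh` is linear. -/
def hlgAct : Coh k S →ₐ[k] Module.End k (Hlg k S) := (exists_hlgAct k S).choose

@[simp] theorem toCoh_hlgAct (a : Coh k S) (x : Hlg k S) :
    toCoh k S (hlgAct k S a x) = a * toCoh k S x := (exists_hlgAct k S).choose_spec a x

theorem isAction_hlgAct : IsAction k (hlgAct k S) where
  not_break T A h1 h2 := toCoh_injective (by
    rw [toCoh_hlgAct, toCoh_mu, map_zero]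
    have hA : ¬ T.splitting.IsEdge A := fun h => h1 (STree.splitting_isEdge_iff.1 h)
    by_cases hc : ∃ A', T.splitting.IsEdge A' ∧ Crosses A.1 A'.1
    · obtain ⟨A', h1, h2⟩ := hc
      exact T.cls_mul_monomialCls_of_crosses h1 h2
    · push Not at hc
      obtain ⟨v, α, rfl⟩ := Splitting.exists_ext hc hA
      exact absurd ⟨v, α, STree.part_newEdge v α⟩ h2)
  break_vertex T v A := toCoh_injective (by
    rw [toCoh_hlgAct, toCoh_mu, toCoh_mu, STree.monomialCls_insert]
    exact congrArg (fun B => cls k B * T.monomialCls k) (STree.part_newEdge v A))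
  break_edge T e I J K L hI hJ hK hL hall := toCoh_injective (by
    obtain ⟨⟨hIJ, -, -, -, -, hKL⟩, ⟨hw1, hw2⟩, -⟩ := hall
    rw [toCoh_hlgAct, toCoh_mu, T.cls_part_mul_monomialCls, map_sub, map_neg, map_sum, map_sum]
    simp only [toCoh_mu, STree.monomialCls_insert]
    rw [(T.balanced_monomialCls _).sum_sep_eq_cut (x := ⟨e.1, rfl⟩) (T.graph.edge_white _ e.2)
        (fun h => hIJ (congrArg Subtype.val h)) (fun h => hI (congrArg Subtype.val h))
        (fun h => hJ (congrArg Subtype.val h)) hw1,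
      (T.balanced_monomialCls _).sum_sep_eq_cut (x := ⟨e.flip.1, rfl⟩)
        (T.graph.edge_white _ e.flip.2)
        (fun h => hKL (congrArg Subtype.val h)) (fun h => hK (congrArg Subtype.val h))
        (fun h => hL (congrArg Subtype.val h)) hw2]
    rfl)

end ToCoh

/-! ### One-edge trees -/

namespace OneEdge

variable {S S₁ S₂ : PaintedSet.{u}} (D : OneEdge S S₁ S₂)

/-- The flag at the first vertex behind which a tail lies. -/
def side (s : S) : S₁ := (D.toSum s).elim id fun _ => D.e₁

variable {D}

theorem toSum_ne {s : S} : D.toSum s ≠ Sum.inl D.e₁ := ((D.toSum_range _).1 ⟨s, rfl⟩).1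

theorem toSum_eq_of_mem {s : S} (h : s ∈ D.part.1) : D.toSum s = Sum.inl (D.side s) := by
  obtain ⟨x, hx⟩ := h
  rw [side, hx]
  rfl

theorem side_eq_of_toSum {s : S} {x : S₁} (h : D.toSum s = Sum.inl x) : D.side s = x := by
  rw [side, h]
  rfl

theorem side_eq_e₁_iff {s : S} : D.side s = D.e₁ ↔ s ∉ D.part.1 := by
  constructor
  · intro h hs
    exact toSum_ne ((toSum_eq_of_mem hs).trans (congrArg Sum.inl h))
  · intro h
    obtain ⟨x, hx⟩ := (D.not_left_iff s).1 h
    rw [side, hx]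
    rfl

theorem side_eq_side_iff {s t : S} :
    D.side s = D.side t ↔ s = t ∨ (s ∉ D.part.1 ∧ t ∉ D.part.1) := by
  constructor
  · intro h
    by_cases hs : s ∈ D.part.1
    · have ht : t ∈ D.part.1 := by
        by_contra ht
        rw [side_eq_e₁_iff.2 ht] at h
        exact side_eq_e₁_iff.1 h hs
      exact Or.inl (D.toSum_inj (by rw [toSum_eq_of_mem hs, toSum_eq_of_mem ht, h]))
    · exact Or.inr ⟨hs, by rwa [← side_eq_e₁_iff, ← h, side_eq_e₁_iff]⟩
  · rintro (rfl | ⟨hs, ht⟩)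
    · rfl
    · rw [side_eq_e₁_iff.2 hs, side_eq_e₁_iff.2 ht]

theorem exists_toSum {x : S₁} (hx : x ≠ D.e₁) : ∃ s, D.toSum s = Sum.inl x :=
  (D.toSum_range _).2 ⟨fun h => hx (Sum.inl.inj h), Sum.inl_ne_inr⟩

theorem side_preimage_e₁ : D.side ⁻¹' {D.e₁} = D.part.1ᶜ := Set.ext fun _ => side_eq_e₁_iff

theorem side_surjective : Function.Surjective D.side := by
  intro x
  by_cases hx : x = D.e₁
  · obtain ⟨s, hs, -⟩ := D.part.2.white_compl
    exact ⟨s, (side_eq_e₁_iff.2 hs).trans hx.symm⟩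
  · obtain ⟨s, hs⟩ := exists_toSum hx
    exact ⟨s, side_eq_of_toSum hs⟩

theorem white_of_toSum {s : S} {x : S₁} (h : D.toSum s = Sum.inl x) :
    x ∈ S₁.white ↔ s ∈ S.white := by
  rw [← D.white_iff s, h]
  rfl

theorem side_white_iff (x : S₁) : x ∈ S₁.white ↔ ∃ s ∈ S.white, D.side s = x := by
  by_cases hx : x = D.e₁
  · subst hx
    obtain ⟨s, hs, hw⟩ := D.part.2.white_compl
    exact ⟨fun _ => ⟨s, hw, side_eq_e₁_iff.2 hs⟩, fun _ => D.e₁_white⟩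
  · obtain ⟨s, hs⟩ := exists_toSum hx
    rw [white_of_toSum hs]
    refine ⟨fun h => ⟨s, h, side_eq_of_toSum hs⟩, ?_⟩
    rintro ⟨t, ht, rfl⟩
    rcases side_eq_side_iff.1 (side_eq_of_toSum hs) with rfl | h
    · exact ht
    · exact absurd ⟨_, hs⟩ h.1

theorem side_stable (s t : S) (hst : s ≠ t) (h : D.side s = D.side t) :
    IsStablePart (D.side ⁻¹' {D.side s}) := by
  have hs := ((side_eq_side_iff.1 h).resolve_left hst).1
  rw [side_eq_e₁_iff.2 hs, side_preimage_e₁]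
  exact D.part.2.compl

theorem three_le_card (D : OneEdge S S₁ S₂) : 3 ≤ Nat.card S₁ := by
  have h1 : D.e₁ ∉ D.side '' D.part.1 := by
    rintro ⟨s, hs, h⟩
    exact side_eq_e₁_iff.1 h hs
  have h2 : (D.side '' D.part.1).ncard = D.part.1.ncard :=
    Set.InjOn.ncard_image fun s hs t _ h => (side_eq_side_iff.1 h).resolve_right fun h => h.1 hs
  have h3 := Set.ncard_insert_of_notMem h1 (Set.toFinite _)
  have h4 := Set.ncard_le_card (insert D.e₁ (D.side '' D.part.1))
  have h5 := D.part.2.two_le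
  omega

variable (D) in
theorem swap_swap : D.swap.swap = D := by
  cases D
  simp only [swap, Sum.swap_swap]

variable (D)

/-- The corolla with the flags of the first vertex. -/
def fstCorolla : STree S₁ := STree.corolla D.three_le_card ⟨D.e₁, D.e₁_white⟩

/-- The splitting of the set of tails given by a one-edge tree. The first vertex is `true`, the
second one `false`. -/
def splitting : Splitting S Bool where
  X b := match b with | true => S₁ | false => S₂
  br b := match b with | true => D.side | false => D.swap.side
  surj b := match b with | true => side_surjective | false => side_surjective
  white_iff b := match b with | true => side_white_iff | false => side_white_iff
  stable b := match b with | true => side_stable | false => side_stable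
  three_le b := match b with | true => D.three_le_card | false => D.swap.three_le_card
  sep v w hvw := by
    have key : ∀ s, D.side s = D.e₁ ∨ D.swap.side s = D.e₂ := fun s => by
      rw [side_eq_e₁_iff, show D.e₂ = D.swap.e₁ from rfl, side_eq_e₁_iff, swap_part,
        OrdPart.compl_val, Set.mem_compl_iff, not_not]
      exact (em _).symm
    match v, w, hvw with
    | true, true, h => exact absurd rfl h
    | false, false, h => exact absurd rfl h
    | true, false, _ => exact ⟨D.e₁, D.e₂, key⟩
    | false, true, _ => exact ⟨D.e₂, D.e₁, fun s => (key s).symm⟩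
  flip v x hx := by
    have key : ∀ {S₁ S₂ : PaintedSet.{u}} (D : OneEdge S S₁ S₂) (x : S₁),
        IsStablePart (D.side ⁻¹' {x}) → D.swap.side ⁻¹' {D.e₂} = (D.side ⁻¹' {x})ᶜ := by
      intro S₁ S₂ D x hx
      by_cases hxe : x = D.e₁
      · rw [hxe, side_preimage_e₁, show D.e₂ = D.swap.e₁ from rfl, side_preimage_e₁, swap_part]
        rfl
      · obtain ⟨s, hs⟩ := exists_toSum hxe
        obtain ⟨t, ht, hne⟩ := (Set.one_lt_ncard_iff_nontrivial.1 hx.two_le).exists_ne s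
        have h := (side_eq_side_iff.1
          ((show D.side t = x from ht).trans (side_eq_of_toSum hs).symm)).resolve_left hne
        exact absurd ⟨x, hs⟩ h.2
    match v, x, hx with
    | true, x, hx => exact ⟨false, D.e₂, key D x hx⟩
    | false, x, hx =>
      have h := key D.swap x hx
      rw [swap_swap] at h
      exact ⟨true, D.e₁, h⟩
  cover A _ h := by
    have hc : ¬ Crosses A D.part.1 := by
      have h1 := h true D.e₁
      change IsStablePart (D.side ⁻¹' {D.e₁}) → ¬ Crosses A (D.side ⁻¹' {D.e₁}) at h1
      rw [side_preimage_e₁, crosses_compl_right] at h1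
      exact h1 D.part.2.compl
    by_cases h1 : A ∩ D.part.1ᶜ = ∅ ∨ Aᶜ ∩ D.part.1ᶜ = ∅
    · refine ⟨true, fun s t hst hs => ?_⟩
      rcases side_eq_side_iff.1 hst with rfl | ⟨hs', ht'⟩
      · exact hs
      rcases h1 with h1 | h1
      · exact absurd (h1 ▸ ⟨hs, hs'⟩ : s ∈ (∅ : Set S)) (Set.notMem_empty _)
      · by_contra ht
        exact absurd (h1 ▸ ⟨ht, ht'⟩ : t ∈ (∅ : Set S)) (Set.notMem_empty _)
    · refine ⟨false, fun s t hst hs => ?_⟩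
      have h1' := (not_or.1 h1).imp Set.nonempty_iff_ne_empty.2 Set.nonempty_iff_ne_empty.2
      rcases side_eq_side_iff.1 hst with rfl | ⟨hs', ht'⟩
      · exact hs
      rw [swap_part, OrdPart.compl_val, Set.mem_compl_iff, not_not] at hs' ht'
      by_contra ht
      exact hc ⟨⟨s, hs, hs'⟩, h1'.1, ⟨t, ht, ht'⟩, h1'.2⟩

/-- The partition of `S` induced by a partition of the set of flags at the first vertex. -/
def ext₁ (α : OrdPart S₁) : OrdPart S := D.splitting.ext true α

/-- The partition of `S` induced by a partition of the set of flags at the second vertex. -/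
def ext₂ (α : OrdPart S₂) : OrdPart S := D.splitting.ext false α

variable {D}

theorem isEdge_part : D.splitting.IsEdge D.part :=
  ⟨false, D.e₂, (side_preimage_e₁ (D := D.swap)).trans (by rw [swap_part]; exact compl_compl _)⟩

theorem isEdge_iff {A : OrdPart S} : D.splitting.IsEdge A ↔ A.toPart = D.part.toPart := by
  have key : ∀ {S₁ S₂ : PaintedSet.{u}} (D : OneEdge S S₁ S₂) (x : S₁),
      D.side ⁻¹' {x} = A.1 → A = D.part.compl := by
    intro S₁ S₂ D x hx
    obtain ⟨s, t, hs, ht, hst⟩ := (Set.one_lt_ncard_iff (Set.toFinite _)).1 A.2.two_le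
    rw [← hx] at hs ht
    have hs' : D.side s = x := hs
    have h := ((side_eq_side_iff.1 (hs'.trans (Eq.symm ht))).resolve_left hst).1
    rw [← hs', side_eq_e₁_iff.2 h, side_preimage_e₁] at hx
    exact Subtype.ext hx.symm
  rw [OrdPart.toPart_eq_iff]
  constructor
  · rintro ⟨b, x, hx⟩
    match b, x, hx with
    | true, x, hx => exact Or.inr (key D x hx)
    | false, x, hx => exact Or.inl ((key D.swap x hx).trans (by rw [swap_part, OrdPart.compl_compl]))
  · rintro (rfl | rfl)
    · exact isEdge_part
    · exact Splitting.isEdge_compl isEdge_part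

theorem side_restrict (B : OrdPart S) (h : B.1 ⊂ D.part.1) :
    D.side ⁻¹' (D.restrict B h).1 = B.1 := by
  ext s
  constructor
  · rintro ⟨t, ht, hts⟩
    have := (side_eq_side_iff.1 (side_eq_of_toSum hts)).resolve_right fun h' => h'.1 (h.1 ht)
    exact this ▸ ht
  · intro hs
    exact ⟨s, hs, toSum_eq_of_mem (h.1 hs)⟩

section Restriction

variable (k : Type w) [CommRing k] (D)

/-- The inclusions of the cohomology rings of the two vertices. -/
def inclusions (b : Bool) : Coh k (D.splitting.X b) →ₐ[k] Coh k S₁ ⊗[k] Coh k S₂ :=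
  match b with
  | true => Algebra.TensorProduct.includeLeft
  | false => Algebra.TensorProduct.includeRight

/-- The restriction homomorphism of a one-edge tree. -/
def resHom : Coh k S →ₐ[k] Coh k S₁ ⊗[k] Coh k S₂ :=
  (Splitting.exists_isRes (k := k) (B := Coh k S₁ ⊗[k] Coh k S₂) (𝒯 := D.splitting)
    (D.inclusions k)).choose

variable {k D}

theorem isRes_resHom :
    D.splitting.IsRes (k := k) (B := Coh k S₁ ⊗[k] Coh k S₂) (D.inclusions k) (D.resHom k) :=
  (Splitting.exists_isRes (k := k) (B := Coh k S₁ ⊗[k] Coh k S₂) (𝒯 := D.splitting)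
    (D.inclusions k)).choose_spec

theorem resHom_ext₁ (α : OrdPart S₁) : D.resHom k (cls k (D.ext₁ α)) = cls k α ⊗ₜ[k] 1 :=
  isRes_resHom.ext true α

theorem resHom_ext₂ (α : OrdPart S₂) : D.resHom k (cls k (D.ext₂ α)) = 1 ⊗ₜ[k] cls k α :=
  isRes_resHom.ext false α

theorem isRestriction_resHom : D.IsRestriction k (D.resHom k) where
  break_fst B h := by
    rw [← resHom_ext₁]
    exact congrArg (fun B => D.resHom k (cls k B)) (Subtype.ext (side_restrict B h).symm)
  break_snd B h := by
    rw [← resHom_ext₂]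
    exact congrArg (fun B => D.resHom k (cls k B))
      (Subtype.ext (side_restrict (D := D.swap) B h).symm)
  not_break B h1 h2 h3 h4 := isRes_resHom.crosses B D.part isEdge_part ⟨h1, h2, h3, h4⟩
  break_edge a b c d i j p q ha hb hc hd hall := by
    obtain ⟨⟨hab, -, -, -, -, hcd⟩, ⟨hw1, hw2⟩, -⟩ := hall
    have h1 := (isRes_resHom (k := k)).edge (isEdge_part (D := D))
    have h2 := Splitting.edgeSum_eq (𝒯 := D.splitting) (A := D.part)
      (Θ := fun A => D.resHom k (cls k A)) (v := false) (w := true) (x := D.e₂) (y := D.e₁)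
      ((side_preimage_e₁ (D := D.swap)).trans (by rw [swap_part]; exact compl_compl _))
      side_preimage_e₁
    rw [h2] at h1
    have key : ∀ {S₁ S₂ : PaintedSet.{u}} (D : OneEdge S S₁ S₂) (B : Type (max u w)) [CommRing B]
        [Algebra k B] (g : Coh k S₁ →ₐ[k] B) {a b : S} {i j : S₁}, D.toSum a = Sum.inl i →
        D.toSum b = Sum.inl j → a ≠ b → (a ∈ S.white ∨ b ∈ S.white) →
        ∑ A ∈ sep i j D.e₁ D.e₁, g (cls k A) = cut (fun α => g (cls k α)) D.e₁ := by
      intro S₁ S₂ D B _ _ g a b i j ha hb hab hw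
      refine (balanced_cls.map g).sum_sep_eq_cut D.e₁_white ?_ ?_ ?_ ?_
      · rintro rfl
        exact hab (D.toSum_inj (ha.trans hb.symm))
      · rintro rfl
        exact toSum_ne ha
      · rintro rfl
        exact toSum_ne hb
      · rwa [white_of_toSum ha, white_of_toSum hb]
    have e1 := key D (Coh k S₁ ⊗[k] Coh k S₂) Algebra.TensorProduct.includeLeft ha hb hab hw1
    have e2 := key D.swap (Coh k S₁ ⊗[k] Coh k S₂) Algebra.TensorProduct.includeRight
      (congrArg Sum.swap hc) (congrArg Sum.swap hd) hcd hw2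
    have e3 : (fun α => D.resHom k (cls k (D.splitting.ext true α))) =
        fun α : OrdPart S₁ => cls k α ⊗ₜ[k] (1 : Coh k S₂) := funext resHom_ext₁
    have e4 : (fun α => D.resHom k (cls k (D.splitting.ext false α))) =
        fun α : OrdPart S₂ => (1 : Coh k S₁) ⊗ₜ[k] cls k α := funext resHom_ext₂
    rw [e3, e4, neg_add_rev] at h1
    refine h1.trans ((sub_eq_add_neg _ _).symm.trans ?_)
    exact congrArg₂ (fun x y => - x - y) e1.symm e2.symm

theorem resHom_surjective : Function.Surjective (D.resHom k) := by
  intro z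
  induction z with
  | zero => exact ⟨0, map_zero _⟩
  | tmul x y =>
    obtain ⟨a, ha⟩ := isRes_resHom (D := D).range_le true ⟨x, rfl⟩
    obtain ⟨b, hb⟩ := isRes_resHom (D := D).range_le false ⟨y, rfl⟩
    refine ⟨a * b, ?_⟩
    have ha' : D.resHom k a = x ⊗ₜ[k] 1 := ha
    have hb' : D.resHom k b = 1 ⊗ₜ[k] y := hb
    rw [map_mul, ha', hb', Algebra.TensorProduct.tmul_mul_tmul, mul_one, one_mul]
  | add x y hx hy =>
    obtain ⟨a, rfl⟩ := hx
    obtain ⟨b, rfl⟩ := hy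
    exact ⟨a + b, map_add _ _ _⟩

theorem mem_crossIdeal_of_resHom_eq_zero {a : Coh k S} (ha : D.resHom k a = 0) :
    a ∈ D.splitting.crossIdeal k := by
  refine isRes_resHom.mem_crossIdeal (fun ψ => ?_) ha
  refine ⟨Algebra.TensorProduct.productMap (R := k) (A := Coh k S₁) (B := Coh k S₂)
    (S := Coh k S ⧸ D.splitting.crossIdeal k) (ψ true) (ψ false), fun b => ?_⟩
  match b with
  | true => exact fun a => Algebra.TensorProduct.productMap_left_apply _ _ a
  | false => exact fun a => Algebra.TensorProduct.productMap_right_apply _ _ a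

/-- The kernel of the restriction is generated by partitions that cross the edge, and their product
with the generator of the edge vanishes. This makes the push-forward well defined. -/
theorem mul_cls_part_eq_zero {a : Coh k S} (ha : D.resHom k a = 0) : a * cls k D.part = 0 := by
  have h := mem_crossIdeal_of_resHom_eq_zero ha
  clear ha
  induction h using Submodule.span_induction with
  | mem a ha =>
    obtain ⟨A, A', hA', hc, rfl⟩ := ha
    rw [← cls_mul_cls_of_crosses hc, ← partCls_toPart, ← partCls_toPart, ← partCls_toPart,
      isEdge_iff.1 hA']
  | zero => exact zero_mul _
  | add a b _ _ h1 h2 => rw [add_mul, h1, h2, add_zero]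
  | smul c a _ h => rw [smul_eq_mul, mul_assoc, h, mul_zero]

end Restriction

end OneEdge

/-! ### Gluing of trees -/

namespace Splitting

variable {S : PaintedSet.{u}} {V : Type v} (𝒯 : Splitting S V)

/-- The unordered partition of `S` induced by an unordered partition of `X v`. -/
def extPart (v : V) : Part (𝒯.X v) → Part S :=
  Quotient.map' (𝒯.ext v) (by
    rintro α β (rfl | rfl)
    · exact Or.inl rfl
    · exact Or.inr rfl)

theorem extPart_toPart (v : V) (α : OrdPart (𝒯.X v)) :
    𝒯.extPart v α.toPart = (𝒯.ext v α).toPart := rfl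

variable {𝒯}

theorem extPart_injective {v w : V} {ρ : Part (𝒯.X v)} {σ : Part (𝒯.X w)}
    (h : 𝒯.extPart v ρ = 𝒯.extPart w σ) : (⟨v, ρ⟩ : Σ v, Part (𝒯.X v)) = ⟨w, σ⟩ := by
  obtain ⟨α, rfl⟩ := OrdPart.toPart_surjective ρ
  obtain ⟨β, rfl⟩ := OrdPart.toPart_surjective σ
  have key : ∀ (z z' : Σ v, OrdPart (𝒯.X v)), z = z' →
      (⟨z.1, z.2.toPart⟩ : Σ v, Part (𝒯.X v)) = ⟨z'.1, z'.2.toPart⟩ := by rintro z _ rfl; rfl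
  rw [extPart_toPart, extPart_toPart] at h
  rcases OrdPart.toPart_eq_iff.1 h with h | h
  · exact key ⟨v, α⟩ ⟨w, β⟩ (ext_injective h)
  · have := key ⟨v, α⟩ ⟨w, β.compl⟩ (ext_injective h)
    rwa [OrdPart.toPart_compl] at this

theorem extPart_eq_iff {v : V} {ρ σ : Part (𝒯.X v)} :
    𝒯.extPart v ρ = 𝒯.extPart v σ ↔ ρ = σ :=
  ⟨fun h => eq_of_heq (Sigma.mk.inj (extPart_injective h)).2, fun h => h ▸ rfl⟩

theorem IsRes.extPart {k : Type w} [CommRing k] {B : Type*} [CommRing B] [Algebra k B]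
    {φ : ∀ v, Coh k (𝒯.X v) →ₐ[k] B} {r : Coh k S →ₐ[k] B} (hr : 𝒯.IsRes φ r) (v : V)
    (ρ : Part (𝒯.X v)) : r (partCls k (𝒯.extPart v ρ)) = φ v (partCls k ρ) := by
  obtain ⟨α, rfl⟩ := OrdPart.toPart_surjective ρ
  exact hr.ext v α

end Splitting

theorem exists_linearMap_of_surjective {k A B M : Type*} [CommRing k] [AddCommGroup A] [Module k A]
    [AddCommGroup B] [Module k B] [AddCommGroup M] [Module k M] {r : A →ₗ[k] B}
    (hr : Function.Surjective r) (f : A →ₗ[k] M) (h : ∀ a, r a = 0 → f a = 0) :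
    ∃ g : B →ₗ[k] M, ∀ a, g (r a) = f a := by
  refine ⟨((LinearMap.ker r).liftQ f h).comp
    (r.quotKerEquivOfSurjective hr).symm.toLinearMap, fun a => ?_⟩
  have : (r.quotKerEquivOfSurjective hr).symm (r a) = (LinearMap.ker r).mkQ a := by
    rw [LinearEquiv.symm_apply_eq]
    rfl
  rw [LinearMap.comp_apply, LinearEquiv.coe_coe, this]
  rfl

-- A shortcut that keeps instance synthesis fast.
instance {k : Type w} [CommRing k] (S S' : PaintedSet.{u}) : CommRing (Coh k S ⊗[k] Coh k S') :=
  Algebra.TensorProduct.instCommRing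

namespace OneEdge

variable {S S₁ S₂ : PaintedSet.{u}} (D : OneEdge S S₁ S₂) (T₁ : STree S₁) (T₂ : STree S₂)

variable {T₁ T₂} in
theorem glue_inv_inl {f : T₁.graph.F} (hf : f ≠ T₁.mark D.e₁) :
    (D.glue T₁ T₂).graph.inv (Sum.inl f) = Sum.inl (T₁.graph.inv f) := if_neg hf

variable {T₁ T₂} in
theorem glue_inv_inr {f : T₂.graph.F} (hf : f ≠ T₂.mark D.e₂) :
    (D.glue T₁ T₂).graph.inv (Sum.inr f) = Sum.inr (T₂.graph.inv f) := if_neg hf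

theorem glue_inv_left :
    (D.glue T₁ T₂).graph.inv (Sum.inl (T₁.mark D.e₁)) = Sum.inr (T₂.mark D.e₂) := if_pos rfl

variable {T₁ T₂} in
theorem glue_sep {v w : T₁.graph.V ⊕ T₂.graph.V}
    (h : (D.glue T₁ T₂).graph.Reach {Sum.inl (T₁.mark D.e₁)} v w) : v.isLeft = w.isLeft :=
  Graph.glue_sep (h₁ := (T₁.mark_tail _).2 ⟨_, rfl⟩) (h₂ := (T₂.mark_tail _).2 ⟨_, rfl⟩)
    (w₁ := (T₁.mark_white _).2 D.e₁_white) (w₂ := (T₂.mark_white _).2 D.e₂_white) h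

variable {T₁ T₂} in
theorem ne_mark_e₁ (f : T₁.EdgeFlag) : f.1 ≠ T₁.mark D.e₁ :=
  fun h => f.2 (h ▸ (T₁.mark_tail _).2 ⟨_, rfl⟩)

variable {T₁ T₂} in
theorem ne_mark_e₂ (f : T₂.EdgeFlag) : f.1 ≠ T₂.mark D.e₂ :=
  fun h => f.2 (h ▸ (T₂.mark_tail _).2 ⟨_, rfl⟩)

/-- An edge of the first tree as an edge of the glued tree. -/
def inlEdge (f : T₁.EdgeFlag) : (D.glue T₁ T₂).EdgeFlag :=
  ⟨Sum.inl f.1, fun h => f.2 (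
    Sum.inl.inj ((D.glue_inv_inl (D.ne_mark_e₁ f)).symm.trans h))⟩

/-- An edge of the second tree as an edge of the glued tree. -/
def inrEdge (f : T₂.EdgeFlag) : (D.glue T₁ T₂).EdgeFlag :=
  ⟨Sum.inr f.1, fun h => f.2 (
    Sum.inr.inj ((D.glue_inv_inr (D.ne_mark_e₂ f)).symm.trans h))⟩

theorem part_inlEdge (f : T₁.EdgeFlag) :
    (D.glue T₁ T₂).part (D.inlEdge T₁ T₂ f) = D.ext₁ (T₁.part f) := by
  have himp : ∀ f s, s ∈ ((D.glue T₁ T₂).part (D.inlEdge T₁ T₂ f)).1 →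
      D.side s ∈ (T₁.part f).1 := by
    intro f s hs
    have h := Graph.glue_proj_inl (h₁ := (T₁.mark_tail _).2 ⟨_, rfl⟩)
      (h₂ := (T₂.mark_tail _).2 ⟨_, rfl⟩) (w₁ := (T₁.mark_white _).2 D.e₁_white)
      (w₂ := (T₂.mark_white _).2 D.e₂_white) hs
    have h2 : Sum.elim id (fun _ => T₁.graph.bd (T₁.mark D.e₁)) ((D.glue T₁ T₂).graph.bd
        ((D.glue T₁ T₂).mark s)) = T₁.graph.bd (T₁.mark (D.side s)) := by
      change Sum.elim id _ (Sum.map T₁.graph.bd T₂.graph.bd (Sum.map T₁.mark T₂.mark (D.toSum s))) =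
        T₁.graph.bd (T₁.mark ((D.toSum s).elim id fun _ => D.e₁))
      rcases D.toSum s with x | x <;> rfl
    exact (congrArg (T₁.graph.Reach {f.1} (T₁.graph.bd f.1)) h2).mp h
  have hflip : (D.inlEdge T₁ T₂ f).flip = D.inlEdge T₁ T₂ f.flip :=
    Subtype.ext (D.glue_inv_inl (D.ne_mark_e₁ f))
  exact Subtype.ext (Set.ext fun s => STree.mem_part_iff_of_imp (himp f)
    (fun s hs => himp f.flip s (by rwa [← hflip])) s)

theorem part_inrEdge (f : T₂.EdgeFlag) :
    (D.glue T₁ T₂).part (D.inrEdge T₁ T₂ f) = D.ext₂ (T₂.part f) := by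
  have himp : ∀ f s, s ∈ ((D.glue T₁ T₂).part (D.inrEdge T₁ T₂ f)).1 →
      D.swap.side s ∈ (T₂.part f).1 := by
    intro f s hs
    have h := Graph.glue_proj_inr (h₁ := (T₁.mark_tail _).2 ⟨_, rfl⟩)
      (h₂ := (T₂.mark_tail _).2 ⟨_, rfl⟩) (w₁ := (T₁.mark_white _).2 D.e₁_white)
      (w₂ := (T₂.mark_white _).2 D.e₂_white) hs
    have h2 : Sum.elim (fun _ => T₂.graph.bd (T₂.mark D.e₂)) id ((D.glue T₁ T₂).graph.bd
        ((D.glue T₁ T₂).mark s)) = T₂.graph.bd (T₂.mark (D.swap.side s)) := by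
      change Sum.elim _ id (Sum.map T₁.graph.bd T₂.graph.bd (Sum.map T₁.mark T₂.mark (D.toSum s))) =
        T₂.graph.bd (T₂.mark ((D.toSum s).swap.elim id fun _ => D.e₂))
      rcases D.toSum s with x | x <;> rfl
    exact (congrArg (T₂.graph.Reach {f.1} (T₂.graph.bd f.1)) h2).mp h
  have hflip : (D.inrEdge T₁ T₂ f).flip = D.inrEdge T₁ T₂ f.flip :=
    Subtype.ext (D.glue_inv_inr (D.ne_mark_e₂ f))
  exact Subtype.ext (Set.ext fun s => STree.mem_part_iff_of_imp (himp f)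
    (fun s hs => himp f.flip s (by rwa [← hflip])) s)

theorem part_glueEdge : (D.glue T₁ T₂).part (D.glueEdge T₁ T₂) = D.part := by
  have hleft : ∀ s, ((D.glue T₁ T₂).graph.bd ((D.glue T₁ T₂).mark s)).isLeft = true ↔
      s ∈ D.part.1 := by
    intro s
    change (Sum.map T₁.graph.bd T₂.graph.bd (Sum.map T₁.mark T₂.mark (D.toSum s))).isLeft = true ↔
      ∃ x, D.toSum s = Sum.inl x
    rcases D.toSum s with x | x <;> simp
  refine Subtype.ext (Set.ext fun s => ⟨fun hs => ?_, fun hs => ?_⟩)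
  · exact (hleft s).1 (D.glue_sep hs).symm
  · by_contra hn
    have h : s ∈ ((D.glue T₁ T₂).part (D.glueEdge T₁ T₂).flip).1 := by
      rw [STree.part_flip]
      exact hn
    have h1 := D.glue_sep ((Graph.reach_inv_iff (G := (D.glue T₁ T₂).graph) _ _ _).1 h)
    rw [(hleft s).2 hs] at h1
    change ((D.glue T₁ T₂).graph.bd ((D.glue T₁ T₂).graph.inv
      (Sum.inl (T₁.mark D.e₁)))).isLeft = true at h1
    rw [glue_inv_left] at h1
    exact absurd h1 Bool.false_ne_true

/-- The unordered partition of `S` induced by one of the set of flags at the first vertex. -/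
def extPart₁ : Part S₁ → Part S := D.splitting.extPart true

/-- The unordered partition of `S` induced by one of the set of flags at the second vertex. -/
def extPart₂ : Part S₂ → Part S := D.splitting.extPart false

variable {D} in
theorem extPart₁_injective : Function.Injective D.extPart₁ := fun _ _ h =>
  Splitting.extPart_eq_iff.1 h

variable {D} in
theorem extPart₂_injective : Function.Injective D.extPart₂ := fun _ _ h =>
  Splitting.extPart_eq_iff.1 h

theorem extPart₁_ne_extPart₂ (ρ : Part S₁) (σ : Part S₂) : D.extPart₁ ρ ≠ D.extPart₂ σ := fun h =>
  Bool.false_ne_true (Sigma.mk.inj (Splitting.extPart_injective h)).1.symm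

theorem resHom_extPart₁ (k : Type w) [CommRing k] (ρ : Part S₁) :
    D.resHom k (partCls k (D.extPart₁ ρ)) = partCls k ρ ⊗ₜ[k] 1 := isRes_resHom.extPart true ρ

theorem resHom_extPart₂ (k : Type w) [CommRing k] (ρ : Part S₂) :
    D.resHom k (partCls k (D.extPart₂ ρ)) = 1 ⊗ₜ[k] partCls k ρ := isRes_resHom.extPart false ρ

theorem extPart₁_ne (ρ : Part S₁) : D.extPart₁ ρ ≠ D.part.toPart := by
  obtain ⟨α, rfl⟩ := OrdPart.toPart_surjective ρ
  intro h
  exact Splitting.not_isEdge_ext (𝒯 := D.splitting) true α (isEdge_iff.2 h)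

theorem extPart₂_ne (ρ : Part S₂) : D.extPart₂ ρ ≠ D.part.toPart := by
  obtain ⟨α, rfl⟩ := OrdPart.toPart_surjective ρ
  intro h
  exact Splitting.not_isEdge_ext (𝒯 := D.splitting) false α (isEdge_iff.2 h)

open Classical in
theorem edgeParts_glue : (D.glue T₁ T₂).edgeParts = insert D.part.toPart
    (T₁.edgeParts.image D.extPart₁ ∪
      T₂.edgeParts.image D.extPart₂) := by
  have hflip : D.part = ((D.glue T₁ T₂).part (D.glueEdge T₁ T₂).flip).compl := by
    rw [STree.part_flip, OrdPart.compl_compl, part_glueEdge]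
  ext ρ
  simp only [Finset.mem_insert, Finset.mem_union, Finset.mem_image, STree.mem_edgeParts]
  constructor
  · rintro ⟨⟨f | f, hf⟩, rfl⟩
    · by_cases hft : f = T₁.mark D.e₁
      · subst hft
        exact Or.inl (congrArg _ (D.part_glueEdge T₁ T₂))
      · have hf' : T₁.graph.inv f ≠ f := fun h => hf ((D.glue_inv_inl hft).trans
          (congrArg Sum.inl h))
        exact Or.inr (Or.inl ⟨_, ⟨⟨f, hf'⟩, rfl⟩, (congrArg OrdPart.toPart
          (D.part_inlEdge T₁ T₂ ⟨f, hf'⟩)).symm⟩)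
    · by_cases hft : f = T₂.mark D.e₂
      · subst hft
        left
        have h : (D.glueEdge T₁ T₂).flip = ⟨Sum.inr (T₂.mark D.e₂), hf⟩ :=
          Subtype.ext (D.glue_inv_left T₁ T₂)
        rw [hflip, h, OrdPart.toPart_compl]
      · have hf' : T₂.graph.inv f ≠ f := fun h => hf ((D.glue_inv_inr hft).trans
          (congrArg Sum.inr h))
        exact Or.inr (Or.inr ⟨_, ⟨⟨f, hf'⟩, rfl⟩, (congrArg OrdPart.toPart
          (D.part_inrEdge T₁ T₂ ⟨f, hf'⟩)).symm⟩)
  · rintro (rfl | ⟨_, ⟨f, rfl⟩, rfl⟩ | ⟨_, ⟨f, rfl⟩, rfl⟩)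
    · exact ⟨D.glueEdge T₁ T₂, by rw [part_glueEdge]⟩
    · exact ⟨D.inlEdge T₁ T₂ f, congrArg OrdPart.toPart (D.part_inlEdge T₁ T₂ f)⟩
    · exact ⟨D.inrEdge T₁ T₂ f, congrArg OrdPart.toPart (D.part_inrEdge T₁ T₂ f)⟩

variable (k : Type w) [CommRing k]

theorem resHom_monomialClsErase :
    D.resHom k ((D.glue T₁ T₂).monomialClsErase k (D.glueEdge T₁ T₂).edge) =
      T₁.monomialCls k ⊗ₜ[k] T₂.monomialCls k := by
  classical
  have hnot : D.part.toPart ∉ (T₁.edgeParts.image D.extPart₁ ∪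
      T₂.edgeParts.image D.extPart₂) := by
    simp only [Finset.mem_union, Finset.mem_image]
    rintro (⟨ρ, -, h⟩ | ⟨ρ, -, h⟩)
    · exact D.extPart₁_ne ρ h
    · exact D.extPart₂_ne ρ h
  have hdis : Disjoint (T₁.edgeParts.image D.extPart₁)
      (T₂.edgeParts.image D.extPart₂) := by
    rw [Finset.disjoint_left]
    simp only [Finset.mem_image]
    rintro _ ⟨ρ, -, rfl⟩ ⟨σ, -, h⟩
    exact D.extPart₁_ne_extPart₂ ρ σ h.symm
  have he := D.edgeParts_glue T₁ T₂
  rw [STree.monomialClsErase_eq, part_glueEdge]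
  have he' : ((D.glue T₁ T₂).edgeParts.erase D.part.toPart) =
      T₁.edgeParts.image D.extPart₁ ∪
        T₂.edgeParts.image D.extPart₂ := by
    rw [he]
    exact Finset.erase_insert hnot
  refine (congrArg (fun s => D.resHom k (∏ ρ ∈ s, partCls k ρ)) he').trans ?_
  rw [Finset.prod_union hdis, map_mul, map_prod, map_prod,
    Finset.prod_image extPart₁_injective.injOn, Finset.prod_image extPart₂_injective.injOn]
  simp only [resHom_extPart₁, resHom_extPart₂]
  have e1 := map_prod (Algebra.TensorProduct.includeLeft : _ →ₐ[k] Coh k S₁ ⊗[k] Coh k S₂)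
    (partCls k) T₁.edgeParts
  have e2 := map_prod (Algebra.TensorProduct.includeRight : _ →ₐ[k] Coh k S₁ ⊗[k] Coh k S₂)
    (partCls k) T₂.edgeParts
  refine (congrArg₂ (· * ·) e1.symm e2.symm).trans ?_
  rw [Algebra.TensorProduct.includeLeft_apply, Algebra.TensorProduct.includeRight_apply,
    Algebra.TensorProduct.tmul_mul_tmul, one_mul, mul_one, STree.monomialCls_eq,
    STree.monomialCls_eq]

theorem monomialCls_glue : (D.glue T₁ T₂).monomialCls k =
    (D.glue T₁ T₂).monomialClsErase k (D.glueEdge T₁ T₂).edge * cls k D.part := by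
  classical
  have h : D.part.toPart ∈ (D.glue T₁ T₂).edgeParts :=
    STree.mem_edgeParts.2 ⟨D.glueEdge T₁ T₂, by rw [part_glueEdge]⟩
  rw [STree.monomialClsErase_eq, part_glueEdge, STree.monomialCls_eq, ← partCls_toPart]
  exact (Finset.prod_erase_mul _ _ h).symm

variable {k}

theorem exists_pushCoh : ∃ g : Coh k S₁ ⊗[k] Coh k S₂ →ₗ[k] Coh k S,
    ∀ a, g (D.resHom k a) = a * cls k D.part :=
  exists_linearMap_of_surjective (r := (D.resHom k).toLinearMap) resHom_surjective
    (LinearMap.mulRight k (cls k D.part)) fun _ ha => mul_cls_part_eq_zero ha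

variable (k) in
/-- The push-forward in cohomology: multiplication by the generator of the edge after a lift. -/
def pushCoh : Coh k S₁ ⊗[k] Coh k S₂ →ₗ[k] Coh k S := D.exists_pushCoh.choose

theorem pushCoh_resHom (a : Coh k S) : D.pushCoh k (D.resHom k a) = a * cls k D.part :=
  D.exists_pushCoh.choose_spec a

variable (k) in
/-- The isomorphism of homology with cohomology, if there are trees. -/
def _root_.PaintedTrees.hlgEquiv {S : PaintedSet.{u}} (T₀ : STree S) : Hlg k S ≃ₗ[k] Coh k S :=
  LinearEquiv.ofBijective (toCoh k S) ⟨toCoh_injective, toCoh_surjective T₀⟩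

variable (k) in
/-- The push-forward in homology for a one-edge tree. -/
def glueHom : Hlg k S₁ ⊗[k] Hlg k S₂ →ₗ[k] Hlg k S :=
  (hlgEquiv k (D.glue D.fstCorolla D.swap.fstCorolla)).symm.toLinearMap ∘ₗ D.pushCoh k ∘ₗ
    TensorProduct.map (toCoh k S₁) (toCoh k S₂)

theorem toCoh_glueHom (x : Hlg k S₁ ⊗[k] Hlg k S₂) : toCoh k S (D.glueHom k x) =
    D.pushCoh k (TensorProduct.map (toCoh k S₁) (toCoh k S₂) x) :=
  (hlgEquiv k (D.glue D.fstCorolla D.swap.fstCorolla)).apply_symm_apply _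

theorem glueHom_mu : D.glueHom k (mu k T₁ ⊗ₜ[k] mu k T₂) = mu k (D.glue T₁ T₂) :=
  toCoh_injective (by
    rw [toCoh_glueHom, TensorProduct.map_tmul, toCoh_mu, toCoh_mu, toCoh_mu,
      ← resHom_monomialClsErase, pushCoh_resHom, monomialCls_glue])

theorem map_toCoh_act (b : Coh k S₁ ⊗[k] Coh k S₂) (x : Hlg k S₁ ⊗[k] Hlg k S₂) :
    TensorProduct.map (toCoh k S₁) (toCoh k S₂)
      (TensorProduct.map₂ (hlgAct k S₁).toLinearMap (hlgAct k S₂).toLinearMap b x) =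
    b * TensorProduct.map (toCoh k S₁) (toCoh k S₂) x := by
  induction b with
  | zero => simp
  | add b c hb hc => rw [map_add, LinearMap.add_apply, map_add, hb, hc, add_mul]
  | tmul a c =>
    induction x with
    | zero => simp
    | add x y hx hy => rw [map_add, map_add, hx, hy, map_add, mul_add]
    | tmul x y =>
      rw [TensorProduct.map₂_apply_tmul, TensorProduct.map_tmul, TensorProduct.map_tmul,
        TensorProduct.map_tmul, Algebra.TensorProduct.tmul_mul_tmul]
      exact congrArg₂ (· ⊗ₜ[k] ·) (toCoh_hlgAct a x) (toCoh_hlgAct c y)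

/-- The projection formula. -/
theorem glueHom_act (a : Coh k S) (x : Hlg k S₁ ⊗[k] Hlg k S₂) :
    D.glueHom k (TensorProduct.map₂ (hlgAct k S₁).toLinearMap (hlgAct k S₂).toLinearMap
      (D.resHom k a) x) = hlgAct k S a (D.glueHom k x) :=
  toCoh_injective (by
    rw [toCoh_hlgAct, toCoh_glueHom, toCoh_glueHom, map_toCoh_act]
    obtain ⟨b, hb⟩ := D.resHom_surjective (TensorProduct.map (toCoh k S₁) (toCoh k S₂) x)
    rw [← hb, ← map_mul, pushCoh_resHom, pushCoh_resHom, mul_assoc])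

end OneEdge

/-! ### Change of labels -/

section Relabel

variable {S S' : PaintedSet.{u}} (φ : S.Iso S')

theorem OrdPart.mem_map {A : OrdPart S} {s : S} : φ.toEquiv s ∈ (A.map φ).1 ↔ s ∈ A.1 :=
  φ.toEquiv.injective.mem_set_image

theorem OrdPart.map_eq_iff {A : OrdPart S} {B : OrdPart S'} :
    A.map φ = B ↔ ∀ s, s ∈ A.1 ↔ φ.toEquiv s ∈ B.1 := by
  constructor
  · rintro rfl _
    exact (OrdPart.mem_map φ).symm
  · intro h
    refine Subtype.ext (Set.ext fun t => ?_)
    obtain ⟨s, rfl⟩ := φ.toEquiv.surjective t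
    rw [← h]
    exact OrdPart.mem_map φ

theorem OrdPart.map_compl (A : OrdPart S) : A.compl.map φ = (A.map φ).compl :=
  (OrdPart.map_eq_iff φ).2 fun _ => not_congr (OrdPart.mem_map φ).symm

theorem OrdPart.map_injective : Function.Injective (OrdPart.map φ) := fun A B h =>
  Subtype.ext (Set.ext fun s => by rw [← OrdPart.mem_map φ, h, OrdPart.mem_map])

theorem OrdPart.map_surjective : Function.Surjective (OrdPart.map φ) := by
  intro B
  let ψ : S'.Iso S := ⟨φ.toEquiv.symm, fun t => by
    rw [← φ.white_iff, Equiv.apply_symm_apply]⟩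
  refine ⟨B.map ψ, (OrdPart.map_eq_iff φ).2 fun s => ?_⟩
  have h := OrdPart.mem_map ψ (A := B) (s := φ.toEquiv s)
  have h' : ψ.toEquiv (φ.toEquiv s) = s := φ.toEquiv.symm_apply_apply s
  rwa [h'] at h

/-- Transport of unordered partitions along a bijection of painted sets. -/
def Part.map : Part S → Part S' :=
  Quotient.map' (OrdPart.map φ) (by
    rintro A B (rfl | rfl)
    · exact Or.inl rfl
    · exact Or.inr (OrdPart.map_compl φ _))

theorem Part.map_toPart (A : OrdPart S) : A.toPart.map φ = (A.map φ).toPart := rfl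

theorem Part.map_injective : Function.Injective (Part.map φ) := by
  intro ρ σ h
  obtain ⟨A, rfl⟩ := OrdPart.toPart_surjective ρ
  obtain ⟨B, rfl⟩ := OrdPart.toPart_surjective σ
  rw [Part.map_toPart, Part.map_toPart, OrdPart.toPart_eq_iff, ← OrdPart.map_compl] at h
  exact OrdPart.toPart_eq_iff.2 (h.imp (fun h => OrdPart.map_injective φ h)
    fun h => OrdPart.map_injective φ h)

theorem Balanced.comp_map {B : Type*} [AddCommGroup B] {Θ : OrdPart S' → B} (h : Balanced Θ) :
    Balanced fun A => Θ (A.map φ) where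
  symm A := by rw [OrdPart.map_compl, h.symm]
  rel i j p q hall := by
    have key : ∀ i j p q : S, ∑ A ∈ sep i j p q, Θ (A.map φ) =
        ∑ A ∈ sep (φ.toEquiv i) (φ.toEquiv j) (φ.toEquiv p) (φ.toEquiv q), Θ A := by
      intro i j p q
      refine Finset.sum_bij (fun A _ => A.map φ) (fun A hA => ?_)
        (fun A _ B _ h => OrdPart.map_injective φ h) (fun B hB => ?_) (fun _ _ => rfl)
      · rw [mem_sep] at hA ⊢
        simpa only [OrdPart.mem_map] using hA
      · obtain ⟨A, rfl⟩ := OrdPart.map_surjective φ B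
        refine ⟨A, ?_, rfl⟩
        rw [mem_sep] at hB ⊢
        simpa only [OrdPart.mem_map] using hB
    rw [key, key]
    refine h.rel _ _ _ _ ?_
    simpa only [Allowed, φ.toEquiv.injective.ne_iff, φ.white_iff] using hall

theorem crosses_map {A B : OrdPart S} : Crosses (A.map φ).1 (B.map φ).1 ↔ Crosses A.1 B.1 := by
  simp only [Crosses, Set.Nonempty, φ.toEquiv.surjective.exists, Set.mem_inter_iff,
    Set.mem_compl_iff, OrdPart.mem_map]

variable (k : Type w) [CommRing k]

theorem exists_cohMap : ∃ f : Coh k S →ₐ[k] Coh k S', ∀ A, f (cls k A) = cls k (A.map φ) :=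
  exists_coh_lift (Θ := fun A => cls k (A.map φ)) (balanced_cls.comp_map φ)
    fun _ _ h => cls_mul_cls_of_crosses ((crosses_map φ).2 h)

/-- The homomorphism of cohomology rings induced by a bijection of painted sets. -/
def cohMap : Coh k S →ₐ[k] Coh k S' := (exists_cohMap φ k).choose

@[simp] theorem cohMap_cls (A : OrdPart S) : cohMap φ k (cls k A) = cls k (A.map φ) :=
  (exists_cohMap φ k).choose_spec A

theorem cohMap_partCls (ρ : Part S) : cohMap φ k (partCls k ρ) = partCls k (ρ.map φ) := by
  obtain ⟨A, rfl⟩ := OrdPart.toPart_surjective ρ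
  exact cohMap_cls φ k A

theorem cohMap_prod (F : Finset (Part S)) [DecidableEq (Part S')] :
    cohMap φ k (∏ ρ ∈ F, partCls k ρ) = ∏ ρ ∈ F.image (Part.map φ), partCls k ρ := by
  rw [map_prod, Finset.prod_image (Part.map_injective φ).injOn]
  exact Finset.prod_congr rfl fun ρ _ => cohMap_partCls φ k ρ

namespace STree

variable (T : STree S')

theorem part_relabel (f : T.EdgeFlag) :
    ((T.relabel φ).part f).map φ = T.part f :=
  (OrdPart.map_eq_iff φ).2 fun _ => Iff.rfl

theorem image_edgeParts_relabel [DecidableEq (Part S')] :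
    (T.relabel φ).edgeParts.image (Part.map φ) = T.edgeParts := by
  ext ρ
  simp only [Finset.mem_image, mem_edgeParts]
  constructor
  · rintro ⟨_, ⟨f, rfl⟩, rfl⟩
    exact ⟨f, (congrArg OrdPart.toPart (T.part_relabel φ f)).symm⟩
  · rintro ⟨f, rfl⟩
    exact ⟨_, ⟨f, rfl⟩, congrArg OrdPart.toPart (T.part_relabel φ f)⟩

theorem cohMap_monomialCls :
    cohMap φ k ((T.relabel φ).monomialCls k) = T.monomialCls k := by
  classical
  rw [monomialCls_eq, cohMap_prod, image_edgeParts_relabel, monomialCls_eq]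

theorem branch_relabel (v : T.graph.V) (s : S) :
    (T.relabel φ).branch v s = T.branch v (φ.toEquiv s) :=
  branch_eq_iff.2 (branch_eq_iff.1 (rfl : T.branch v (φ.toEquiv s) = _))

theorem map_ext_relabel (v : T.graph.V) (α : OrdPart (T.graph.flagsAt v)) :
    ((T.relabel φ).splitting.ext v α).map φ = T.splitting.ext v α :=
  (OrdPart.map_eq_iff φ).2 fun s => by
    change (T.relabel φ).branch v s ∈ α.1 ↔ T.branch v (φ.toEquiv s) ∈ α.1
    rw [branch_relabel]
    rfl

end STree

end Relabel

/-! ### Contractions -/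

/-- The conditions on contractions that are used below: the flags that do not come from flags of
the target are halves of edges whose ends are glued together. -/
structure GMap.IsCollapse {G H : Graph.{u}} (c : GMap G H) : Prop extends c.IsCompat where
  range_or : ∀ g, (∃ f, c.flag f = g) ∨
    (G.inv g ≠ g ∧ c.vert (G.bd g) = c.vert (G.bd (G.inv g)))

theorem GMap.IsIso.isCollapse {G H : Graph.{u}} {c : GMap G H} (h : c.IsIso) : c.IsCollapse :=
  ⟨h.toIsCompat, fun g => Or.inl (h.flag_surj g)⟩

theorem GMap.IsEdgeContraction.isCollapse {G H : Graph.{u}} {c : GMap G H} {e : G.F}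
    (h : c.IsEdgeContraction e) : c.IsCollapse :=
  ⟨h.toIsCompat, fun g => by
    by_cases hg : g ≠ e ∧ g ≠ G.inv e
    · exact Or.inl ((h.flag_range g).2 hg)
    right
    have h1 : c.vert (G.bd e) = c.vert (G.bd (G.inv e)) :=
      (h.vert_eq _ _).2 (Or.inr (Or.inl ⟨rfl, rfl⟩))
    by_cases hge : g = e
    · subst hge
      exact ⟨h.edge, h1⟩
    · have hg' : g = G.inv e := by
        by_contra hg'
        exact hg ⟨hge, hg'⟩
      subst hg'
      rw [G.inv_inv]
      exact ⟨h.edge.symm, h1.symm⟩⟩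

theorem GMap.IsCollapse.comp {G H K : Graph.{u}} {c : GMap G H} {d : GMap H K}
    (hc : c.IsCollapse) (hd : d.IsCollapse) : (c.comp d).IsCollapse where
  flag_inj := hc.flag_inj.comp hd.flag_inj
  flag_inv f := by simp [GMap.comp, hc.flag_inv, hd.flag_inv]
  vert_bd f := by simp [GMap.comp, hc.vert_bd, hd.vert_bd]
  white_iff f := by simp [GMap.comp, hc.white_iff, hd.white_iff]
  range_or g := by
    rcases hc.range_or g with ⟨g, rfl⟩ | ⟨h1, h2⟩
    · rcases hd.range_or g with ⟨f, rfl⟩ | ⟨h1, h2⟩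
      · exact Or.inl ⟨f, rfl⟩
      · refine Or.inr ⟨fun h => h1 (hc.flag_inj ((hc.flag_inv g).trans h)), ?_⟩
        change d.vert (c.vert _) = d.vert (c.vert _)
        rw [← hc.flag_inv, hc.vert_bd, hc.vert_bd, h2]
    · exact Or.inr ⟨h1, congrArg d.vert h2⟩

theorem IsContraction.isCollapse {σ τ : StableTree.{u}} {c : GMap σ.graph τ.graph}
    (h : IsContraction c) : c.IsCollapse := by
  induction h with
  | iso c h => exact h.isCollapse
  | edge c e h => exact h.isCollapse
  | comp c d _ _ hc hd => exact hc.comp hd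

theorem GMap.IsCollapse.reach {G H : Graph.{u}} {c : GMap G H} (hc : c.IsCollapse) {x : H.F}
    {v w : G.V} (h : G.Reach {c.flag x} v w) : H.Reach {x} (c.vert v) (c.vert w) := by
  induction h with
  | refl => exact .refl
  | tail _ hs ih =>
    obtain ⟨g, h1, h2, rfl, rfl⟩ := hs
    rcases hc.range_or g with ⟨y, rfl⟩ | ⟨-, h3⟩
    · rw [← hc.flag_inv] at h2 ⊢
      exact ih.tail ⟨y, fun h => h1 (congrArg c.flag h), fun h => h2 (congrArg c.flag h),
        (hc.vert_bd y).symm, (hc.vert_bd _).symm⟩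
    · rwa [← h3]

namespace STree

variable {S : PaintedSet.{u}} (T : STree S) {G : Graph.{u}} (hG : G.IsStable)
  {c : GMap G T.graph} (hc : c.IsCollapse)

/-- The tree that is contracted to a given `S`-tree, with the same labels of the tails. -/
def pullback : STree S where
  graph := G
  stable := hG
  mark s := c.flag (T.mark s)
  mark_inj := hc.flag_inj.comp T.mark_inj
  mark_tail f := by
    constructor
    · intro hf
      obtain ⟨y, rfl⟩ := (hc.range_or f).resolve_right fun h => h.1 hf
      obtain ⟨s, rfl⟩ := (T.mark_tail y).1 (hc.flag_inj ((hc.flag_inv y).trans hf))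
      exact ⟨s, rfl⟩
    · rintro ⟨s, rfl⟩
      rw [← hc.flag_inv, (T.mark_tail _).2 ⟨s, rfl⟩]
  mark_white s := (hc.white_iff _).trans (T.mark_white s)

variable {T}

/-- An edge of the contracted tree as an edge of the original one. -/
def pullbackEdge (f : T.EdgeFlag) : (T.pullback hG hc).EdgeFlag :=
  ⟨c.flag f.1, fun h => f.2 (hc.flag_inj ((hc.flag_inv f.1).trans h))⟩

theorem part_pullbackEdge (f : T.EdgeFlag) :
    (T.pullback hG hc).part (pullbackEdge hG hc f) = T.part f := by
  have himp : ∀ f s, s ∈ ((T.pullback hG hc).part (pullbackEdge hG hc f)).1 →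
      s ∈ (T.part f).1 := by
    intro f s hs
    have h := hc.reach hs
    have h1 : c.vert ((T.pullback hG hc).graph.bd (pullbackEdge hG hc f).1) = T.graph.bd f.1 :=
      hc.vert_bd f.1
    have h2 : c.vert ((T.pullback hG hc).graph.bd ((T.pullback hG hc).mark s)) =
      T.graph.bd (T.mark s) := hc.vert_bd _
    rwa [h1, h2] at h
  have hflip : (pullbackEdge hG hc f).flip = pullbackEdge hG hc f.flip :=
    Subtype.ext (hc.flag_inv f.1).symm
  exact Subtype.ext (Set.ext fun s => mem_part_iff_of_imp (π := fun s => s) (himp f)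
    (fun s hs => himp f.flip s (by rwa [← hflip])) s)

theorem edgeParts_subset_pullback : T.edgeParts ⊆ (T.pullback hG hc).edgeParts := by
  intro ρ hρ
  obtain ⟨f, rfl⟩ := mem_edgeParts.1 hρ
  exact mem_edgeParts.2 ⟨pullbackEdge hG hc f, by rw [part_pullbackEdge]⟩

theorem behind_pullback (x : T.graph.F) :
    (T.pullback hG hc).behind (c.flag x) = T.behind x := by
  rcases tail_or_edge x with ⟨s, rfl⟩ | hx
  · exact ((T.pullback hG hc).behind_mark s).trans (T.behind_mark s).symm
  · have h1 := (T.pullback hG hc).behind_edge (pullbackEdge hG hc ⟨x, hx⟩)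
    have hflip : (pullbackEdge hG hc ⟨x, hx⟩).flip =
      pullbackEdge hG hc (EdgeFlag.flip (T := T) ⟨x, hx⟩) := Subtype.ext (hc.flag_inv x).symm
    rw [hflip, part_pullbackEdge] at h1
    exact h1.trans (T.behind_edge ⟨x, hx⟩).symm

theorem branch_pullback {w : G.V} {s : S}
    (h : G.bd (c.flag (T.branch (c.vert w) s).1) = w) :
    ((T.pullback hG hc).branch w s).1 = c.flag (T.branch (c.vert w) s).1 := by
  have h1 : s ∈ (T.pullback hG hc).behind (c.flag (T.branch (c.vert w) s).1) := by
    rw [behind_pullback]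
    exact branch_eq_iff.1 rfl
  exact congrArg Subtype.val (branch_eq_iff (T := T.pullback hG hc)
    (x := ⟨c.flag (T.branch (c.vert w) s).1, h⟩) |>.2 h1)

/-- A vertex at which nothing is contracted contributes the same partitions to both trees. -/
theorem ext_flagIso (w : G.V) (hr : ∀ f, G.bd f = w → ∃ f', c.flag f' = f)
    (hi : ∀ w', c.vert w' = c.vert w → w' = w) (A : OrdPart (T.graph.flagsAt (c.vert w))) :
    (T.pullback hG hc).splitting.ext w (A.map (hc.flagIso w hr hi)) =
      T.splitting.ext (c.vert w) A := by
  refine Subtype.ext (Set.ext fun s => ?_)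
  change (T.pullback hG hc).branch w s ∈ (A.map (hc.flagIso w hr hi)).1 ↔
    T.branch (c.vert w) s ∈ A.1
  have h1 : G.bd (c.flag (T.branch (c.vert w) s).1) = w :=
    hi _ ((hc.vert_bd _).trans (T.branch (c.vert w) s).2)
  have h2 : (T.pullback hG hc).branch w s =
      (hc.flagIso w hr hi).toEquiv (T.branch (c.vert w) s) :=
    Subtype.ext (branch_pullback hG hc h1)
  rw [h2]
  exact OrdPart.mem_map _

theorem edgeParts_pullback_of_isIso (h : c.IsIso) :
    (T.pullback hG hc).edgeParts = T.edgeParts := by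
  refine Finset.Subset.antisymm (fun ρ hρ => ?_) (edgeParts_subset_pullback hG hc)
  obtain ⟨⟨f, hf⟩, rfl⟩ := mem_edgeParts.1 hρ
  obtain ⟨y, rfl⟩ := h.flag_surj f
  have hy : T.graph.inv y ≠ y := fun hy => hf ((hc.flag_inv y).symm.trans (congrArg c.flag hy))
  exact mem_edgeParts.2 ⟨⟨y, hy⟩, by rw [← part_pullbackEdge hG hc ⟨y, hy⟩]; rfl⟩

section EdgeContraction

variable {e : G.F} (he : c.IsEdgeContraction e)

/-- The contracted edge. -/
def contractedEdge : (T.pullback hG he.isCollapse).EdgeFlag := ⟨e, he.edge⟩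

theorem edgeParts_pullback_of_isEdgeContraction [DecidableEq (Part S)] :
    (T.pullback hG he.isCollapse).edgeParts =
      Insert.insert ((T.pullback hG he.isCollapse).part (contractedEdge hG he)).toPart
        T.edgeParts := by
  refine Finset.Subset.antisymm (fun ρ hρ => ?_) (Finset.insert_subset
    (mem_edgeParts.2 ⟨_, rfl⟩) (edgeParts_subset_pullback hG _))
  obtain ⟨⟨f, hf⟩, rfl⟩ := mem_edgeParts.1 hρ
  rw [Finset.mem_insert]
  by_cases h1 : f = e
  · have : (⟨f, hf⟩ : (T.pullback hG he.isCollapse).EdgeFlag) = contractedEdge hG he :=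
      Subtype.ext h1
    exact Or.inl (by rw [this])
  by_cases h2 : f = G.inv e
  · left
    have : (⟨f, hf⟩ : (T.pullback hG he.isCollapse).EdgeFlag) =
      (contractedEdge hG he).flip := Subtype.ext h2
    rw [this, part_flip, OrdPart.toPart_compl]
  · right
    obtain ⟨y, rfl⟩ := (he.flag_range f).2 ⟨h1, h2⟩
    have hy : T.graph.inv y ≠ y := fun hy => hf ((he.flag_inv y).symm.trans (congrArg c.flag hy))
    exact mem_edgeParts.2 ⟨⟨y, hy⟩, by rw [← part_pullbackEdge hG he.isCollapse ⟨y, hy⟩]; rfl⟩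

theorem part_contractedEdge_notMem :
    ((T.pullback hG he.isCollapse).part (contractedEdge hG he)).toPart ∉ T.edgeParts := by
  intro h
  obtain ⟨f, hf⟩ := toPart_mem_edgeParts.1 h
  rw [← part_pullbackEdge hG he.isCollapse] at hf
  exact ((he.flag_range e).1 ⟨f.1, congrArg Subtype.val (part_injective hf)⟩).1 rfl

theorem side_of_bd_eq {x : T.graph.flagsAt (c.vert (G.bd e))} (h : G.bd (c.flag x.1) = G.bd e) :
    (he.oneEdge hG).side x = (⟨c.flag x.1, h⟩ : {f // G.bd f = G.bd e}) :=
  OneEdge.side_eq_of_toSum (dif_pos h)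

theorem side_of_bd_ne {x : T.graph.flagsAt (c.vert (G.bd e))} (h : G.bd (c.flag x.1) ≠ G.bd e) :
    (he.oneEdge hG).side x = (⟨e, rfl⟩ : {f // G.bd f = G.bd e}) :=
  congrArg (Sum.elim id fun _ => (he.oneEdge hG).e₁) (dif_neg h)

theorem swap_side_of_bd_eq {x : T.graph.flagsAt (c.vert (G.bd e))}
    (h : G.bd (c.flag x.1) = G.bd e) :
    (he.oneEdge hG).swap.side x = (⟨G.inv e, rfl⟩ : {f // G.bd f = G.bd (G.inv e)}) :=
  congrArg (fun y => (Sum.swap y).elim id fun _ => (he.oneEdge hG).e₂) (dif_pos h)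

theorem swap_side_of_bd_ne {x : T.graph.flagsAt (c.vert (G.bd e))}
    (h : G.bd (c.flag x.1) ≠ G.bd e) (h' : G.bd (c.flag x.1) = G.bd (G.inv e)) :
    (he.oneEdge hG).swap.side x = (⟨c.flag x.1, h'⟩ : {f // G.bd f = G.bd (G.inv e)}) :=
  OneEdge.side_eq_of_toSum (congrArg Sum.swap (dif_neg h))

theorem mem_behind_flag_branch (v : T.graph.V) (s : S) :
    s ∈ (T.pullback hG hc).behind (c.flag (T.branch v s).1) := by
  rw [behind_pullback]
  exact branch_eq_iff.1 rfl

/-- The flag at one end of the edge `x` behind which `s` lies is `x`, if `s` lies behind another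
flag at the other end. -/
theorem mem_behind_of_ne {x y : T.graph.F} (hx : T.graph.inv x ≠ x)
    (hy : T.graph.bd y = T.graph.bd (T.graph.inv x)) (hne : y ≠ T.graph.inv x) {s : S}
    (hs : s ∈ T.behind y) : s ∈ T.behind x := by
  by_contra h
  have h' : s ∈ T.behind (T.graph.inv x) := by rwa [T.behind_inv hx]
  exact hne (T.behind_unique hy hs h')

/-- The one-edge tree at the new vertex knows behind which flag at an end of the contracted edge a
tail lies. -/
theorem side_branch (s : S) : (he.oneEdge hG).side (T.branch (c.vert (G.bd e)) s) =
    (T.pullback hG he.isCollapse).branch (G.bd e) s := by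
  have hs := mem_behind_flag_branch hG he.isCollapse (c.vert (G.bd e)) s
  have hor : G.bd (c.flag (T.branch (c.vert (G.bd e)) s).1) ≠ G.bd e →
      G.bd (c.flag (T.branch (c.vert (G.bd e)) s).1) = G.bd (G.inv e) := fun hx => by
    rcases (he.vert_eq _ _).1 ((he.vert_bd _).trans (T.branch (c.vert (G.bd e)) s).2) with h | h | h
    · exact absurd h hx
    · exact absurd h.1 hx
    · exact h.1
  have hr := (he.flag_range _).1 ⟨(T.branch (c.vert (G.bd e)) s).1, rfl⟩
  by_cases h : G.bd (c.flag (T.branch (c.vert (G.bd e)) s).1) = G.bd e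
  · exact (side_of_bd_eq hG he h).trans
      (branch_eq_iff (T := T.pullback hG he.isCollapse) (v := G.bd e) |>.2 hs).symm
  · exact (side_of_bd_ne hG he h).trans
      (branch_eq_iff (T := T.pullback hG he.isCollapse) (v := G.bd e) |>.2
        (mem_behind_of_ne (T := T.pullback hG he.isCollapse) he.edge (hor h) hr.2 hs)).symm

theorem swap_side_branch (s : S) : (he.oneEdge hG).swap.side (T.branch (c.vert (G.bd e)) s) =
    (T.pullback hG he.isCollapse).branch (G.bd (G.inv e)) s := by
  have hs := mem_behind_flag_branch hG he.isCollapse (c.vert (G.bd e)) s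
  have hor : G.bd (c.flag (T.branch (c.vert (G.bd e)) s).1) ≠ G.bd e →
      G.bd (c.flag (T.branch (c.vert (G.bd e)) s).1) = G.bd (G.inv e) := fun hx => by
    rcases (he.vert_eq _ _).1 ((he.vert_bd _).trans (T.branch (c.vert (G.bd e)) s).2) with h | h | h
    · exact absurd h hx
    · exact absurd h.1 hx
    · exact h.1
  have hr := (he.flag_range _).1 ⟨(T.branch (c.vert (G.bd e)) s).1, rfl⟩
  by_cases h : G.bd (c.flag (T.branch (c.vert (G.bd e)) s).1) = G.bd e
  · refine (swap_side_of_bd_eq hG he h).trans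
      (branch_eq_iff (T := T.pullback hG he.isCollapse) (v := G.bd (G.inv e)) |>.2
        (mem_behind_of_ne (T := T.pullback hG he.isCollapse) (Graph.inv_ne he.edge) ?_ ?_ hs)).symm
    · exact h.trans (congrArg G.bd (G.inv_inv e)).symm
    · exact fun h' => hr.1 (h'.trans (G.inv_inv e))
  · exact (swap_side_of_bd_ne hG he h (hor h)).trans
      (branch_eq_iff (T := T.pullback hG he.isCollapse) (v := G.bd (G.inv e)) |>.2 hs).symm

end EdgeContraction

end STree

/-! ### Cohomology of trees -/

section PiTensorProduct

variable {k : Type*} [CommRing k] {ι : Type*} [Fintype ι] [DecidableEq ι] {A : ι → Type*}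
  [∀ i, CommRing (A i)] [∀ i, Algebra k (A i)]

theorem tprod_eq_prod_singleAlgHom (x : ∀ i, A i) :
    PiTensorProduct.tprod k x = ∏ i, PiTensorProduct.singleAlgHom (R := k) i (x i) := by
  have h : x = ∏ i, Pi.mulSingle i (x i) := (Finset.univ_prod_mulSingle x).symm
  conv_lhs => rw [h]
  exact PiTensorProduct.tprod_prod _ _

/-- The tensor product is the coproduct of commutative algebras. -/
theorem exists_algHom_singleAlgHom {B : Type*} [CommRing B] [Algebra k B] (ψ : ∀ i, A i →ₐ[k] B) :
    ∃ Ψ : PiTensorProduct k A →ₐ[k] B, ∀ i a,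
      Ψ (PiTensorProduct.singleAlgHom (R := k) i a) = ψ i a := by
  refine ⟨PiTensorProduct.liftAlgHom
    ((MultilinearMap.mkPiAlgebra k ι B).compLinearMap fun i => (ψ i).toLinearMap) ?_ ?_, ?_⟩
  · simp
  · intro x y
    simp [Finset.prod_mul_distrib]
  · intro i a
    refine (PiTensorProduct.lift.tprod _).trans ?_
    simp only [MultilinearMap.compLinearMap_apply, MultilinearMap.mkPiAlgebra_apply,
      AlgHom.toLinearMap_apply, MonoidHom.mulSingle_apply]
    rw [Finset.prod_eq_single i]
    · rw [Pi.mulSingle_eq_same]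
    · intro j _ hj
      rw [Pi.mulSingle_eq_of_ne hj, map_one]
    · simp

theorem eq_top_of_singleAlgHom_mem {R : Subalgebra k (PiTensorProduct k A)}
    (h : ∀ i a, PiTensorProduct.singleAlgHom (R := k) i a ∈ R) : R = ⊤ := by
  refine Algebra.eq_top_iff.2 fun z => ?_
  induction z using PiTensorProduct.induction_on with
  | smul_tprod r x =>
    rw [tprod_eq_prod_singleAlgHom]
    exact Subalgebra.smul_mem _ (Subalgebra.prod_mem _ fun i _ => h i (x i)) r
  | add x y hx hy => exact add_mem hx hy

end PiTensorProduct

section Factor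

-- A shortcut that keeps instance synthesis fast.
instance (k : Type w) [CommRing k] (τ : StableTree.{u}) : CommRing (TreeCoh k τ) :=
  PiTensorProduct.instCommRing

variable {k : Type w} [CommRing k] {τ : StableTree.{u}}

theorem tprod_eq_prod_factor (x : ∀ v, Coh k (τ.graph.flagsAt v)) :
    PiTensorProduct.tprod k x = ∏ v, factor k τ v (x v) := by
  classical
  exact tprod_eq_prod_singleAlgHom x

theorem exists_algHom_factor {B : Type*} [CommRing B] [Algebra k B]
    (ψ : ∀ v, Coh k (τ.graph.flagsAt v) →ₐ[k] B) :
    ∃ Ψ : TreeCoh k τ →ₐ[k] B, ∀ v a, Ψ (factor k τ v a) = ψ v a := by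
  classical
  exact exists_algHom_singleAlgHom ψ

theorem treeCoh_algHom_ext {B : Type*} [CommRing B] [Algebra k B] {f g : TreeCoh k τ →ₐ[k] B}
    (h : ∀ v A, f (factor k τ v (cls k A)) = g (factor k τ v (cls k A))) : f = g := by
  classical
  exact PiTensorProduct.algHom_ext fun v =>
    coh_algHom_ext (f := f.comp (factor k τ v)) (g := g.comp (factor k τ v)) (h v)

theorem eq_top_of_factor_mem {R : Subalgebra k (TreeCoh k τ)} (h : ∀ v a, factor k τ v a ∈ R) :
    R = ⊤ := by
  classical
  exact eq_top_of_singleAlgHom_mem h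

end Factor

namespace STree

variable {S S' : PaintedSet.{u}} (T : STree S) (k : Type w) [CommRing k]

/-- The underlying painted stable tree of an `S`-tree. -/
abbrev toStable : StableTree.{u} := ⟨T.graph, T.stable⟩

/-- The inclusions of the cohomology rings of the vertices. -/
def inclusions (v : T.graph.V) : Coh k (T.splitting.X v) →ₐ[k] TreeCoh k T.toStable :=
  factor k T.toStable v

/-- The restriction homomorphism to the cohomology ring of a tree. -/
def treeRes : Coh k S →ₐ[k] TreeCoh k T.toStable :=
  (Splitting.exists_isRes (k := k) (B := TreeCoh k T.toStable) (𝒯 := T.splitting)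
    (T.inclusions k)).choose

theorem isRes_treeRes : T.splitting.IsRes (k := k) (B := TreeCoh k T.toStable)
    (T.inclusions k) (T.treeRes k) :=
  (Splitting.exists_isRes (k := k) (B := TreeCoh k T.toStable) (𝒯 := T.splitting)
    (T.inclusions k)).choose_spec

variable {k}

theorem treeRes_ext (v : T.graph.V) (α : OrdPart (T.graph.flagsAt v)) :
    T.treeRes k (cls k (T.splitting.ext v α)) = factor k T.toStable v (cls k α) :=
  (T.isRes_treeRes k).ext v α

theorem factor_mem_range (v : T.graph.V) (a : Coh k (T.graph.flagsAt v)) :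
    factor k T.toStable v a ∈ (T.treeRes k).range :=
  (T.isRes_treeRes k).range_le v (AlgHom.mem_range_self (T.inclusions k v) a)

theorem treeRes_surjective : Function.Surjective (T.treeRes k) :=
  AlgHom.range_eq_top (T.treeRes k) |>.1 (eq_top_of_factor_mem T.factor_mem_range)

theorem exists_algHom_inclusions {B : Type*} [CommRing B] [Algebra k B]
    (ψ : ∀ v, Coh k (T.splitting.X v) →ₐ[k] B) :
    ∃ Ψ : TreeCoh k T.toStable →ₐ[k] B, ∀ v a, Ψ (T.inclusions k v a) = ψ v a :=
  let ψ' : ∀ v, Coh k (T.graph.flagsAt v) →ₐ[k] B := ψ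
  exists_algHom_factor (τ := T.toStable) ψ'

theorem mem_crossIdeal_of_treeRes_eq_zero {a : Coh k S} (ha : T.treeRes k a = 0) :
    a ∈ T.splitting.crossIdeal k :=
  (T.isRes_treeRes k).mem_crossIdeal (T.exists_algHom_inclusions (k := k)
    (B := Coh k S ⧸ T.splitting.crossIdeal k)) ha

theorem treeRes_relabel (T : STree S') (φ : S.Iso S') (a : Coh k S) :
    (T.relabel φ).treeRes k a = T.treeRes k (cohMap φ k a) := by
  let r : Coh k S →ₐ[k] TreeCoh k (T.relabel φ).toStable := (T.treeRes k).comp (cohMap φ k)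
  have h : (T.relabel φ).splitting.IsRes (k := k) (B := TreeCoh k (T.relabel φ).toStable)
      ((T.relabel φ).inclusions k) r := by
    constructor
    · intro v α
      have h := (cohMap_cls φ k _).trans (congrArg (cls k) (T.map_ext_relabel φ v α))
      exact (congrArg (T.treeRes k) h).trans (T.treeRes_ext v α)
    · intro A A' hA' hc
      obtain ⟨f, rfl⟩ := splitting_isEdge_iff.1 hA'
      change T.treeRes k (cohMap φ k _) = _
      rw [cohMap_cls]
      refine (T.isRes_treeRes k).crosses _ (T.part f) (splitting_isEdge_iff.2 ⟨f, rfl⟩) ?_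
      rw [← T.part_relabel φ f]
      exact (crosses_map φ).2 hc
  exact DFunLike.congr_fun (((T.relabel φ).isRes_treeRes k).unique h) a

end STree

namespace StableTree

variable (τ : StableTree.{u})

/-- The painted set of tails of a tree. -/
def tails : PaintedSet.{u} where
  carrier := {f : τ.graph.F // τ.graph.inv f = f}
  white := {f | f.1 ∈ τ.graph.white}

/-- A painted stable tree, labelled by its own tails. -/
def tree : STree τ.tails where
  graph := τ.graph
  stable := τ.stable
  mark s := s.1
  mark_inj := Subtype.val_injective
  mark_tail f := ⟨fun h => ⟨⟨f, h⟩, rfl⟩, by rintro ⟨s, rfl⟩; exact s.2⟩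
  mark_white _ := Iff.rfl

end StableTree

namespace GMap.IsCollapse

variable {τ' τ : StableTree.{u}} {c : GMap τ'.graph τ.graph} (hc : c.IsCollapse)

/-- The tree `τ'`, labelled by the tails of the tree `τ` to which it is contracted. -/
def tree : STree τ.tails := τ.tree.pullback τ'.stable hc

/-- The bijection of tails given by a contraction. -/
def tailsIso : τ.tails.Iso τ'.tails where
  toEquiv := Equiv.ofBijective
    (fun s : {f : τ.graph.F // τ.graph.inv f = f} =>
      (⟨c.flag s.1, (hc.flag_inv s.1).symm.trans (congrArg c.flag s.2)⟩ :
        {f : τ'.graph.F // τ'.graph.inv f = f}))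
    ⟨fun s t h => Subtype.ext (hc.flag_inj (congrArg Subtype.val h)), fun t => by
      obtain ⟨s, hs⟩ := (hc.tree.mark_tail t.1).1 t.2
      exact ⟨s, Subtype.ext hs⟩⟩
  white_iff s := hc.white_iff s.1

theorem comp_tree {τ'' : StableTree.{u}} {d : GMap τ''.graph τ'.graph} (hd : d.IsCollapse) :
    (hd.comp hc).tree = hd.tree.relabel hc.tailsIso := rfl

theorem edgeParts_subset : τ.tree.edgeParts ⊆ hc.tree.edgeParts :=
  STree.edgeParts_subset_pullback _ _

variable (k : Type w) [CommRing k]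

theorem exists_pull : ∃ g : TreeCoh k τ →ₐ[k] TreeCoh k τ',
    ∀ a, g (τ.tree.treeRes k a) = hc.tree.treeRes k a := by
  have hs := τ.tree.treeRes_surjective (k := k)
  have hk : ∀ a ∈ RingHom.ker (τ.tree.treeRes k), hc.tree.treeRes k a = 0 := by
    intro a ha
    have h := τ.tree.mem_crossIdeal_of_treeRes_eq_zero ha
    refine (Ideal.span_le (I := RingHom.ker (hc.tree.treeRes k))).2 ?_ h
    rintro _ ⟨A, A', hA', hA, rfl⟩
    obtain ⟨f, rfl⟩ := STree.splitting_isEdge_iff.1 hA'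
    refine (hc.tree.isRes_treeRes k).crosses A _ (STree.splitting_isEdge_iff.2
      ⟨STree.pullbackEdge τ'.stable hc f, rfl⟩) ?_
    have h := STree.part_pullbackEdge τ'.stable hc f
    exact (congrArg (fun B => Crosses A.1 B.1) h).mpr hA
  refine ⟨(Ideal.Quotient.liftₐ _ (hc.tree.treeRes k) hk).comp
    (Ideal.quotientKerAlgEquivOfSurjective hs).symm.toAlgHom, fun a => ?_⟩
  have h : (Ideal.quotientKerAlgEquivOfSurjective hs).symm (τ.tree.treeRes k a) =
      Ideal.Quotient.mk _ a := by
    rw [AlgEquiv.symm_apply_eq]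
    rfl
  exact congrArg (Ideal.Quotient.liftₐ _ (hc.tree.treeRes k) hk) h

/-- The pull-back in cohomology along a contraction. -/
def pull : TreeCoh k τ →ₐ[k] TreeCoh k τ' := (hc.exists_pull k).choose

theorem pull_treeRes (a : Coh k τ.tails) :
    hc.pull k (τ.tree.treeRes k a) = hc.tree.treeRes k a := (hc.exists_pull k).choose_spec a

theorem pull_id : (GMap.isIso_id τ.graph).isCollapse.pull k = AlgHom.id k (TreeCoh k τ) := by
  refine AlgHom.ext fun x => ?_
  obtain ⟨a, rfl⟩ := τ.tree.treeRes_surjective x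
  exact pull_treeRes _ k a

theorem pull_comp {τ'' : StableTree.{u}} {d : GMap τ''.graph τ'.graph} (hd : d.IsCollapse) :
    (hd.comp hc).pull k = (hd.pull k).comp (hc.pull k) := by
  refine AlgHom.ext fun x => ?_
  obtain ⟨a, rfl⟩ := τ.tree.treeRes_surjective x
  have h1 := (congrArg (hd.pull k) (hc.pull_treeRes k a)).trans
    ((congrArg (hd.pull k) (STree.treeRes_relabel τ'.tree hc.tailsIso a)).trans
      (hd.pull_treeRes k _))
  exact ((hd.comp hc).pull_treeRes k a).trans
    ((STree.treeRes_relabel hd.tree hc.tailsIso a).trans h1.symm)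

open Classical in
/-- The product of the generators of the contracted edges. -/
def contracted : Coh k τ.tails := ∏ ρ ∈ hc.tree.edgeParts \ τ.tree.edgeParts, partCls k ρ

/-- A generator in the kernel belongs to a partition that crosses an edge. If this edge is not
contracted, the generator is killed in the target as well; otherwise its product with the generator
of this contracted edge vanishes. -/
theorem treeRes_mul_contracted {a : Coh k τ.tails} (ha : hc.tree.treeRes k a = 0) :
    τ.tree.treeRes k (a * hc.contracted k) = 0 := by
  classical
  have h := hc.tree.mem_crossIdeal_of_treeRes_eq_zero ha
  clear ha
  induction h using Submodule.span_induction with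
  | zero => rw [zero_mul, map_zero]
  | add a b _ _ h1 h2 => rw [add_mul, map_add, h1, h2, add_zero]
  | smul c a _ h => rw [smul_eq_mul, mul_assoc, map_mul, h, mul_zero]
  | mem a ha =>
    obtain ⟨A, A', hA', hA, rfl⟩ := ha
    obtain ⟨f, rfl⟩ := STree.splitting_isEdge_iff.1 hA'
    by_cases hf : (hc.tree.part f).toPart ∈ τ.tree.edgeParts
    · obtain ⟨g, hg⟩ := STree.toPart_mem_edgeParts.1 hf
      rw [map_mul, (τ.tree.isRes_treeRes k).crosses A _ (STree.splitting_isEdge_iff.2 ⟨g, hg⟩) hA,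
        zero_mul]
    · have hmem : (hc.tree.part f).toPart ∈ hc.tree.edgeParts \ τ.tree.edgeParts :=
        Finset.mem_sdiff.2 ⟨STree.mem_edgeParts.2 ⟨f, rfl⟩, hf⟩
      rw [contracted, ← Finset.mul_prod_erase _ _ hmem, partCls_toPart, ← mul_assoc,
        cls_mul_cls_of_crosses hA, zero_mul, map_zero]

theorem exists_pushCoh : ∃ g : TreeCoh k τ' →ₗ[k] TreeCoh k τ,
    ∀ a, g (hc.tree.treeRes k a) = τ.tree.treeRes k (a * hc.contracted k) :=
  exists_linearMap_of_surjective (B := TreeCoh k τ') (M := TreeCoh k τ) (r := (hc.tree.treeRes k).toLinearMap)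
    hc.tree.treeRes_surjective
    ((τ.tree.treeRes k).toLinearMap ∘ₗ LinearMap.mulRight k (hc.contracted k))
    fun _ ha => hc.treeRes_mul_contracted k ha

/-- The push-forward in cohomology along a contraction: a lift to the cohomology ring of the set
of tails is multiplied by the generators of the contracted edges. -/
def pushCoh : TreeCoh k τ' →ₗ[k] TreeCoh k τ := (hc.exists_pushCoh k).choose

theorem pushCoh_treeRes (a : Coh k τ.tails) :
    hc.pushCoh k (hc.tree.treeRes k a) = τ.tree.treeRes k (a * hc.contracted k) :=
  (hc.exists_pushCoh k).choose_spec a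

theorem pushCoh_pull_mul (a : TreeCoh k τ) (b : TreeCoh k τ') :
    hc.pushCoh k (hc.pull k a * b) = a * hc.pushCoh k b := by
  obtain ⟨a, rfl⟩ := τ.tree.treeRes_surjective a
  obtain ⟨b, rfl⟩ := hc.tree.treeRes_surjective b
  have h := (hc.tree.treeRes k).map_mul a b
  refine ((congrArg (hc.pushCoh k) ((congrArg (· * hc.tree.treeRes k b)
    (hc.pull_treeRes k a)).trans h.symm)).trans (hc.pushCoh_treeRes k _)).trans ?_
  rw [mul_assoc, map_mul]
  exact congrArg (τ.tree.treeRes k a * ·) (hc.pushCoh_treeRes k b).symm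

theorem pushCoh_id : (GMap.isIso_id τ.graph).isCollapse.pushCoh k = LinearMap.id := by
  refine LinearMap.ext fun x => ?_
  obtain ⟨a, rfl⟩ := τ.tree.treeRes_surjective x
  refine (pushCoh_treeRes (GMap.isIso_id τ.graph).isCollapse k a).trans ?_
  have h : (GMap.isIso_id τ.graph).isCollapse.contracted k = (1 : Coh k τ.tails) := by
    classical
    exact (congrArg (fun F => ∏ ρ ∈ F, partCls k ρ) (Finset.sdiff_self τ.tree.edgeParts)).trans
      Finset.prod_empty
  rw [h, mul_one]
  rfl

/-- The edges contracted by the composition are those contracted by `c`, together with those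
contracted by `d`, up to the change of labels of the tails. -/
theorem contracted_comp {τ'' : StableTree.{u}} {d : GMap τ''.graph τ'.graph} (hd : d.IsCollapse) :
    ∃ N : Coh k τ.tails, cohMap hc.tailsIso k N = hd.contracted k ∧
      (hd.comp hc).contracted k = N * hc.contracted k := by
  classical
  refine ⟨∏ ρ ∈ (hd.comp hc).tree.edgeParts \ hc.tree.edgeParts, partCls k ρ, ?_, ?_⟩
  · rw [cohMap_prod, Finset.image_sdiff _ _ (Part.map_injective _)]
    have h1 := STree.image_edgeParts_relabel hc.tailsIso hd.tree
    have h2 := STree.image_edgeParts_relabel hc.tailsIso τ'.tree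
    rw [comp_tree hc hd, h1]
    exact congrArg (fun F => ∏ ρ ∈ hd.tree.edgeParts \ F, partCls k ρ) h2
  · unfold contracted
    have h := STree.edgeParts_subset_pullback (T := hc.tree) τ''.stable hd
    rw [← Finset.sdiff_union_sdiff_cancel (s := (hd.comp hc).tree.edgeParts) h hc.edgeParts_subset,
      Finset.prod_union]
    rw [Finset.disjoint_left]
    exact fun ρ h1 h2 => (Finset.mem_sdiff.1 h1).2 (Finset.mem_sdiff.1 h2).1

theorem pushCoh_comp {τ'' : StableTree.{u}} {d : GMap τ''.graph τ'.graph} (hd : d.IsCollapse) :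
    (hd.comp hc).pushCoh k = hc.pushCoh k ∘ₗ hd.pushCoh k := by
  refine LinearMap.ext fun x => ?_
  obtain ⟨a, rfl⟩ := (hd.comp hc).tree.treeRes_surjective x
  obtain ⟨N, h1, h2⟩ := hc.contracted_comp k hd
  rw [pushCoh_treeRes, h2, ← mul_assoc]
  refine (hc.pushCoh_treeRes k (a * N)).symm.trans (congrArg (hc.pushCoh k) ?_)
  refine (STree.treeRes_relabel τ'.tree hc.tailsIso _).trans ?_
  rw [map_mul, h1]
  exact (hd.pushCoh_treeRes k _).symm.trans (congrArg (hd.pushCoh k)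
    (STree.treeRes_relabel hd.tree hc.tailsIso a).symm)

end GMap.IsCollapse

/-! ### Values of the pull-back -/

namespace GMap.IsCollapse

variable {τ' τ : StableTree.{u}} {c : GMap τ'.graph τ.graph} (hc : c.IsCollapse)
  (k : Type w) [CommRing k]

theorem pull_factor_cls {v : τ.graph.V} (A : OrdPart (τ.graph.flagsAt v)) :
    hc.pull k (factor k τ v (cls k A)) = hc.tree.treeRes k (cls k (τ.tree.splitting.ext v A)) :=
  (congrArg (hc.pull k) (τ.tree.treeRes_ext v A).symm).trans (hc.pull_treeRes k _)

theorem pull_factor_cls_flagIso (w : τ'.graph.V) (hr : ∀ f, τ'.graph.bd f = w → ∃ f', c.flag f' = f)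
    (hi : ∀ w', c.vert w' = c.vert w → w' = w) (A : OrdPart (τ.graph.flagsAt (c.vert w))) :
    hc.pull k (factor k τ (c.vert w) (cls k A)) =
      factor k τ' w (cls k (A.map (hc.flagIso w hr hi))) :=
  (hc.pull_factor_cls k A).trans ((congrArg (fun B => hc.tree.treeRes k (cls k B))
    (STree.ext_flagIso (T := τ.tree) τ'.stable hc w hr hi A).symm).trans
      (hc.tree.treeRes_ext w _))

theorem pull_factor_flagIso (w : τ'.graph.V) (hr : ∀ f, τ'.graph.bd f = w → ∃ f', c.flag f' = f)
    (hi : ∀ w', c.vert w' = c.vert w → w' = w) (a : Coh k (τ.graph.flagsAt (c.vert w))) :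
    hc.pull k (factor k τ (c.vert w) a) =
      factor k τ' w (cohMap (hc.flagIso w hr hi) k a) := by
  refine DFunLike.congr_fun (coh_algHom_ext (f := (hc.pull k).comp (factor k τ (c.vert w)))
    (g := (factor k τ' w).comp (cohMap (hc.flagIso w hr hi) k)) fun A => ?_) a
  rw [AlgHom.comp_apply, AlgHom.comp_apply, cohMap_cls]
  exact hc.pull_factor_cls_flagIso k w hr hi A

/-- The product of the generators of the contracted edges as a class of the contracted tree. -/
def contractedCls : TreeCoh k τ := τ.tree.treeRes k (hc.contracted k)

theorem pushCoh_pull (b : TreeCoh k τ) :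
    hc.pushCoh k (hc.pull k b) = b * hc.contractedCls k := by
  have h1 := hc.pushCoh_treeRes k 1
  have h2 := (congrArg (hc.pushCoh k) (mul_one (hc.pull k b))).symm.trans
    (hc.pushCoh_pull_mul k b 1)
  have h3 : hc.tree.treeRes k 1 = 1 := (hc.tree.treeRes k).map_one
  rw [one_mul] at h1
  rw [h2]
  exact congrArg (b * ·) ((congrArg (hc.pushCoh k) h3.symm).trans h1)

end GMap.IsCollapse

namespace GMap.IsIso

variable {τ' τ : StableTree.{u}} {c : GMap τ'.graph τ.graph} (h : c.IsIso)
  (k : Type w) [CommRing k]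

theorem pushCoh_pull (b : TreeCoh k τ) :
    h.isCollapse.pushCoh k (h.isCollapse.pull k b) = b := by
  classical
  have h1 : h.isCollapse.contracted k = 1 :=
    (congrArg (fun F => ∏ ρ ∈ F \ τ.tree.edgeParts, partCls k ρ)
      (STree.edgeParts_pullback_of_isIso (T := τ.tree) τ'.stable h.isCollapse h)).trans
      ((congrArg (fun F => ∏ ρ ∈ F, partCls k ρ) (Finset.sdiff_self τ.tree.edgeParts)).trans
        Finset.prod_empty)
  have h2 : h.isCollapse.contractedCls k = 1 :=
    (congrArg (τ.tree.treeRes k) h1).trans (τ.tree.treeRes k).map_one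
  rw [h.isCollapse.pushCoh_pull, h2]
  exact mul_one b

end GMap.IsIso

namespace GMap.IsEdgeContraction

variable {τ' τ : StableTree.{u}} {c : GMap τ'.graph τ.graph} {e : τ'.graph.F}
  (h : c.IsEdgeContraction e)

/-- The partition of the tails given by the contracted edge comes from the one-edge tree at the
new vertex. -/
theorem ext_part : τ.tree.splitting.ext (c.vert (τ'.graph.bd e)) (h.oneEdge τ'.stable).part =
    h.isCollapse.tree.part (STree.contractedEdge τ'.stable h) := by
  refine Subtype.ext (Set.ext fun s => ?_)
  have h1 := OneEdge.side_eq_e₁_iff (D := h.oneEdge τ'.stable)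
    (s := τ.tree.branch (c.vert (τ'.graph.bd e)) s)
  have h2 : (h.oneEdge τ'.stable).side (τ.tree.branch (c.vert (τ'.graph.bd e)) s) =
    h.isCollapse.tree.branch (τ'.graph.bd e) s := STree.side_branch (T := τ.tree) τ'.stable h s
  rw [h2] at h1
  have h3 : s ∈ h.isCollapse.tree.behind e ↔ _ :=
    (STree.branch_eq_iff (T := h.isCollapse.tree) (v := τ'.graph.bd e) (s := s)
      (x := ⟨e, rfl⟩)).symm.trans h1
  have h4 := h.isCollapse.tree.behind_edge (STree.contractedEdge τ'.stable h)
  have h5 : h.isCollapse.tree.behind e =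
      (h.isCollapse.tree.part (STree.contractedEdge τ'.stable h)).1ᶜ :=
    h4.trans (congrArg Subtype.val (h.isCollapse.tree.part_flip _))
  rw [h5, Set.mem_compl_iff] at h3
  exact (not_iff_not.1 h3).symm

variable (k : Type w) [CommRing k]

theorem contractedCls_eq : h.isCollapse.contractedCls k =
    factor k τ (c.vert (τ'.graph.bd e)) (cls k (h.oneEdge τ'.stable).part) := by
  classical
  have h1 : h.isCollapse.tree.edgeParts \ τ.tree.edgeParts =
      {(h.isCollapse.tree.part (STree.contractedEdge τ'.stable h)).toPart} :=
    (congrArg (· \ τ.tree.edgeParts)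
      (STree.edgeParts_pullback_of_isEdgeContraction (T := τ.tree) τ'.stable h)).trans
      (Finset.insert_sdiff_cancel (STree.part_contractedEdge_notMem (T := τ.tree) τ'.stable h))
  have h2 : h.isCollapse.contracted k =
      cls k (h.isCollapse.tree.part (STree.contractedEdge τ'.stable h)) :=
    (congrArg (fun F => ∏ ρ ∈ F, partCls k ρ) h1).trans (Finset.prod_singleton _ _)
  rw [← h.ext_part] at h2
  exact (congrArg (τ.tree.treeRes k) h2).trans (τ.tree.treeRes_ext _ _)

theorem pushCoh_pull (b : TreeCoh k τ) :
    h.isCollapse.pushCoh k (h.isCollapse.pull k b) =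
      b * factor k τ (c.vert (τ'.graph.bd e)) (cls k (h.oneEdge τ'.stable).part) := by
  rw [h.isCollapse.pushCoh_pull, h.contractedCls_eq]

/-- The inclusions of the cohomology rings of the two ends of the contracted edge. -/
def endInclusions (b : Bool) :
    Coh k ((h.oneEdge τ'.stable).splitting.X b) →ₐ[k] TreeCoh k τ' :=
  match b with
  | true => factor k τ' (τ'.graph.bd e)
  | false => factor k τ' (τ'.graph.bd (τ'.graph.inv e))

theorem pull_factor (a : Coh k (τ.graph.flagsAt (c.vert (τ'.graph.bd e)))) :
    h.isCollapse.pull k (factor k τ (c.vert (τ'.graph.bd e)) a) =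
      Algebra.TensorProduct.productMap (factor k τ' (τ'.graph.bd e))
        (factor k τ' (τ'.graph.bd (τ'.graph.inv e))) ((h.oneEdge τ'.stable).resHom k a) := by
  have h1 : (h.oneEdge τ'.stable).splitting.IsRes (k := k) (B := TreeCoh k τ')
      (h.endInclusions k) ((h.isCollapse.pull k).comp (factor k τ (c.vert (τ'.graph.bd e)))) := by
    constructor
    · intro b α
      refine (h.isCollapse.pull_factor_cls k _).trans ?_
      match b with
      | true =>
        have h2 : τ.tree.splitting.ext (c.vert (τ'.graph.bd e))
            ((h.oneEdge τ'.stable).ext₁ α) = h.isCollapse.tree.splitting.ext (τ'.graph.bd e) α :=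
          Subtype.ext (Set.ext fun s => iff_of_eq (congrArg (· ∈ α.1)
            (STree.side_branch (T := τ.tree) τ'.stable h s)))
        exact (congrArg (fun A => h.isCollapse.tree.treeRes k (cls k A)) h2).trans
          (h.isCollapse.tree.treeRes_ext _ _)
      | false =>
        have h2 : τ.tree.splitting.ext (c.vert (τ'.graph.bd e))
            ((h.oneEdge τ'.stable).ext₂ α) =
            h.isCollapse.tree.splitting.ext (τ'.graph.bd (τ'.graph.inv e)) α :=
          Subtype.ext (Set.ext fun s => iff_of_eq (congrArg (· ∈ α.1)
            (STree.swap_side_branch (T := τ.tree) τ'.stable h s)))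
        exact (congrArg (fun A => h.isCollapse.tree.treeRes k (cls k A)) h2).trans
          (h.isCollapse.tree.treeRes_ext _ _)
    · intro A A' hA' hA
      refine (h.isCollapse.pull_factor_cls k A).trans ?_
      have hcr : Crosses (τ.tree.splitting.ext (c.vert (τ'.graph.bd e)) A).1
          (τ.tree.splitting.ext (c.vert (τ'.graph.bd e)) A').1 := Splitting.crosses_ext_iff.2 hA
      refine (h.isCollapse.tree.isRes_treeRes k).crosses _ _ ?_ hcr
      have hedge := STree.splitting_isEdge_iff.2
        ⟨STree.contractedEdge (T := τ.tree) τ'.stable h, h.ext_part.symm⟩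
      rcases OrdPart.toPart_eq_iff.1 (OneEdge.isEdge_iff.1 hA') with rfl | rfl
      · exact hedge
      · exact Splitting.isEdge_compl hedge
  have h2 : (h.oneEdge τ'.stable).splitting.IsRes (k := k) (B := TreeCoh k τ')
      (h.endInclusions k) ((Algebra.TensorProduct.productMap (factor k τ' (τ'.graph.bd e))
        (factor k τ' (τ'.graph.bd (τ'.graph.inv e)))).comp ((h.oneEdge τ'.stable).resHom k)) := by
    constructor
    · intro b α
      rw [AlgHom.comp_apply]
      match b with
      | true =>
        refine (congrArg _ (OneEdge.resHom_ext₁ (D := h.oneEdge τ'.stable) α)).trans ?_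
        exact Algebra.TensorProduct.productMap_left_apply _ _ _
      | false =>
        refine (congrArg _ (OneEdge.resHom_ext₂ (D := h.oneEdge τ'.stable) α)).trans ?_
        exact Algebra.TensorProduct.productMap_right_apply _ _ _
    · intro A A' hA' hA
      rw [AlgHom.comp_apply, OneEdge.isRes_resHom.crosses A A' hA' hA, map_zero]
  exact DFunLike.congr_fun (h1.unique h2) a

end GMap.IsEdgeContraction

/-! ### The functors -/

section Functors

open CategoryTheory

variable {τ' τ : StableTree.{u}} (f : τ' ⟶ τ) (k : Type w) [CommRing k]

theorem Contraction.isCollapse : f.map.IsCollapse := IsContraction.isCollapse f.isContraction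

/-- The pull-back in cohomology along a morphism. -/
def pullHom : TreeCoh k τ →ₐ[k] TreeCoh k τ' := (Contraction.isCollapse f).pull k

variable {k} in
theorem isCohFunctor_pullHom : IsCohFunctor (k := k) (fun D => D.resHom k)
    (fun f => pullHom f k) where
  map_id _ := GMap.IsCollapse.pull_id k
  map_comp g f := GMap.IsCollapse.pull_comp (Contraction.isCollapse f) k (Contraction.isCollapse g)
  iso f _ w A := GMap.IsCollapse.pull_factor_cls_flagIso (Contraction.isCollapse f) k w _ _ A
  edge_other f _ _ w _ _ A :=
    GMap.IsCollapse.pull_factor_cls_flagIso (Contraction.isCollapse f) k w _ _ A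
  edge _ _ hf a := hf.pull_factor k a

end Functors

open CategoryTheory

section Homology

variable (k : Type w) [CommRing k]

/-- A vertex of a stable tree as a tree with one vertex. -/
def StableTree.corollaAt (τ : StableTree.{u}) (v : τ.graph.V) : STree (τ.graph.flagsAt v) :=
  STree.corolla (τ.tree.splitting.three_le v) (by
    by_cases hs : {f | τ.graph.bd f = v ∧ τ.graph.inv f ≠ f}.Subsingleton
    · obtain ⟨f, hf, hv, -⟩ := τ.stable.end_white v hs
      exact ⟨⟨f, hv⟩, hf⟩
    · rw [Set.not_subsingleton_iff] at hs
      obtain ⟨f, hv, hf⟩ := hs.nonempty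
      exact ⟨⟨f, hv⟩, τ.graph.edge_white f hf⟩)

/-- The isomorphism of the homology module of a tree with its cohomology ring. -/
def treeHlgEquiv (τ : StableTree.{u}) : TreeHlg k τ ≃ₗ[k] TreeCoh k τ :=
  PiTensorProduct.congr fun v => hlgEquiv k (τ.corollaAt v)

theorem treeHlgEquiv_tprod {τ : StableTree.{u}} (y : ∀ v, Hlg k (τ.graph.flagsAt v)) :
    treeHlgEquiv k τ (PiTensorProduct.tprod k y) = ∏ v, factor k τ v (toCoh k _ (y v)) :=
  (PiTensorProduct.congr_tprod _ y).trans (tprod_eq_prod_factor _)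

theorem treeHlgEquiv_treeAct {τ : StableTree.{u}} (a : TreeCoh k τ) (x : TreeHlg k τ) :
    treeHlgEquiv k τ (treeAct (fun S => hlgAct k S) τ a x) = a * treeHlgEquiv k τ x := by
  induction a using PiTensorProduct.induction_on with
  | add a b ha hb => rw [map_add, LinearMap.add_apply, map_add, ha, hb, add_mul]
  | smul_tprod r a =>
    induction x using PiTensorProduct.induction_on with
    | add x y hx hy => rw [map_add, map_add, hx, hy, map_add, mul_add]
    | smul_tprod s x =>
      have h : treeHlgEquiv k τ (treeAct (fun S => hlgAct k S) τ (PiTensorProduct.tprod k a)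
          (PiTensorProduct.tprod k x)) =
          PiTensorProduct.tprod k a * treeHlgEquiv k τ (PiTensorProduct.tprod k x) := by
        refine (congrArg (treeHlgEquiv k τ) (PiTensorProduct.map₂_tprod_tprod _ a x)).trans ?_
        rw [treeHlgEquiv_tprod, treeHlgEquiv_tprod, tprod_eq_prod_factor]
        refine Eq.trans ?_ Finset.prod_mul_distrib
        refine Finset.prod_congr rfl fun v _ => ?_
        refine (congrArg (factor k τ v) (toCoh_hlgAct (a v) (x v))).trans ?_
        exact (factor k τ v).map_mul _ _
      rw [map_smul, map_smul, map_smul, LinearMap.smul_apply, map_smul, map_smul, h]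
      exact (((PiTensorProduct.mul (r • PiTensorProduct.tprod k a)).map_smul s _).trans
        (congrArg (s • ·) (PiTensorProduct.mul.map_smul₂ r (PiTensorProduct.tprod k a) _))).symm

variable {τ' τ : StableTree.{u}} (f : τ' ⟶ τ)

/-- The push-forward in homology along a morphism. -/
def pushHom : TreeHlg k τ' →ₗ[k] TreeHlg k τ :=
  (treeHlgEquiv k τ).symm.toLinearMap ∘ₗ (Contraction.isCollapse f).pushCoh k ∘ₗ
    (treeHlgEquiv k τ').toLinearMap

theorem treeHlgEquiv_pushHom (x : TreeHlg k τ') : treeHlgEquiv k τ (pushHom k f x) =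
    (Contraction.isCollapse f).pushCoh k (treeHlgEquiv k τ' x) :=
  (treeHlgEquiv k τ).apply_symm_apply _

/-- The projection formula. -/
theorem pushHom_treeAct (a : TreeCoh k τ) (x : TreeHlg k τ') :
    pushHom k f (treeAct (fun S => hlgAct k S) τ' (pullHom f k a) x) =
      treeAct (fun S => hlgAct k S) τ a (pushHom k f x) := by
  apply (treeHlgEquiv k τ).injective
  rw [treeHlgEquiv_pushHom, treeHlgEquiv_treeAct, treeHlgEquiv_treeAct, treeHlgEquiv_pushHom]
  exact GMap.IsCollapse.pushCoh_pull_mul _ k a _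

theorem pushHom_id : pushHom k (𝟙 τ) = LinearMap.id := by
  refine LinearMap.ext fun x => (treeHlgEquiv k τ).injective ?_
  rw [treeHlgEquiv_pushHom]
  exact DFunLike.congr_fun (GMap.IsCollapse.pushCoh_id (τ := τ) k) _

theorem pushHom_comp {τ'' : StableTree.{u}} (g : τ'' ⟶ τ') :
    pushHom k (g ≫ f) = (pushHom k f).comp (pushHom k g) := by
  refine LinearMap.ext fun x => (treeHlgEquiv k τ).injective ?_
  rw [LinearMap.comp_apply, treeHlgEquiv_pushHom, treeHlgEquiv_pushHom, treeHlgEquiv_pushHom]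
  exact DFunLike.congr_fun ((Contraction.isCollapse f).pushCoh_comp k (Contraction.isCollapse g)) _

variable {k}

/-- In cohomology a tensor product of monomials is the pull-back of such a product, and the
push-forward inverts the pull-back along an isomorphism. -/
theorem pushHom_of_isIso (hf : f.map.IsIso) (T : ∀ w : τ'.graph.V, STree (τ'.graph.flagsAt w))
    (y : ∀ v : τ.graph.V, Hlg k (τ.graph.flagsAt v))
    (hy : ∀ w, y (f.map.vert w) = mu k ((T w).relabel (hf.flagIso w))) :
    pushHom k f (PiTensorProduct.tprod k fun w => mu k (T w)) = PiTensorProduct.tprod k y := by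
  apply (treeHlgEquiv k τ).injective
  rw [treeHlgEquiv_pushHom, treeHlgEquiv_tprod, treeHlgEquiv_tprod]
  have h : ∏ w, factor k τ' w (toCoh k _ (mu k (T w))) =
      (Contraction.isCollapse f).pull k (∏ v, factor k τ v (toCoh k _ (y v))) := by
    rw [map_prod, ← hf.vert_bij.prod_comp]
    refine Finset.prod_congr rfl fun w _ => ?_
    rw [hy, toCoh_mu, toCoh_mu, ← STree.cohMap_monomialCls (hf.flagIso w) k (T w)]
    exact (GMap.IsCollapse.pull_factor_flagIso _ k w _ _ _).symm
  rw [h]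
  exact hf.pushCoh_pull k _

/-- In cohomology a tensor product of monomials is the pull-back of a product in which the monomials
at the ends of the edge are replaced by the monomial of the glued tree without the generator of the
new edge; the push-forward after the pull-back supplies this generator. -/
theorem pushHom_of_isEdgeContraction {e : τ'.graph.F} (hf : f.map.IsEdgeContraction e)
    (T : ∀ w : τ'.graph.V, STree (τ'.graph.flagsAt w))
    (y : ∀ v : τ.graph.V, Hlg k (τ.graph.flagsAt v))
    (hy : ∀ (w) (h₁ : w ≠ τ'.graph.bd e) (h₂ : w ≠ τ'.graph.bd (τ'.graph.inv e)),
      y (f.map.vert w) = mu k ((T w).relabel (hf.flagIso w h₁ h₂)))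
    (hy' : y (f.map.vert (τ'.graph.bd e)) = (hf.oneEdge τ'.stable).glueHom k
      (mu k (T (τ'.graph.bd e)) ⊗ₜ[k] mu k (T (τ'.graph.bd (τ'.graph.inv e))))) :
    pushHom k f (PiTensorProduct.tprod k fun w => mu k (T w)) = PiTensorProduct.tprod k y := by
  classical
  obtain ⟨a, ha⟩ := (hf.oneEdge τ'.stable).resHom_surjective
    ((T (τ'.graph.bd e)).monomialCls k ⊗ₜ[k] (T (τ'.graph.bd (τ'.graph.inv e))).monomialCls k)
  have hya : toCoh k _ (y (f.map.vert (τ'.graph.bd e))) =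
      a * cls k (hf.oneEdge τ'.stable).part := by
    rw [hy', OneEdge.toCoh_glueHom, TensorProduct.map_tmul, toCoh_mu, toCoh_mu, ← ha,
      OneEdge.pushCoh_resHom]
  have hbd : τ'.graph.bd e ≠ τ'.graph.bd (τ'.graph.inv e) :=
    Graph.bd_ne τ'.stable.toIsTree hf.edge
  apply (treeHlgEquiv k τ).injective
  rw [treeHlgEquiv_pushHom, treeHlgEquiv_tprod, treeHlgEquiv_tprod]
  have h1 : ∏ w ∈ (Finset.univ.erase (τ'.graph.bd e)).erase (τ'.graph.bd (τ'.graph.inv e)),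
      factor k τ' w (toCoh k _ (mu k (T w))) =
      (Contraction.isCollapse f).pull k (∏ v ∈ Finset.univ.erase (f.map.vert (τ'.graph.bd e)),
        factor k τ v (toCoh k _ (y v))) := by
    rw [map_prod]
    refine Finset.prod_bij (fun w _ => f.map.vert w) ?_ ?_ ?_ ?_
    · intro w hw
      simp only [Finset.mem_erase, Finset.mem_univ, and_true] at hw ⊢
      intro h
      rcases (hf.vert_eq _ _).1 h with h | h | h
      · exact hw.2 h
      · exact hw.2 h.1
      · exact hw.1 h.1
    · intro w hw w' hw' h
      simp only [Finset.mem_erase, Finset.mem_univ, and_true] at hw hw'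
      rcases (hf.vert_eq _ _).1 h with h | h | h
      · exact h
      · exact absurd h.1 hw.2
      · exact absurd h.1 hw.1
    · intro v hv
      obtain ⟨w, rfl⟩ := hf.vert_surj v
      refine ⟨w, ?_, rfl⟩
      simp only [Finset.mem_erase, Finset.mem_univ, and_true] at hv ⊢
      refine ⟨?_, ?_⟩
      · rintro rfl
        exact hv ((hf.vert_eq _ _).2 (Or.inr (Or.inr ⟨rfl, rfl⟩)))
      · rintro rfl
        exact hv rfl
    · intro w hw
      simp only [Finset.mem_erase, Finset.mem_univ, and_true] at hw
      rw [hy w hw.2 hw.1, toCoh_mu, toCoh_mu,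
        ← STree.cohMap_monomialCls (hf.flagIso w hw.2 hw.1) k (T w)]
      exact (GMap.IsCollapse.pull_factor_flagIso _ k w _ _ _).symm
  have h2 : factor k τ' (τ'.graph.bd e) (toCoh k _ (mu k (T (τ'.graph.bd e)))) *
      factor k τ' (τ'.graph.bd (τ'.graph.inv e))
        (toCoh k _ (mu k (T (τ'.graph.bd (τ'.graph.inv e))))) =
      (Contraction.isCollapse f).pull k (factor k τ (f.map.vert (τ'.graph.bd e)) a) := by
    rw [toCoh_mu, toCoh_mu]
    refine Eq.trans ?_ (hf.pull_factor k a).symm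
    rw [ha, Algebra.TensorProduct.productMap_apply_tmul]
  rw [← Finset.mul_prod_erase Finset.univ _ (Finset.mem_univ (τ'.graph.bd e)),
    ← Finset.mul_prod_erase _ _ (Finset.mem_erase.2 ⟨hbd.symm, Finset.mem_univ _⟩), ← mul_assoc,
    h1, h2, ← map_mul]
  refine (hf.pushCoh_pull k _).trans ?_
  rw [← Finset.mul_prod_erase Finset.univ _ (Finset.mem_univ (f.map.vert (τ'.graph.bd e))), hya,
    map_mul]
  exact mul_right_comm _ _ _

theorem isHlgFunctor_pushHom : IsHlgFunctor (k := k) (fun D => D.glueHom k)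
    (fun f => pushHom k f) where
  map_id _ := pushHom_id k
  map_comp g f := pushHom_comp k f g
  iso f hf T y hy := pushHom_of_isIso f hf T y hy
  edge f _ hf T y hy hy' := pushHom_of_isEdgeContraction f hf T y hy hy'

end Homology

/-! ### Uniqueness of the functors -/

section Uniqueness

variable {k : Type w} [CommRing k]
  {res : ∀ {S S₁ S₂ : PaintedSet.{u}}, OneEdge S S₁ S₂ → (Coh k S →ₐ[k] Coh k S₁ ⊗[k] Coh k S₂)}
  {glueMap : ∀ {S S₁ S₂ : PaintedSet.{u}},
      OneEdge S S₁ S₂ → (Hlg k S₁ ⊗[k] Hlg k S₂ →ₗ[k] Hlg k S)}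

/-- Every contraction is a composition of isomorphisms and contractions of single edges, for which
the values at the algebra generators are prescribed. -/
theorem IsCohFunctor.unique
    {pull₁ pull₂ : ∀ {τ' τ : StableTree.{u}}, (τ' ⟶ τ) → (TreeCoh k τ →ₐ[k] TreeCoh k τ')}
    (h₁ : IsCohFunctor res pull₁) (h₂ : IsCohFunctor res pull₂) {τ' τ : StableTree.{u}}
    (f : τ' ⟶ τ) : pull₁ f = pull₂ f := by
  obtain ⟨c, hc⟩ := f
  induction hc with
  | @iso σ τ c h =>
    refine treeCoh_algHom_ext (k := k) (τ := τ) (B := TreeCoh k σ) fun v A => ?_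
    obtain ⟨w, rfl⟩ := h.vert_bij.2 v
    exact (h₁.iso ⟨c, .iso c h⟩ h w A).trans (h₂.iso ⟨c, .iso c h⟩ h w A).symm
  | @edge σ τ c e h =>
    refine treeCoh_algHom_ext (k := k) (τ := τ) (B := TreeCoh k σ) fun v A => ?_
    by_cases hv : v = c.vert (σ.graph.bd e)
    · subst hv
      exact (h₁.edge ⟨c, .edge c e h⟩ e h _).trans (h₂.edge ⟨c, .edge c e h⟩ e h _).symm
    · obtain ⟨w, rfl⟩ := h.vert_surj v
      have hw : w ≠ σ.graph.bd e := fun h' => hv (congrArg c.vert h')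
      have hw' : w ≠ σ.graph.bd (σ.graph.inv e) := fun h' =>
        hv ((h.vert_eq _ _).2 (Or.inr (Or.inr ⟨h', rfl⟩)))
      exact (h₁.edge_other ⟨c, .edge c e h⟩ e h w hw hw' A).trans
        (h₂.edge_other ⟨c, .edge c e h⟩ e h w hw hw' A).symm
  | comp c d hc hd ihc ihd =>
    exact (h₁.map_comp ⟨c, hc⟩ ⟨d, hd⟩).trans ((congrArg₂ AlgHom.comp ihc ihd).trans
      (h₂.map_comp ⟨c, hc⟩ ⟨d, hd⟩).symm)

theorem treeHlg_ext {τ : StableTree.{u}} {M : Type*} [AddCommMonoid M] [Module k M]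
    {f g : TreeHlg k τ →ₗ[k] M}
    (h : ∀ T : ∀ v, STree (τ.graph.flagsAt v), f (PiTensorProduct.tprod k fun v => mu k (T v)) =
      g (PiTensorProduct.tprod k fun v => mu k (T v))) : f = g :=
  PiTensorProduct.ext_of_span_eq_top (γ := fun v => STree (τ.graph.flagsAt v))
    (g := fun _ T => mu k T) (fun _ => span_mu) h

/-- Every contraction is a composition of isomorphisms and contractions of single edges, for which
the values at the tensor products of classes of trees are prescribed. -/
theorem IsHlgFunctor.unique
    {push₁ push₂ : ∀ {τ' τ : StableTree.{u}}, (τ' ⟶ τ) → (TreeHlg k τ' →ₗ[k] TreeHlg k τ)}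
    (h₁ : IsHlgFunctor glueMap push₁) (h₂ : IsHlgFunctor glueMap push₂) {τ' τ : StableTree.{u}}
    (f : τ' ⟶ τ) : push₁ f = push₂ f := by
  obtain ⟨c, hc⟩ := f
  induction hc with
  | @iso σ τ c h =>
    refine treeHlg_ext (k := k) (τ := σ) (M := TreeHlg k τ) fun T => ?_
    have hy : ∀ v, ∃ z : Hlg k (τ.graph.flagsAt v), ∀ w, c.vert w = v →
        HEq z (mu k ((T w).relabel (h.flagIso w))) := by
      intro v
      obtain ⟨w, rfl⟩ := h.vert_bij.2 v
      refine ⟨mu k ((T w).relabel (h.flagIso w)), fun w' hw' => ?_⟩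
      obtain rfl := h.vert_bij.1 hw'
      rfl
    choose y hy using hy
    have hy' : ∀ w, y (c.vert w) = mu k ((T w).relabel (h.flagIso w)) :=
      fun w => eq_of_heq (hy _ w rfl)
    exact (h₁.iso ⟨c, .iso c h⟩ h T y hy').trans (h₂.iso ⟨c, .iso c h⟩ h T y hy').symm
  | @edge σ τ c e h =>
    refine treeHlg_ext (k := k) (τ := σ) (M := TreeHlg k τ) fun T => ?_
    have hy : ∀ v, ∃ z : Hlg k (τ.graph.flagsAt v),
        (∀ w (hw : w ≠ σ.graph.bd e) (hw' : w ≠ σ.graph.bd (σ.graph.inv e)), c.vert w = v →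
          HEq z (mu k ((T w).relabel (h.flagIso w hw hw')))) ∧
        (c.vert (σ.graph.bd e) = v → HEq z (glueMap (h.oneEdge σ.stable)
          (mu k (T (σ.graph.bd e)) ⊗ₜ[k] mu k (T (σ.graph.bd (σ.graph.inv e)))))) := by
      intro v
      by_cases hv : v = c.vert (σ.graph.bd e)
      · subst hv
        refine ⟨_, fun w hw hw' h' => ?_, fun _ => HEq.rfl⟩
        rcases (h.vert_eq _ _).1 h' with h' | h' | h'
        · exact absurd h' hw
        · exact absurd h'.1 hw
        · exact absurd h'.1 hw'
      · obtain ⟨w, rfl⟩ := h.vert_surj v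
        have hw : w ≠ σ.graph.bd e := fun h' => hv (congrArg c.vert h')
        have hw' : w ≠ σ.graph.bd (σ.graph.inv e) := fun h' =>
          hv ((h.vert_eq _ _).2 (Or.inr (Or.inr ⟨h', rfl⟩)))
        refine ⟨mu k ((T w).relabel (h.flagIso w hw hw')), fun w₁ hw₁ hw₁' h' => ?_,
          fun h' => absurd h'.symm hv⟩
        rcases (h.vert_eq _ _).1 h' with rfl | h' | h'
        · rfl
        · exact absurd h'.1 hw₁
        · exact absurd h'.1 hw₁'
    choose y hy hy' using hy
    have e₁ := fun w hw hw' => eq_of_heq (hy _ w hw hw' rfl)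
    have e₂ := eq_of_heq (hy' _ rfl)
    exact (h₁.edge ⟨c, .edge c e h⟩ e h T y e₁ e₂).trans
      (h₂.edge ⟨c, .edge c e h⟩ e h T y e₁ e₂).symm
  | comp c d hc hd ihc ihd =>
    exact (h₁.map_comp ⟨c, hc⟩ ⟨d, hd⟩).trans ((congrArg₂ LinearMap.comp ihd ihc).trans
      (h₂.map_comp ⟨c, hc⟩ ⟨d, hd⟩).symm)

end Uniqueness

end PaintedTrees

end

theorem theorem3p2 (k : Type w) [CommRing k] :
    ∃ (act : ∀ S : PaintedSet.{u}, Coh k S →ₐ[k] Module.End k (Hlg k S))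
      (res : ∀ {S S₁ S₂ : PaintedSet.{u}},
        OneEdge S S₁ S₂ → (Coh k S →ₐ[k] Coh k S₁ ⊗[k] Coh k S₂))
      (glueMap : ∀ {S S₁ S₂ : PaintedSet.{u}},
        OneEdge S S₁ S₂ → (Hlg k S₁ ⊗[k] Hlg k S₂ →ₗ[k] Hlg k S))
      (pull : ∀ {τ' τ : StableTree.{u}}, (τ' ⟶ τ) → (TreeCoh k τ →ₐ[k] TreeCoh k τ'))
      (push : ∀ {τ' τ : StableTree.{u}}, (τ' ⟶ τ) → (TreeHlg k τ' →ₗ[k] TreeHlg k τ)),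
      -- the action of cohomology on homology
      (∀ S, IsAction k (act S)) ∧
      -- the one-edge case in cohomology
      (∀ {S S₁ S₂ : PaintedSet.{u}} (D : OneEdge S S₁ S₂),
        D.IsRestriction k (res D) ∧
        Function.Surjective (res D) ∧
        ∀ (T₁ : STree S₁) (T₂ : STree S₂),
          res D ((D.glue T₁ T₂).monomialClsErase k (D.glueEdge T₁ T₂).edge) =
              T₁.monomialCls k ⊗ₜ[k] T₂.monomialCls k ∧
            res D ((D.glue T₁ T₂).monomialCls k) =
              res D (cls k D.part) * (T₁.monomialCls k ⊗ₜ[k] T₂.monomialCls k)) ∧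
      -- the one-edge case in homology
      (∀ {S S₁ S₂ : PaintedSet.{u}} (D : OneEdge S S₁ S₂),
        (∀ (T₁ : STree S₁) (T₂ : STree S₂),
          glueMap D (mu k T₁ ⊗ₜ[k] mu k T₂) = mu k (D.glue T₁ T₂)) ∧
        ∀ (a : Coh k S) (x : Hlg k S₁ ⊗[k] Hlg k S₂),
          glueMap D (TensorProduct.map₂ (act S₁).toLinearMap (act S₂).toLinearMap (res D a) x) =
            act S a (glueMap D x)) ∧
      -- functoriality, the values on isomorphisms and on contractions of one edge
      IsCohFunctor res pull ∧ IsHlgFunctor glueMap push ∧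
      -- compatibility
      (∀ {τ' τ : StableTree.{u}} (f : τ' ⟶ τ) (a : TreeCoh k τ) (x : TreeHlg k τ'),
        push f (treeAct act τ' (pull f a) x) = treeAct act τ a (push f x)) ∧
      -- the functors are determined by these values
      (∀ pull₁ : ∀ {τ' τ : StableTree.{u}}, (τ' ⟶ τ) → (TreeCoh k τ →ₐ[k] TreeCoh k τ'),
        IsCohFunctor res pull₁ → ∀ {τ' τ : StableTree.{u}} (f : τ' ⟶ τ), pull₁ f = pull f) ∧
      (∀ push₁ : ∀ {τ' τ : StableTree.{u}}, (τ' ⟶ τ) → (TreeHlg k τ' →ₗ[k] TreeHlg k τ),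
        IsHlgFunctor glueMap push₁ → ∀ {τ' τ : StableTree.{u}} (f : τ' ⟶ τ),
          push₁ f = push f) := by
  refine ⟨hlgAct k, fun D => D.resHom k, fun D => D.glueHom k, fun f => pullHom f k,
    fun f => pushHom k f, fun S => isAction_hlgAct, fun D => ⟨OneEdge.isRestriction_resHom,
      OneEdge.resHom_surjective, fun T₁ T₂ => ⟨D.resHom_monomialClsErase T₁ T₂ k, ?_⟩⟩,
    fun D => ⟨fun T₁ T₂ => D.glueHom_mu T₁ T₂, D.glueHom_act⟩, isCohFunctor_pullHom,
    isHlgFunctor_pushHom, fun f a x => pushHom_treeAct k f a x,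
    fun pull₁ h _ _ f => h.unique isCohFunctor_pullHom f,
    fun push₁ h _ _ f => h.unique isHlgFunctor_pushHom f⟩
  rw [D.monomialCls_glue T₁ T₂ k, map_mul, D.resHom_monomialClsErase T₁ T₂ k, mul_comm]
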